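/- **Setting.** Let $\varphi=\begin{pmatrix}a&b\\c&d\end{pmatrix}\in SL(2,\mathbb Z)$ with $|a+d|>2$, acting on slopes $\hat{\mathbb Q}=\mathbb Q\cup\{\infty\}$ by $\varphi_*(s)=\frac{c+ds}{a+bs}$, with repulsive and attractive fixed points $\mu_-,\mu_+\in\mathbb R$. Let $\{\sigma_n\}_{n\in\mathbb Z}$ be the bi-infinite sequence of Farey triangles crossed by the oriented geodesic $\ell$ of $\mathbb H^2$ from $\mu_-$ to $\mu_+$, in the order in which they are met, and let $f_n\in\{R,L\}$ be $R$ (resp. $L$) if $\ell$ exits $\sigma_n$ to the right (resp. left) of where it enters. Assume, as one may after conjugation and a shift of indices, that $\sigma_0=\langle 0,\infty,-1\rangle$, $\sigma_1=\langle 0,1,\infty\rangle$, $f_0=L$ and $f_1=R$. Put $n_+=\min\{k>n: f_k=f_n\}$ and $n_-=\max\{k<n: f_k=f_n\}$, and let $d(n)=2$ if $f_n=R$ and $d(n)=3$ if $f_n=L$. Let $G=\langle A,B,C\mid A^2=B^2=C^2=1\rangle$ be the orbifold fundamental group of the quotient of the punctured torus $T=(\mathbb R^2-\mathbb Z^2)/\mathbb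 Z^2$ by the hyper-elliptic involution, and $D=CBA$. Let $G$ act on $\mathbb Z^2$ with $A,B,C$ acting as $x\mapsto v-x$ for $v=(1,0),(1,1),(0,1)$. A triple $(P,P',P'')$ of elements of square $1$ that generates $G$ and satisfies $P''P'P=D$ is an *elliptic generator triple*; its members are *elliptic generators*, and the slope of an elliptic generator $P$ is $q/p$, where $P\cdot(0,0)=(p,q)$. The *sequence of elliptic generators* associated with a Farey triangle $\sigma$ is the sequence $\{P_j\}_{j\in\mathbb Z}$ (unique up to a shift of indices) whose consecutive triples are elliptic generator triples with set of slopes the vertex set of $\sigma$. Let $R,L$ also denote the automorphisms of $G$ with $R:(A,B,C)\mapsto(A,BCB^{-1},B)$ and $L:(A,B,C)\mapsto(B,BAB^{-1},C)$; let $\mathcal F_0=1$ and $\mathcal F_n=\mathcal F_{n-1}f_n$ for $n\in\mathbb Z$. Define, for $m,n\in\mathbb Z$, with $X_0=A$, $X_1=B$, $X_2=C$, $$Q_{3m+i,n}=\mathcal F_{n-1}(D^mX_iD^{-m})\ (i=0,1,2),\quad P_{2m,n}=D^m\mathcal F_{n-1}(B)D^{-m},\quad P_{2m+1,n}=D^m\mathcal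 F_n(CBC^{-1})D^{-m}.$$ *The complex $\Delta^*(\varphi)$* is (the geometric realization of) the $2$-dimensional simplicial complex whose vertices are the elliptic generators whose slope is a vertex of some $\sigma_n$; whose edges are the pairs of successive elements of the sequence of elliptic generators associated with some $\sigma_n$; and whose faces are the triples $(P,P',P'')$ of consecutive elements of the sequence associated with some $\sigma_n$ such that $P,P''$ are successive in the sequence associated with $\sigma_{n-1}$ or $\sigma_{n+1}$. *The complex $CW^*(\varphi)$* is obtained by collapsing each closed slanted edge to a point in the following CW-decomposition $CW'(\varphi)$ of $\mathbb R^2$. The vertices are $\mathbb Z^2$; the (straight) edges are the vertical edges $\langle(m,n),(m,n+1)\rangle$ and the slanted edges $\langle(2m,n),(2m+1,n_+)\rangle$ if $f_n=R$, $\langle(2m,n),(2m-1,n_+)\rangle$ if $f_n=L$; the faces are the convex hulls of $\{(2m,n_-),(2m,n),(2m+1,n),(2m+1,n_+)\}$ if $f_n=R$ and of $\{(2m-1,n),(2m-1,n_+),(2m,n_-),(2m,n)\}$ if $f_n=L$. *The complex $CW\Delta(\varphi)$* is the CW-decomposition of $\mathbb R^2$ with vertex set $\mathbb Z^2$ ($(m,n)$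 being labelled by $Q_{m,n}$) and the following straight edges, for $m,n\in\mathbb Z$. Horizontal: $\langle(m,n),(m+1,n)\rangle$. Vertical: $\langle(3m+1,n),(3m+1,n+1)\rangle$ and $\langle(3m+d(n),n),(3m+d(n+1),n+1)\rangle$. Slanted: $\langle(3m,n),(3m,n+1)\rangle$ and $\langle(3m+1,n),(3m+2,n+1)\rangle$ if $f_n=R$; $\langle(3m+1,n),(3m,n+1)\rangle$ and $\langle(3m+2,n),(3m+2,n+1)\rangle$ if $f_n=L$. An isomorphism of such complexes is a homeomorphism carrying the vertices, open edges and open faces of the one onto those of the other. **Proposition.** (1) Let $\Delta^{**}(\varphi)$ be obtained from $CW\Delta(\varphi)$ by removing (the interior of) each vertical edge and collapsing each slanted edge to a point. There is an isomorphism from $\Delta^{**}(\varphi)$ to $\Delta^*(\varphi)$ sending, for all $m,n$, the vertex represented by $(m,n)$ to the vertex $Q_{m,n}$. Composing with it, one obtains an isomorphism from $\Delta^{**}(\varphi)$ to every complex to which $\Delta^*(\varphi)$ is isomorphic. (2) Two vertices $(m,n)$ and $(m',n')$ of $CW'(\varphi)$ represent the same vertex of $CW^*(\varphi)$ if and only if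 $P_{m,n}=P_{m',n'}$, so that the vertices of $CW^*(\varphi)$ are identified with the elements $P_{m,n}$. Let $CW^{**}(\varphi)$ be obtained from $CW\Delta(\varphi)$ by removing (the interior of) each horizontal edge and collapsing each slanted edge to a point. There is an isomorphism from $CW^{**}(\varphi)$ to $CW^*(\varphi)$ sending, for all $m,n$, the vertex represented by $(3m+1,n)$ to $P_{2m,n}$ and the vertex represented by $(3m+d(n),n)$ to $P_{2m+1,n}$. Composing with it, one obtains an isomorphism from $CW^{**}(\varphi)$ to every complex to which $CW^*(\varphi)$ is isomorphic. -/

import Mathlib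

open Topology Matrix

namespace PTB

/-! ### The orbifold group and its elliptic generators -/

/-- The relators `X²` of the three generators. -/
def orbRels : Set (FreeGroup (Fin 3)) := {r | ∃ i, r = FreeGroup.of i * FreeGroup.of i}

/-- The orbifold fundamental group `⟨A, B, C | A² = B² = C² = 1⟩` of the
`(2,2,2,∞)`-orbifold. -/
abbrev Orb : Type := PresentedGroup orbRels

def A : Orb := PresentedGroup.of 0
def B : Orb := PresentedGroup.of 1
def C : Orb := PresentedGroup.of 2

/-- The distinguished (peripheral) element. -/
def D : Orb := C * B * A

theorem of_sq (i : Fin 3) : (PresentedGroup.of i : Orb) * PresentedGroup.of i = 1 :=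
  PresentedGroup.one_of_mem ⟨i, rfl⟩

theorem A_sq : A * A = 1 := of_sq 0
theorem B_sq : B * B = 1 := of_sq 1
theorem C_sq : C * C = 1 := of_sq 2

/-- The homomorphism out of `Orb` given by three elements of square one. -/
def orbLift {G : Type*} [Group G] (x y z : G) (hx : x * x = 1) (hy : y * y = 1)
    (hz : z * z = 1) : Orb →* G :=
  PresentedGroup.toGroup (f := ![x, y, z]) (by
    rintro r ⟨i, rfl⟩
    fin_cases i <;> simp [hx, hy, hz])

theorem orbLift_A {G : Type*} [Group G] {x y z : G} (hx : x * x = 1) (hy : y * y = 1)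
    (hz : z * z = 1) : orbLift x y z hx hy hz A = x :=
  PresentedGroup.toGroup.of _

theorem orbLift_B {G : Type*} [Group G] {x y z : G} (hx : x * x = 1) (hy : y * y = 1)
    (hz : z * z = 1) : orbLift x y z hx hy hz B = y :=
  PresentedGroup.toGroup.of _

theorem orbLift_C {G : Type*} [Group G] {x y z : G} (hx : x * x = 1) (hy : y * y = 1)
    (hz : z * z = 1) : orbLift x y z hx hy hz C = z :=
  PresentedGroup.toGroup.of _

theorem hom_ext {G : Type*} [Group G] {f g : Orb →* G} (hA : f A = g A) (hB : f B = g B)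
    (hC : f C = g C) : f = g := by
  apply PresentedGroup.ext
  intro i
  fin_cases i
  · exact hA
  · exact hB
  · exact hC

theorem conj_sq {x y : Orb} (hx : x * x = 1) (hy : y * y = 1) :
    (x * y * x) * (x * y * x) = 1 := by
  have h : (x * y * x) * (x * y * x) = x * (y * ((x * x) * (y * x))) := by group
  rw [h, hx, one_mul, ← mul_assoc y, hy, one_mul, hx]

theorem conj_conj {x y : Orb} (hx : x * x = 1) : x * (x * y * x) * x = y := by
  have h : x * (x * y * x) * x = (x * x) * y * (x * x) := by group
  rw [h, hx, one_mul, mul_one]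

/-- The right automorphism `(A, B, C) ↦ (A, B C B⁻¹, B)` (recall `B⁻¹ = B`). -/
def autR : MulAut Orb :=
  MonoidHom.toMulEquiv
    (orbLift A (B * C * B) B A_sq (conj_sq B_sq C_sq) B_sq)
    (orbLift A C (C * B * C) A_sq C_sq (conj_sq C_sq B_sq))
    (by
      apply hom_ext <;>
        simp only [MonoidHom.comp_apply, MonoidHom.id_apply, orbLift_A, orbLift_B, orbLift_C,
          map_mul, conj_conj C_sq])
    (by
      apply hom_ext <;>
        simp only [MonoidHom.comp_apply, MonoidHom.id_apply, orbLift_A, orbLift_B, orbLift_C,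
          map_mul, conj_conj B_sq])

/-- The left automorphism `(A, B, C) ↦ (B, B A B⁻¹, C)`. -/
def autL : MulAut Orb :=
  MonoidHom.toMulEquiv
    (orbLift B (B * A * B) C B_sq (conj_sq B_sq A_sq) C_sq)
    (orbLift (A * B * A) A C (conj_sq A_sq B_sq) A_sq C_sq)
    (by
      apply hom_ext <;>
        simp only [MonoidHom.comp_apply, MonoidHom.id_apply, orbLift_A, orbLift_B, orbLift_C,
          map_mul, conj_conj A_sq])
    (by
      apply hom_ext <;>
        simp only [MonoidHom.comp_apply, MonoidHom.id_apply, orbLift_A, orbLift_B, orbLift_C,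
          map_mul, conj_conj B_sq])

theorem subLeft_sq (v : ℤ × ℤ) : (Equiv.subLeft v : Equiv.Perm (ℤ × ℤ)) * Equiv.subLeft v = 1 := by
  ext x <;> simp

/-- The action of the orbifold group on the lattice of punctures of the universal abelian
cover `ℝ² - ℤ²` of the punctured torus, which is a covering of the orbifold: `A`, `B`, `C` are the
half-turns about the midpoints of the arcs from `(0,0)` to `(1,0)`, `(1,1)`, `(0,1)`. -/
def puncAct : Orb →* Equiv.Perm (ℤ × ℤ) :=
  orbLift (Equiv.subLeft (1, 0)) (Equiv.subLeft (1, 1)) (Equiv.subLeft (0, 1))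
    (subLeft_sq _) (subLeft_sq _) (subLeft_sq _)

/-- The slope `y / x ∈ ℚ ∪ {1/0}` of a vector `(x, y)`. -/
def slopeOf (v : ℤ × ℤ) : OnePoint ℚ :=
  if v.1 = 0 then OnePoint.infty else OnePoint.some ((v.2 : ℚ) / v.1)

/-- The slope of an elliptic generator `P`: the geodesic from `∞` (the fixed point of `D`, lying
over the puncture `(0,0)`) to `P(∞)` projects to an arc from `(0,0)` to `P · (0,0)`. -/
def ellSlope (P : Orb) : OnePoint ℚ := slopeOf (puncAct P (0, 0))

/-- A primitive integer vector of the given slope. -/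
def primVec : OnePoint ℚ → ℤ × ℤ
  | OnePoint.infty => (0, 1)
  | OnePoint.some s => (s.den, s.num)

/-- Two slopes are joined by an edge of the Farey tessellation. -/
def FareyAdj (r s : OnePoint ℚ) : Prop :=
  |(primVec r).1 * (primVec s).2 - (primVec r).2 * (primVec s).1| = 1

/-- (The vertex set of) a Farey triangle. -/
def IsFareyTriangle (τ : Set (OnePoint ℚ)) : Prop :=
  τ.ncard = 3 ∧ τ.Pairwise FareyAdj

/-- A bi-infinite sequence each of whose consecutive triples is an elliptic generator triple:
involutions that generate the orbifold group, with product the distinguished element. -/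
structure IsEllipticSequence (P : ℤ → Orb) : Prop where
  sq : ∀ j, P j * P j = 1
  prod : ∀ j, P (j + 2) * P (j + 1) * P j = D
  gen : ∀ j, Subgroup.closure {P j, P (j + 1), P (j + 2)} = ⊤

/-- `P` is the sequence of elliptic generators associated with the Farey triangle `τ`
(well defined up to a shift of indices). -/
structure IsAssociated (τ : Set (OnePoint ℚ)) (P : ℤ → Orb) : Prop extends
    IsEllipticSequence P where
  farey : IsFareyTriangle τ
  slopes : ∀ j, ({ellSlope (P j), ellSlope (P (j + 1)), ellSlope (P (j + 2))} : Set (OnePoint ℚ)) = τ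

def IsEllipticGenerator (X : Orb) : Prop :=
  ∃ τ P j, IsAssociated τ P ∧ P j = X

/-! ### The Farey triangles met by the axis of a hyperbolic element -/

/-- The action `s ↦ (c + d s) / (a + b s)` of `φ = (a b; c d)` on slopes. -/
def slopeMap (φ : SpecialLinearGroup (Fin 2) ℤ) (s : OnePoint ℚ) : OnePoint ℚ :=
  slopeOf (φ 0 0 * (primVec s).1 + φ 0 1 * (primVec s).2,
    φ 1 0 * (primVec s).1 + φ 1 1 * (primVec s).2)

/-- `μ` is the slope of an eigenvector `(1, μ)` of `φ` with eigenvalue `l`. -/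
def IsEigenSlope (φ : SpecialLinearGroup (Fin 2) ℤ) (l μ : ℝ) : Prop :=
  (φ 0 0 : ℝ) + φ 0 1 * μ = l ∧ (φ 1 0 : ℝ) + φ 1 1 * μ = l * μ

/-- `μ` is the attractive fixed point of `φ` on the circle of slopes. -/
def IsAttractive (φ : SpecialLinearGroup (Fin 2) ℤ) (μ : ℝ) : Prop :=
  ∃ l : ℝ, 1 < |l| ∧ IsEigenSlope φ l μ

/-- `μ` is the repulsive fixed point of `φ` on the circle of slopes. -/
def IsRepulsive (φ : SpecialLinearGroup (Fin 2) ℤ) (μ : ℝ) : Prop :=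
  ∃ l : ℝ, |l| < 1 ∧ IsEigenSlope φ l μ

/-- The slope lies to the right of the oriented geodesic of the upper half-plane from `μm` to
`μp`, i.e. on the arc of the circle from `μm` to `μp` in the increasing direction. -/
def OnRight (μm μp : ℝ) : OnePoint ℚ → Prop
  | OnePoint.infty => μp < μm
  | OnePoint.some s => if μm < μp then μm < s ∧ (s : ℝ) < μp else (s : ℝ) < μp ∨ μm < s

/-- The geodesic from `μm` to `μp` crosses the ideal triangle with vertex set `τ`. -/
def Crosses (μm μp : ℝ) (τ : Set (OnePoint ℚ)) : Prop :=
  (∃ r ∈ τ, OnRight μm μp r) ∧ ∃ r ∈ τ, ¬ OnRight μm μp r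

/-- `σ` is the bi-infinite sequence of Farey triangles crossed by the axis of `φ`, in the order in
which they are met on the way from the repulsive fixed point `μm` to the attractive one `μp`. -/
structure IsFareySequence (φ : SpecialLinearGroup (Fin 2) ℤ) (μm μp : ℝ)
    (σ : ℤ → Set (OnePoint ℚ)) : Prop where
  inj : Function.Injective σ
  range : Set.range σ = {τ | IsFareyTriangle τ ∧ Crosses μm μp τ}
  /-- consecutive triangles share an edge -/
  adj : ∀ n, (σ n ∩ σ (n + 1)).ncard = 2
  /-- the order is the one in which `φ` translates its axis -/
  dir : ∃ p : ℤ, 0 < p ∧ ∀ n, slopeMap φ '' σ n = σ (n + p)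

inductive Letter : Type
  | R
  | L

open Classical in
/-- The `n`-th letter: `R` or `L` according as the axis exits `σ n` to the right or to the left of
where it enters, i.e. according as the vertex common to the edge of entry and the edge of
exit lies to the right or to the left of the axis. -/
noncomputable def turn (μm μp : ℝ) (σ : ℤ → Set (OnePoint ℚ)) (n : ℤ) : Letter :=
  if ∃ v ∈ σ (n - 1) ∩ σ n ∩ σ (n + 1), OnRight μm μp v then Letter.R else Letter.L

/-! ### The elliptic generators `P_{m,n}` and `Q_{m,n}` -/

def letterAut : Letter → MulAut Orb
  | Letter.R => autR
  | Letter.L => autL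

/-- `F n` for `n ≥ 0`. -/
def Fpos (f : ℤ → Letter) : ℕ → MulAut Orb
  | 0 => 1
  | n + 1 => Fpos f n * letterAut (f (n + 1))

/-- `F (-n)` for `n ≥ 0`. -/
def Fneg (f : ℤ → Letter) : ℕ → MulAut Orb
  | 0 => 1
  | n + 1 => Fneg f n * (letterAut (f (-n)))⁻¹

/-- The automorphisms with `F 0 = 1` and `F n = F (n - 1) * f n` for all integers `n`
(see `F_zero`, `F_rec`). -/
def F (f : ℤ → Letter) : ℤ → MulAut Orb
  | Int.ofNat n => Fpos f n
  | Int.negSucc n => Fneg f (n + 1)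

theorem F_zero (f : ℤ → Letter) : F f 0 = 1 := rfl

theorem F_rec (f : ℤ → Letter) (n : ℤ) : F f n = F f (n - 1) * letterAut (f n) := by
  rcases n with (_ | n) | n
  · change (1 : MulAut Orb) = Fneg f 1 * letterAut (f 0)
    simp [Fneg]
  · have h : Int.ofNat (n + 1) - 1 = Int.ofNat n := by simp
    rw [h]; rfl
  · have h : Int.negSucc n - 1 = Int.negSucc (n + 1) := rfl
    have h' : Int.negSucc n = -((n + 1 : ℕ) : ℤ) := rfl
    rw [h]
    change Fneg f (n + 1) = Fneg f (n + 1) * (letterAut (f (-((n + 1 : ℕ) : ℤ))))⁻¹ * _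
    rw [← h']; simp

/-- The sequence `…, A, B, C, D A D⁻¹, D B D⁻¹, D C D⁻¹, …` starting with `A` at index `0`. -/
def Q₁ (m : ℤ) : Orb :=
  MulAut.conj (D ^ (m / 3)) (if m % 3 = 0 then A else if m % 3 = 1 then B else C)

/-- `Q_{m,n}` -/
def Q (f : ℤ → Letter) (m n : ℤ) : Orb := F f (n - 1) (Q₁ m)

/-- `P_{m,n}` -/
def P (f : ℤ → Letter) (m n : ℤ) : Orb :=
  if m % 2 = 0 then MulAut.conj (D ^ (m / 2)) (F f (n - 1) B)
  else MulAut.conj (D ^ (m / 2)) (F f n (MulAut.conj C B))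

/-! ### Cell decompositions, removal and collapse of edges -/

/-- The cells of dimension `0`, `1`, `2` of a two-dimensional cell decomposition of `X`; edges and
faces are given as open cells. -/
structure CellDecomp (X : Type*) where
  verts : Set X
  edges : Set (Set X)
  faces : Set (Set X)

/-- The connected components of `U`. -/
def components {X : Type*} [TopologicalSpace X] (U : Set X) : Set (Set X) :=
  {V | ∃ x ∈ U, V = connectedComponentIn U x}

/-- Remove (the interior of) each edge in `S`: the new faces are the components of what the
old faces and the removed open edges form together. -/
def CellDecomp.removeEdges {X : Type*} [TopologicalSpace X] (K : CellDecomp X)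
    (S : Set (Set X)) : CellDecomp X where
  verts := K.verts
  edges := K.edges \ S
  faces := components (⋃₀ K.faces ∪ ⋃₀ S)

/-- The quotient space in which each closed edge `closure e`, `e ∈ S`, becomes a point. -/
abbrev Collapse {X : Type*} [TopologicalSpace X] (S : Set (Set X)) : Type _ :=
  Quot fun x y : X => ∃ e ∈ S, x ∈ closure e ∧ y ∈ closure e

/-- The image in the collapsed space of a point. -/
def Collapse.mk {X : Type*} [TopologicalSpace X] (S : Set (Set X)) (x : X) : Collapse S :=
  Quot.mk _ x

/-- Collapse each closed edge in `S` to a point. -/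
def CellDecomp.collapse {X : Type*} [TopologicalSpace X] (K : CellDecomp X)
    (S : Set (Set X)) : CellDecomp (Collapse S) where
  verts := Collapse.mk S '' K.verts
  edges := Set.image (Collapse.mk S) '' (K.edges \ S)
  faces := Set.image (Collapse.mk S) '' K.faces

/-- Isomorphisms of cell decompositions: homeomorphisms that carry the cells of each dimension
onto the cells of the same dimension. -/
structure CellIso {X Y : Type*} [TopologicalSpace X] [TopologicalSpace Y]
    (K : CellDecomp X) (K' : CellDecomp Y) extends X ≃ₜ Y where
  map_verts : toFun '' K.verts = K'.verts
  map_edges : Set.image toFun '' K.edges = K'.edges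
  map_faces : Set.image toFun '' K.faces = K'.faces

/-! ### Geometric realization of a simplicial complex -/

/-- The underlying space of a simplicial complex: barycentric coordinates supported on a
simplex. -/
def Realization {V : Type*} (K : PreAbstractSimplicialComplex V) : Type _ :=
  {w : V → ℝ // (∀ v, 0 ≤ w v) ∧ ∃ s ∈ K.faces, (∀ v ∉ s, w v = 0) ∧ ∑ v ∈ s, w v = 1}

/-- The closed simplex spanned by `s`, as a subspace of `V → ℝ`. -/
def ClosedSimplex {V : Type*} (s : Finset V) : Type _ :=
  {w : V → ℝ // (∀ v, 0 ≤ w v) ∧ (∀ v ∉ s, w v = 0) ∧ ∑ v ∈ s, w v = 1}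

instance {V : Type*} (s : Finset V) : TopologicalSpace (ClosedSimplex s) :=
  inferInstanceAs (TopologicalSpace {_w : V → ℝ // _})

/-- The inclusion of a closed simplex into the realization. -/
def ClosedSimplex.incl {V : Type*} {K : PreAbstractSimplicialComplex V} (s : K.faces)
    (x : ClosedSimplex s.1) : Realization K :=
  ⟨x.1, x.2.1, s.1, s.2, x.2.2⟩

/-- The weak topology: a set is open iff its intersection with each closed simplex is open. -/
instance {V : Type*} (K : PreAbstractSimplicialComplex V) : TopologicalSpace (Realization K) :=
  ⨆ s : K.faces, TopologicalSpace.coinduced (ClosedSimplex.incl s) inferInstance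

/-- The open simplex spanned by `s`. -/
def openSimplex {V : Type*} (K : PreAbstractSimplicialComplex V) (s : Finset V) :
    Set (Realization K) :=
  {x | ∀ v, x.1 v ≠ 0 ↔ v ∈ s}

/-- The cell decomposition of the realization of a two-dimensional simplicial complex. -/
def simplicialCells {V : Type*} (K : PreAbstractSimplicialComplex V) :
    CellDecomp (Realization K) where
  verts := {x | ∃ s ∈ K.faces, s.card = 1 ∧ x ∈ openSimplex K s}
  edges := {e | ∃ s ∈ K.faces, s.card = 2 ∧ e = openSimplex K s}
  faces := {c | ∃ s ∈ K.faces, s.card = 3 ∧ c = openSimplex K s}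

/-! ### The complex `Δ*(φ)` -/

/-- The vertices of `Δ*(φ)`: elliptic generators whose slope is a vertex of some `σ n`. -/
def IsDeltaVertex (σ : ℤ → Set (OnePoint ℚ)) (X : Orb) : Prop :=
  IsEllipticGenerator X ∧ ∃ n, ellSlope X ∈ σ n

/-- The edges of `Δ*(φ)`: two successive elements in the sequence of elliptic generators associated
with some `σ n`. -/
def IsDeltaEdge (σ : ℤ → Set (OnePoint ℚ)) (X Y : Orb) : Prop :=
  ∃ n p j, IsAssociated (σ n) p ∧ p j = X ∧ p (j + 1) = Y

/-- The faces of `Δ*(φ)`: elliptic generator triples `(X, Y, Z)` associated with some `σ n` such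
that `X`, `Z` are successive in the sequence associated with `σ (n - 1)` or `σ (n + 1)`. -/
def IsDeltaFace (σ : ℤ → Set (OnePoint ℚ)) (X Y Z : Orb) : Prop :=
  ∃ n, (∃ p j, IsAssociated (σ n) p ∧ p j = X ∧ p (j + 1) = Y ∧ p (j + 2) = Z) ∧
    ∃ n', (n' = n - 1 ∨ n' = n + 1) ∧
      ∃ p' i, IsAssociated (σ n') p' ∧ p' i = X ∧ p' (i + 1) = Z

theorem IsAssociated.isDeltaVertex {σ : ℤ → Set (OnePoint ℚ)} {n : ℤ} {p : ℤ → Orb}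
    (h : IsAssociated (σ n) p) (j : ℤ) : IsDeltaVertex σ (p j) :=
  ⟨⟨σ n, p, j, h, rfl⟩, n, by rw [← h.slopes j]; simp⟩

theorem IsDeltaFace.edges {σ : ℤ → Set (OnePoint ℚ)} {X Y Z : Orb} (h : IsDeltaFace σ X Y Z) :
    IsDeltaEdge σ X Y ∧ IsDeltaEdge σ Y Z ∧ IsDeltaEdge σ X Z := by
  obtain ⟨n, ⟨p, j, hp, rfl, rfl, rfl⟩, n', -, p', i, hp', h1, h2⟩ := h
  exact ⟨⟨n, p, j, hp, rfl, rfl⟩, ⟨n, p, j + 1, hp, rfl, by congr 1; ring⟩,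
    ⟨n', p', i, hp', h1, h2⟩⟩

theorem IsDeltaEdge.verts {σ : ℤ → Set (OnePoint ℚ)} {X Y : Orb} (h : IsDeltaEdge σ X Y) :
    IsDeltaVertex σ X ∧ IsDeltaVertex σ Y := by
  obtain ⟨n, p, j, hp, rfl, rfl⟩ := h
  exact ⟨hp.isDeltaVertex j, hp.isDeltaVertex (j + 1)⟩

open Classical in
/-- The simplicial complex `Δ*(φ)`. -/
noncomputable def DeltaStar (σ : ℤ → Set (OnePoint ℚ)) : PreAbstractSimplicialComplex Orb where
  faces := {s | (∃ X, IsDeltaVertex σ X ∧ s = {X}) ∨ (∃ X Y, IsDeltaEdge σ X Y ∧ s = {X, Y}) ∨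
    ∃ X Y Z, IsDeltaFace σ X Y Z ∧ s = {X, Y, Z}}
  isRelLowerSet_faces := by
    intro s hs
    refine ⟨?_, ?_⟩
    · rcases hs with ⟨X, -, rfl⟩ | ⟨X, Y, -, rfl⟩ | ⟨X, Y, Z, -, rfl⟩ <;> simp
    · have hE : ∀ X Y, IsDeltaEdge σ X Y → ∀ t : Finset Orb, t ⊆ {X, Y} → t.Nonempty →
          (∃ X, IsDeltaVertex σ X ∧ t = {X}) ∨ ∃ X Y, IsDeltaEdge σ X Y ∧ t = {X, Y} := by
        intro X Y h t ht hne
        by_cases hX : X ∈ t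
        · by_cases hY : Y ∈ t
          · exact Or.inr ⟨X, Y, h, by grind⟩
          · exact Or.inl ⟨X, h.verts.1, by grind⟩
        · exact Or.inl ⟨Y, h.verts.2, by
            obtain ⟨z, hz⟩ := hne
            grind⟩
      intro t ht hne
      rcases hs with ⟨X, h, rfl⟩ | ⟨X, Y, h, rfl⟩ | ⟨X, Y, Z, h, rfl⟩
      · exact Or.inl ⟨X, h, by
          obtain ⟨z, hz⟩ := hne
          have := Finset.subset_singleton_iff.1 ht
          grind⟩
      · rcases hE X Y h t ht hne with h' | h'
        · exact Or.inl h'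
        · exact Or.inr (Or.inl h')
      · have key : ∀ X' Y', IsDeltaEdge σ X' Y' → t ⊆ {X', Y'} →
            t ∈ {s : Finset Orb | (∃ X, IsDeltaVertex σ X ∧ s = {X}) ∨
              (∃ X Y, IsDeltaEdge σ X Y ∧ s = {X, Y}) ∨
              ∃ X Y Z, IsDeltaFace σ X Y Z ∧ s = {X, Y, Z}} := by
          intro X' Y' h' ht'
          rcases hE X' Y' h' t ht' hne with h'' | h''
          · exact Or.inl h''
          · exact Or.inr (Or.inl h'')
        by_cases hX : X ∈ t
        · by_cases hY : Y ∈ t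
          · by_cases hZ : Z ∈ t
            · refine Or.inr (Or.inr ⟨X, Y, Z, h, Finset.Subset.antisymm ht ?_⟩)
              intro z hz
              simp only [Finset.mem_insert, Finset.mem_singleton] at hz
              rcases hz with rfl | rfl | rfl <;> assumption
            · exact key X Y h.edges.1 (by grind)
          · exact key X Z h.edges.2.2 (by grind)
        · exact key Y Z h.edges.2.1 (by grind)

/-! ### The decompositions `CW'(φ)` and `CWΔ(φ)` of the plane -/

/-- The lattice point `(m, n)` of the plane. -/
def pt (m n : ℤ) : ℝ × ℝ := (m, n)

/-- The open straight edge with endpoints `(m, n)` and `(m', n')`. -/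
def edge (m n m' n' : ℤ) : Set (ℝ × ℝ) := openSegment ℝ (pt m n) (pt m' n')

/-- The next index with the same letter. -/
noncomputable def nextIdx (f : ℤ → Letter) (n : ℤ) : ℤ := sInf {k | f k = f n ∧ n < k}

/-- The previous index with the same letter. -/
noncomputable def prevIdx (f : ℤ → Letter) (n : ℤ) : ℤ := sSup {k | f k = f n ∧ k < n}

/-- The slanted edges of `CW'(φ)`. -/
def slanted' (f : ℤ → Letter) : Set (Set (ℝ × ℝ)) :=
  {e | ∃ m n, f n = Letter.R ∧ e = edge (2 * m) n (2 * m + 1) (nextIdx f n)} ∪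
  {e | ∃ m n, f n = Letter.L ∧ e = edge (2 * m) n (2 * m - 1) (nextIdx f n)}

/-- The vertical edges of `CW'(φ)`. -/
def vertical' : Set (Set (ℝ × ℝ)) := {e | ∃ m n, e = edge m n m (n + 1)}

/-- The open `2`-cells of `CW'(φ)`. -/
def cell' (f : ℤ → Letter) (m n : ℤ) : Set (ℝ × ℝ) :=
  match f n with
  | Letter.R => interior (convexHull ℝ
      {pt (2 * m) (prevIdx f n), pt (2 * m) n, pt (2 * m + 1) n, pt (2 * m + 1) (nextIdx f n)})
  | Letter.L => interior (convexHull ℝ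
      {pt (2 * m - 1) n, pt (2 * m - 1) (nextIdx f n), pt (2 * m) (prevIdx f n), pt (2 * m) n})

/-- The CW-decomposition `CW'(φ)` of the plane. -/
def CW' (f : ℤ → Letter) : CellDecomp (ℝ × ℝ) where
  verts := {x | ∃ m n, x = pt m n}
  edges := vertical' ∪ slanted' f
  faces := {c | ∃ m n, c = cell' f m n}

/-- The CW-complex `CW*(φ)`, obtained from `CW'(φ)` by collapsing the closed slanted edges. -/
def CWStar (f : ℤ → Letter) : CellDecomp (Collapse (slanted' f)) :=
  (CW' f).collapse (slanted' f)

/-- `d(n)` is `2` or `3` according as the `n`-th letter is `R` or `L`. -/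
def d (f : ℤ → Letter) (n : ℤ) : ℤ :=
  match f n with
  | Letter.R => 2
  | Letter.L => 3

/-- The horizontal edges of `CWΔ(φ)`. -/
def horizontal : Set (Set (ℝ × ℝ)) := {e | ∃ m n, e = edge m n (m + 1) n}

/-- The vertical edges of `CWΔ(φ)`. -/
def vertical (f : ℤ → Letter) : Set (Set (ℝ × ℝ)) :=
  {e | ∃ m n, e = edge (3 * m + 1) n (3 * m + 1) (n + 1)} ∪
  {e | ∃ m n, e = edge (3 * m + d f n) n (3 * m + d f (n + 1)) (n + 1)}

/-- The slanted edges of `CWΔ(φ)`. -/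
def slanted (f : ℤ → Letter) : Set (Set (ℝ × ℝ)) :=
  {e | ∃ m n, f n = Letter.R ∧
    (e = edge (3 * m) n (3 * m) (n + 1) ∨ e = edge (3 * m + 1) n (3 * m + 2) (n + 1))} ∪
  {e | ∃ m n, f n = Letter.L ∧
    (e = edge (3 * m + 1) n (3 * m) (n + 1) ∨ e = edge (3 * m + 2) n (3 * m + 2) (n + 1))}

/-- The CW-decomposition of the plane with the given vertices and (open) edges: the faces are the
components of the complement of the `1`-skeleton. -/
def planar (V : Set (ℝ × ℝ)) (E : Set (Set (ℝ × ℝ))) : CellDecomp (ℝ × ℝ) where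
  verts := V
  edges := E
  faces := components (V ∪ ⋃₀ E)ᶜ

/-- The CW-decomposition `CWΔ(φ)` of the plane. -/
def CWDelta (f : ℤ → Letter) : CellDecomp (ℝ × ℝ) :=
  planar {x | ∃ m n, x = pt m n} (horizontal ∪ vertical f ∪ slanted f)

/-- `Δ**(φ)`: remove the vertical edges of `CWΔ(φ)`, then collapse the slanted ones. -/
def DeltaStarStar (f : ℤ → Letter) : CellDecomp (Collapse (slanted f)) :=
  ((CWDelta f).removeEdges (vertical f)).collapse (slanted f)

/-- `CW**(φ)`: remove the horizontal edges of `CWΔ(φ)`, then collapse the slanted ones. -/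
def CWStarStar (f : ℤ → Letter) : CellDecomp (Collapse (slanted f)) :=
  ((CWDelta f).removeEdges horizontal).collapse (slanted f)

end PTB

open PTB

namespace PTB

/-! ### A faithful action of the orbifold group on the projective line -/

/-! The proof has an algebraic half, which identifies all the generators and sequences involved, and
a topological half, which compares quotients of one parameter space.

Algebra. Passing from level `n` to level `n + 1` retains two of every three members of the sequence
`Q f · n`, because `autR` fixes `A` and sends `C` to `B`, while `autL` sends `A` to `B` and fixes
`C`. These coincidences run exactly along the slanted edges. Hence every `Q f j n` equals some `Q f
(3 * m + 1) i`, where `i` is `n` or the last index below `n` carrying a given letter (`Q_eq_gen`),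
and the elements `Q f (3 * m + 1) i` are pairwise distinct (`gen_injective`). Questions about edges
and faces become arithmetic with last occurrences; both letters recur since the letter sequence is
periodic under `φ` (`letters_unbounded`).

The sequences associated with `σ n` must be shown to be the shifts of `Q f · n`. On the side of
slopes, `farey_eq_tri` follows the axis in both directions, using a quadratic form whose sign tells
the sides of the axis apart and whose parallelogram law decides every turn; `orientation` supplies
the starting signs. On the side of the group, nontrivial involutions act as half-turns of the
hyperbolic plane, and the lower left matrix entries of a triple with product `D` satisfy the Markov
equation `x² + y² + z² = 3xyz` (`markov`). Vieta descent (`descendant_of_triple`) brings every such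
triple down to a consecutive triple of `Q₁`; moves upwards leave the slopes of the original triangle
for good, so slopes determine the elements (`exists_eq_Q`, `eq_Q_of_slopes`). The faithfulness of
the half-turn action, proved by ping-pong, allows equalities to be read off matrices.

Topology. Two quotient maps with the same fibres have homeomorphic targets
(`exists_homeomorph_of_isQuotientMap`). The common source is a disjoint union of squares, one for
each region between successive curves in each horizontal strip. It maps onto the plane by `strip`,
and onto the realization of `Δ*(φ)` by the barycentric maps `charMap`, each square covering one
triangle. The fibres of `strip` followed by the collapse of the slanted edges are those of
`charMap`; this gives (1) in `exists_star_iso`.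

For (2), the vertical and slanted edges of `CWΔ(φ)` and the edges of `CW'(φ)`, cut at integral
heights, are two families of curves in the same combinatorial position. The two `strip` maps have
equal fibres, so there is a homeomorphism of the plane (`exists_plane_homeomorph`). It carries
chains of slanted edges of `CWΔ(φ)` onto the long slanted edges of `CW'(φ)`, is compatible with both
collapses, and matches the `1`-skeleta; faces are the components of the complements
(`exists_cw_iso`). The identification of the vertices with the `P f m n` comes from (1) through this
homeomorphism. -/

open Matrix.SpecialLinearGroup in
/-- The action of the modular group on the rational projective line by Möbius transformations. -/
noncomputable def mob : SpecialLinearGroup (Fin 2) ℤ →* Equiv.Perm (OnePoint ℚ) :=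
  (MulAction.toPermHom (GL (Fin 2) ℚ) (OnePoint ℚ)).comp
    (toGL.comp (SpecialLinearGroup.map (Int.castRingHom ℚ)))

theorem mob_some (M : SpecialLinearGroup (Fin 2) ℤ) (s : ℚ) :
    mob M (OnePoint.some s) = if (M 1 0 : ℚ) * s + M 1 1 = 0 then OnePoint.infty else
      OnePoint.some (((M 0 0 : ℚ) * s + M 0 1) / (M 1 0 * s + M 1 1)) :=
  OnePoint.smul_some_eq_ite

theorem mob_infty (M : SpecialLinearGroup (Fin 2) ℤ) :
    mob M OnePoint.infty = if (M 1 0 : ℚ) = 0 then OnePoint.infty else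
      OnePoint.some ((M 0 0 : ℚ) / M 1 0) :=
  OnePoint.smul_infty_eq_ite _

theorem sl_ext {M N : SpecialLinearGroup (Fin 2) ℤ} (h1 : M 0 0 = N 0 0) (h2 : M 0 1 = N 0 1)
    (h3 : M 1 0 = N 1 0) (h4 : M 1 1 = N 1 1) : M = N := by
  ext i j; fin_cases i <;> fin_cases j <;> assumption

theorem sl_mul_apply (M N : SpecialLinearGroup (Fin 2) ℤ) (i j : Fin 2) :
    (M * N) i j = M i 0 * N 0 j + M i 1 * N 1 j := by
  change ((M : Matrix (Fin 2) (Fin 2) ℤ) * (N : Matrix (Fin 2) (Fin 2) ℤ)) i j = _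
  rw [Matrix.mul_apply, Fin.sum_univ_two]

theorem T_zpow_entries (k : ℤ) : (ModularGroup.T ^ k) 0 0 = 1 ∧ (ModularGroup.T ^ k) 0 1 = k ∧
    (ModularGroup.T ^ k) 1 0 = 0 ∧ (ModularGroup.T ^ k) 1 1 = 1 := by
  have := ModularGroup.coe_T_zpow k
  refine ⟨?_, ?_, ?_, ?_⟩ <;> exact (congrFun (congrFun this _) _).trans (by simp)

theorem mob_eq_one {M : SpecialLinearGroup (Fin 2) ℤ} (h : mob M = 1) : M = 1 ∨ M = -1 := by
  have hd := M.det_coe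
  rw [Matrix.det_fin_two] at hd
  have hc : M 1 0 = 0 := by
    have := mob_infty M
    rw [h] at this
    by_contra hc
    rw [if_neg (by exact_mod_cast hc)] at this
    exact OnePoint.infty_ne_coe _ this
  rw [hc, mul_zero, sub_zero] at hd
  have hd0 : (M 1 1 : ℚ) ≠ 0 := by
    intro h0
    have : M 1 1 = 0 := by exact_mod_cast h0
    rw [this] at hd; simp at hd
  have hb : M 0 1 = 0 := by
    have := mob_some M 0
    rw [h, hc] at this
    simp only [Equiv.Perm.one_apply, Int.cast_zero, mul_zero, zero_add, if_neg hd0] at this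
    have := OnePoint.coe_injective this
    rw [eq_comm, div_eq_zero_iff] at this
    exact_mod_cast this.resolve_right hd0
  rcases Int.eq_one_or_neg_one_of_mul_eq_one' hd with ⟨h1, h2⟩ | ⟨h1, h2⟩
  · left; apply sl_ext <;> simp [h1, h2, hb, hc]
  · right; apply sl_ext <;> simp [h1, h2, hb, hc]

theorem mob_neg (M : SpecialLinearGroup (Fin 2) ℤ) : mob (-M) = mob M := by
  ext x
  induction x using OnePoint.rec with
  | infty => simp [mob_infty, neg_div_neg_eq]
  | coe s =>
    rw [mob_some, mob_some]
    have h : ((-M) 1 0 : ℚ) * s + (-M) 1 1 = -((M 1 0 : ℚ) * s + M 1 1) := by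
      simp; ring
    have h' : ((-M) 0 0 : ℚ) * s + (-M) 0 1 = -((M 0 0 : ℚ) * s + M 0 1) := by
      simp; ring
    simp only [h, h', neg_eq_zero, neg_div_neg_eq]

theorem mob_eq_mob {M N : SpecialLinearGroup (Fin 2) ℤ} (h : mob M = mob N) :
    M = N ∨ M = -N := by
  have : mob (M * N⁻¹) = 1 := by rw [map_mul, map_inv, h, mul_inv_cancel]
  rcases mob_eq_one this with h | h
  · left; exact mul_inv_eq_one.1 h
  · right; rw [mul_inv_eq_iff_eq_mul.1 h]; simp

open ModularGroup in
/-- The half-turn about the point `j + i` of the upper half-plane. -/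
def halfTurn (j : ℤ) : SpecialLinearGroup (Fin 2) ℤ := T ^ j * S * T ^ (-j)

theorem halfTurn_entries (j : ℤ) : halfTurn j 0 0 = j ∧ halfTurn j 0 1 = -1 - j * j ∧
    halfTurn j 1 0 = 1 ∧ halfTurn j 1 1 = -j := by
  obtain ⟨a1, a2, a3, a4⟩ := T_zpow_entries j
  obtain ⟨b1, b2, b3, b4⟩ := T_zpow_entries (-j)
  have s1 : ModularGroup.S 0 0 = 0 := rfl
  have s2 : ModularGroup.S 0 1 = -1 := rfl
  have s3 : ModularGroup.S 1 0 = 1 := rfl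
  have s4 : ModularGroup.S 1 1 = 0 := rfl
  simp only [halfTurn, sl_mul_apply, a1, a2, a3, a4, b1, b2, b3, b4, s1, s2, s3, s4]
  refine ⟨?_, ?_, ?_, ?_⟩ <;> ring

theorem S_mul_S : ModularGroup.S * ModularGroup.S = -1 := by
  apply sl_ext <;> rw [sl_mul_apply] <;> rfl

theorem mob_halfTurn_sq (j : ℤ) : mob (halfTurn j) * mob (halfTurn j) = 1 := by
  rw [← map_mul]
  have : halfTurn j * halfTurn j = -1 := by
    have h : halfTurn j * halfTurn j = ModularGroup.T ^ j * (ModularGroup.S * ModularGroup.S) *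
      ModularGroup.T ^ (-j) := by unfold halfTurn; group
    rw [h, S_mul_S]; simp
  rw [this, mob_neg, map_one]

/-- The action of the orbifold group through half-turns about `i`, `1 + i`, `2 + i`. -/
noncomputable def orbMob : Orb →* Equiv.Perm (OnePoint ℚ) :=
  orbLift (mob (halfTurn 0)) (mob (halfTurn 1)) (mob (halfTurn 2))
    (mob_halfTurn_sq 0) (mob_halfTurn_sq 1) (mob_halfTurn_sq 2)

theorem orbMob_D : orbMob D = mob (ModularGroup.T ^ (3 : ℤ)) := by
  unfold D orbMob
  rw [map_mul, map_mul, orbLift_A, orbLift_B, orbLift_C, ← map_mul, ← map_mul]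
  congr 1
  obtain ⟨a1, a2, a3, a4⟩ := halfTurn_entries 0
  obtain ⟨b1, b2, b3, b4⟩ := halfTurn_entries 1
  obtain ⟨c1, c2, c3, c4⟩ := halfTurn_entries 2
  obtain ⟨t1, t2, t3, t4⟩ := T_zpow_entries 3
  apply sl_ext <;>
    simp only [sl_mul_apply, t1, t2, t3, t4, a1, a2, a3, a4, b1, b2, b3, b4, c1, c2, c3, c4] <;>
    norm_num

/-- `D` acts as the translation by `3`, so conjugation by its powers spreads the half-turns about
`i`, `1 + i`, `2 + i` over all the points `j + i`. -/
theorem orbMob_Q₁ (j : ℤ) : orbMob (Q₁ j) = mob (halfTurn j) := by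
  have h : ∀ k r : ℤ, mob (ModularGroup.T ^ (3 : ℤ)) ^ k * mob (halfTurn r) *
      (mob (ModularGroup.T ^ (3 : ℤ)) ^ k)⁻¹ = mob (halfTurn (3 * k + r)) := by
    intro k r
    rw [← map_zpow, ← map_inv, ← map_mul, ← map_mul]
    congr 1
    unfold halfTurn
    rw [← _root_.zpow_mul, neg_add, _root_.zpow_add, _root_.zpow_add, _root_.zpow_neg,
      _root_.zpow_neg]
    have : (ModularGroup.T ^ (3 * k) : SpecialLinearGroup (Fin 2) ℤ)⁻¹ * (ModularGroup.T ^ r)⁻¹ =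
      (ModularGroup.T ^ r)⁻¹ * (ModularGroup.T ^ (3 * k))⁻¹ := by group
    rw [this]; group
  unfold Q₁
  rw [MulAut.conj_apply, map_mul, map_mul, map_inv, map_zpow, orbMob_D]
  have h3 := Int.emod_add_mul_ediv j 3
  have hlt := Int.emod_lt_of_pos j (show (0 : ℤ) < 3 by norm_num)
  have hge := Int.emod_nonneg j (show (3 : ℤ) ≠ 0 by norm_num)
  split_ifs with h0 h1
  · rw [show orbMob A = mob (halfTurn 0) from orbLift_A _ _ _, h]; congr 2; omega
  · rw [show orbMob B = mob (halfTurn 1) from orbLift_B _ _ _, h]; congr 2; omega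
  · rw [show orbMob C = mob (halfTurn 2) from orbLift_C _ _ _, h]; congr 2; omega

theorem closure_ABC : Subgroup.closure ({A, B, C} : Set Orb) = ⊤ := by
  rw [← PresentedGroup.closure_range_of]
  congr 1
  ext x
  simp only [Set.mem_insert_iff, Set.mem_singleton_iff, Set.mem_range]
  constructor
  · rintro (rfl | rfl | rfl)
    exacts [⟨0, rfl⟩, ⟨1, rfl⟩, ⟨2, rfl⟩]
  · rintro ⟨i, rfl⟩
    fin_cases i
    exacts [Or.inl rfl, Or.inr (Or.inl rfl), Or.inr (Or.inr rfl)]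

theorem mem_of_ABC_mem {H : Subgroup Orb} (hA : A ∈ H) (hB : B ∈ H) (hC : C ∈ H) (X : Orb) :
    X ∈ H := by
  have : Subgroup.closure ({A, B, C} : Set Orb) ≤ H := by
    rw [Subgroup.closure_le]; rintro x (rfl | rfl | rfl) <;> assumption
  rw [closure_ABC] at this
  exact this trivial

theorem exists_orbMob_eq (X : Orb) : ∃ M, mob M = orbMob X := by
  apply mem_of_ABC_mem (H := mob.range.comap orbMob)
  · exact ⟨_, (orbLift_A _ _ _).symm⟩
  · exact ⟨_, (orbLift_B _ _ _).symm⟩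
  · exact ⟨_, (orbLift_C _ _ _).symm⟩

/-! ### Faithfulness of the action, by ping-pong -/

/-- The homomorphism from a group of order two given by an element of square one. -/
def invHom {G : Type*} [Group G] (x : G) (hx : x * x = 1) : Multiplicative (ZMod 2) →* G where
  toFun z := if z = 1 then 1 else x
  map_one' := rfl
  map_mul' := by
    intro a b
    have h : ∀ a : Multiplicative (ZMod 2), a = 1 ∨ a = Multiplicative.ofAdd 1 := by decide
    rcases h a with rfl | rfl <;> rcases h b with rfl | rfl
    · simp
    · simp
    · simp
    · rw [if_pos (by decide), if_neg (by decide), hx]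

theorem invHom_of_ne {G : Type*} [Group G] {x : G} (hx : x * x = 1) {z : Multiplicative (ZMod 2)}
    (hz : z ≠ 1) : invHom x hx z = x := if_neg hz

theorem autL_A : autL A = B := by simp [autL, orbLift_A]
theorem autL_B : autL B = B * A * B := by simp [autL, orbLift_B]
theorem autL_C : autL C = C := by simp [autL, orbLift_C]
theorem autR_A : autR A = A := by simp [autR, orbLift_A]
theorem autR_B : autR B = B * C * B := by simp [autR, orbLift_B]
theorem autR_C : autR C = B := by simp [autR, orbLift_C]

theorem orbMob_autL_A : orbMob (autL A) = mob (halfTurn 1) := by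
  rw [autL_A]; exact orbLift_B _ _ _

theorem orbMob_autL_B : orbMob (autL B) = mob (halfTurn 1 * halfTurn 0 * halfTurn 1) := by
  rw [autL_B, map_mul, map_mul, map_mul, map_mul]
  have hA : orbMob A = mob (halfTurn 0) := orbLift_A _ _ _
  have hB : orbMob B = mob (halfTurn 1) := orbLift_B _ _ _
  rw [hA, hB]

theorem orbMob_autL_C : orbMob (autL C) = mob (halfTurn 2) := by
  rw [autL_C]; exact orbLift_C _ _ _

/-- Three disjoint intervals with which the three generators play ping-pong. -/
def pingPongSet : Fin 3 → Set (OnePoint ℚ) :=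
  ![OnePoint.some '' Set.Iio 1, OnePoint.some '' Set.Ioo 1 2, OnePoint.some '' Set.Ioi 2]

theorem pingPong_apply_A {s : ℚ} (hs : 1 < s) :
    orbMob (autL A) (OnePoint.some s) ∈ pingPongSet 0 := by
  rw [orbMob_autL_A, mob_some]
  obtain ⟨b1, b2, b3, b4⟩ := halfTurn_entries 1
  simp only [b1, b2, b3, b4]
  push_cast
  rw [if_neg (by linarith)]
  refine ⟨_, ?_, rfl⟩
  rw [Set.mem_Iio, div_lt_one (by linarith)]; linarith

theorem pingPong_apply_B {s : ℚ} (hs : s < 1 ∨ 2 < s) :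
    orbMob (autL B) (OnePoint.some s) ∈ pingPongSet 1 := by
  rw [orbMob_autL_B, mob_some]
  obtain ⟨a1, a2, a3, a4⟩ := halfTurn_entries 0
  obtain ⟨b1, b2, b3, b4⟩ := halfTurn_entries 1
  simp only [sl_mul_apply, a1, a2, a3, a4,
    b1, b2, b3, b4]
  push_cast
  rw [if_neg (by rcases hs with h | h <;> intro h' <;> linarith)]
  refine ⟨_, ?_, rfl⟩
  rw [Set.mem_Ioo]
  rcases hs with h | h
  · rw [lt_div_iff₀ (by linarith), div_lt_iff₀ (by linarith)]; constructor <;> linarith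
  · rw [lt_div_iff_of_neg (by linarith), div_lt_iff_of_neg (by linarith)]
    constructor <;> linarith

theorem pingPong_apply_C {s : ℚ} (hs : s < 2) :
    orbMob (autL C) (OnePoint.some s) ∈ pingPongSet 2 := by
  rw [orbMob_autL_C, mob_some]
  obtain ⟨b1, b2, b3, b4⟩ := halfTurn_entries 2
  simp only [b1, b2, b3, b4]
  push_cast
  rw [if_neg (by intro h; linarith)]
  refine ⟨_, ?_, rfl⟩
  rw [Set.mem_Ioi, lt_div_iff_of_neg (by linarith)]; linarith

/-- The half-turns of `A`, `B`, `C` exchange `∞` with `0`, `1`, `2`, which does not suit ping-pong.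
After `autL` the generators exchange `1` with `∞`, `1` with `2`, and `2` with `∞`: they are
half-turns about points on the three sides of one ideal triangle, and the three arcs cut off are
disjoint. -/
theorem orbMob_injective : Function.Injective orbMob := by
  suffices h : Function.Injective (orbMob.comp autL.toMonoidHom) by
    intro x y hxy
    obtain ⟨x, rfl⟩ := autL.surjective x
    obtain ⟨y, rfl⟩ := autL.surjective y
    rw [h hxy]
  set ψ := orbMob.comp autL.toMonoidHom
  have hsq : ∀ i : Fin 3, (PresentedGroup.of i : Orb) * PresentedGroup.of i = 1 := of_sq
  have hsq' : ∀ i : Fin 3, ψ (PresentedGroup.of i) * ψ (PresentedGroup.of i) = 1 := by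
    intro i; rw [← map_mul, hsq, map_one]
  -- The presented group is a quotient of the free product of three groups of order two. Ping-pong
  -- makes the composite with `ψ` injective, and since `g` is onto, `ψ` is injective too.
  let g : Monoid.CoprodI (fun _ : Fin 3 => Multiplicative (ZMod 2)) →* Orb :=
    Monoid.CoprodI.lift fun i => invHom _ (hsq i)
  have hg : Function.Surjective g := by
    intro X
    have hof : ∀ i : Fin 3, (PresentedGroup.of i : Orb) ∈ g.range := by
      intro i
      refine ⟨Monoid.CoprodI.of (i := i) (Multiplicative.ofAdd 1), ?_⟩
      rw [Monoid.CoprodI.lift_of, invHom_of_ne]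
      decide
    exact mem_of_ABC_mem (H := g.range) (hof 0) (hof 1) (hof 2) X
  have hcomp : ψ.comp g = Monoid.CoprodI.lift fun i => invHom _ (hsq' i) := by
    apply Monoid.CoprodI.ext_hom
    intro i
    refine MonoidHom.ext fun z => ?_
    simp only [g, MonoidHom.comp_apply, Monoid.CoprodI.lift_of]
    by_cases hz : z = 1
    · simp [hz]
    · rw [invHom_of_ne _ hz, invHom_of_ne _ hz]
  have hinj : Function.Injective (ψ.comp g) := by
    rw [hcomp]
    -- With three factors, the cardinality condition is met by the index set, although each factor
    -- has only two elements.
    apply Monoid.CoprodI.lift_injective_of_ping_pong (X := pingPongSet) (hcard := Or.inl (by simp))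
    · intro i
      fin_cases i
      · exact ⟨_, 0, by simp, rfl⟩
      · exact ⟨_, 3 / 2, by constructor <;> norm_num, rfl⟩
      · exact ⟨_, 3, by norm_num, rfl⟩
    · intro i j hij
      rw [Function.onFun, Set.disjoint_left]
      fin_cases i <;> fin_cases j <;> first | exact absurd rfl hij | skip
      all_goals
        rintro _ ⟨s, hs, rfl⟩ ⟨s', hs', h⟩
        have := OnePoint.coe_injective h
        subst this
        simp only [Set.mem_Iio, Set.mem_Ioi, Set.mem_Ioo] at hs hs'
        linarith
    · intro i j hij z hz
      rw [invHom_of_ne _ hz]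
      rintro _ ⟨x, hx, rfl⟩
      change ψ _ x ∈ _
      fin_cases i <;> fin_cases j <;> first | exact absurd rfl hij | skip
      all_goals obtain ⟨s, hs, rfl⟩ := hx
      all_goals simp only [Set.mem_Iio, Set.mem_Ioi, Set.mem_Ioo] at hs
      · exact pingPong_apply_A hs.1
      · exact pingPong_apply_A (by linarith)
      · exact pingPong_apply_B (Or.inl hs)
      · exact pingPong_apply_B (Or.inr hs)
      · exact pingPong_apply_C (by linarith)
      · exact pingPong_apply_C hs.2
  intro x y hxy
  obtain ⟨x, rfl⟩ := hg x
  obtain ⟨y, rfl⟩ := hg y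
  rw [hinj hxy]

theorem Q₁_injective : Function.Injective Q₁ := by
  intro i j h
  have h1 := orbMob_Q₁ i
  rw [h, orbMob_Q₁] at h1
  obtain ⟨a1, -, a3, -⟩ := halfTurn_entries i
  obtain ⟨b1, -, b3, -⟩ := halfTurn_entries j
  rcases mob_eq_mob h1 with h | h
  · rw [← a1, ← b1, h]
  · rw [h] at b3; simp [a3] at b3

/-! ### Markov descent for elliptic generator triples -/

/-- `X` acts as the half-turn with matrix `(p q; x -p)`, about the point `(p + i) / x`. -/
def IsHalfTurn (X : Orb) (p q x : ℤ) : Prop :=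
  0 < x ∧ p * p + q * x = -1 ∧ ∃ M : SpecialLinearGroup (Fin 2) ℤ, mob M = orbMob X ∧
    M 0 0 = p ∧ M 0 1 = q ∧ M 1 0 = x ∧ M 1 1 = -p

/-- Matrices are determined up to sign by the action, and `0 < x` selects the sign. -/
theorem IsHalfTurn.unique {X : Orb} {p q x p' q' x' : ℤ} (h : IsHalfTurn X p q x)
    (h' : IsHalfTurn X p' q' x') : p = p' ∧ q = q' ∧ x = x' := by
  obtain ⟨hx, -, M, hM, rfl, rfl, rfl, -⟩ := h
  obtain ⟨hx', -, M', hM', rfl, rfl, rfl, -⟩ := h'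
  rcases mob_eq_mob (hM.trans hM'.symm) with rfl | rfl
  · simp
  · simp only [SpecialLinearGroup.coe_neg, Matrix.neg_apply] at hx
    omega

/-- A matrix with square `±1` has off-diagonal entries killed by its trace. If the trace is nonzero
the matrix is thus `±1`, which faithfulness excludes; if it is zero, the lower left entry cannot
vanish, as `-p² = 1` is impossible. -/
theorem exists_isHalfTurn {X : Orb} (hX : X * X = 1) (h1 : X ≠ 1) :
    ∃ p q x, IsHalfTurn X p q x := by
  obtain ⟨M, hM⟩ := exists_orbMob_eq X
  have hdet := M.det_coe
  rw [Matrix.det_fin_two] at hdet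
  have hM2 : mob (M * M) = 1 := by rw [map_mul, hM, ← map_mul, hX, map_one]
  have htr : M 1 1 = -M 0 0 := by
    by_contra htr
    apply h1
    apply orbMob_injective
    rw [map_one, ← hM]
    have hb : (M 0 0 + M 1 1) * M 0 1 = 0 ∧ (M 0 0 + M 1 1) * M 1 0 = 0 := by
      have e1 := sl_mul_apply M M 0 1
      have e2 := sl_mul_apply M M 1 0
      rcases mob_eq_one hM2 with h | h <;> rw [h] at e1 e2 <;> simp at e1 e2 <;>
        constructor <;> linarith
    have hne : M 0 0 + M 1 1 ≠ 0 := by omega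
    have hb1 := (mul_eq_zero.1 hb.1).resolve_left hne
    have hb2 := (mul_eq_zero.1 hb.2).resolve_left hne
    rw [hb1, zero_mul, sub_zero] at hdet
    rcases Int.eq_one_or_neg_one_of_mul_eq_one' hdet with ⟨h3, h4⟩ | ⟨h3, h4⟩
    · have : M = 1 := by apply sl_ext <;> simp [h3, h4, hb1, hb2]
      rw [this, map_one]
    · have : M = -1 := by apply sl_ext <;> simp [h3, h4, hb1, hb2]
      rw [this, mob_neg, map_one]
  rw [htr] at hdet
  rcases lt_trichotomy (M 1 0) 0 with hc | hc | hc
  · refine ⟨-M 0 0, -M 0 1, -M 1 0, by omega, by linarith, -M, by rw [mob_neg, hM], ?_⟩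
    simp [htr]
  · rw [hc] at hdet; nlinarith [mul_self_nonneg (M 0 0)]
  · exact ⟨M 0 0, M 0 1, M 1 0, hc, by linarith, M, hM, rfl, rfl, rfl, htr⟩

theorem IsHalfTurn.mul_self {X : Orb} {p q x : ℤ} (h : IsHalfTurn X p q x) : X * X = 1 := by
  obtain ⟨-, hr, M, hM, m1, m2, m3, m4⟩ := h
  apply orbMob_injective
  rw [map_mul, ← hM, ← map_mul, map_one]
  have : M * M = -1 := by
    apply sl_ext <;> rw [sl_mul_apply] <;> simp [m1, m2, m3, m4] <;> linarith
  rw [this, mob_neg, map_one]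

/-- With `τ = tr (MN)`, the matrices of trace zero satisfy `MN + NM = τ` and `M² = -1`, so `MNM = τM
+ N`. The hypothesis `h` says that the sign must be reversed to make the lower left entry positive.
-/
theorem IsHalfTurn.conj_involution {X Y : Orb} {p q x r s y : ℤ} (hX : IsHalfTurn X p q x)
    (hY : IsHalfTurn Y r s y) (h : (2 * p * r + q * y + s * x) * x + y < 0) :
    IsHalfTurn (X * Y * X) (-((2 * p * r + q * y + s * x) * p + r))
      (-((2 * p * r + q * y + s * x) * q + s)) (-((2 * p * r + q * y + s * x) * x + y)) := by
  obtain ⟨hx, hp, M, hM, m1, m2, m3, m4⟩ := hX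
  obtain ⟨hy, hr, N, hN, n1, n2, n3, n4⟩ := hY
  refine ⟨by omega, ?_, -(M * N * M), ?_, ?_, ?_, ?_, ?_⟩
  · linear_combination (2 * p * r + q * y + s * x) ^ 2 * hp + hr
  · rw [mob_neg, map_mul, map_mul, map_mul, map_mul, hM, hN]
  all_goals
    simp only [SpecialLinearGroup.coe_neg, Matrix.neg_apply]
    rw [sl_mul_apply, sl_mul_apply, sl_mul_apply]
    simp only [m1, m2, m3, m4, n1, n2, n3, n4]
  · linear_combination r * hp
  · linear_combination s * hp
  · linear_combination y * hp
  · linear_combination (-r) * hp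

theorem IsHalfTurn.conj_D {X : Orb} {p q x : ℤ} (hX : IsHalfTurn X p q x) :
    ∃ p' q', IsHalfTurn (D * X * D⁻¹) p' q' x := by
  obtain ⟨hx, hp, M, hM, m1, m2, m3, m4⟩ := hX
  obtain ⟨t1, t2, t3, t4⟩ := T_zpow_entries 3
  obtain ⟨u1, u2, u3, u4⟩ := T_zpow_entries (-3)
  refine ⟨p + 3 * x, q - 6 * p - 9 * x, hx, by linear_combination hp,
    ModularGroup.T ^ (3 : ℤ) * M * ModularGroup.T ^ (-3 : ℤ), ?_, ?_, ?_, ?_, ?_⟩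
  · rw [map_mul, map_mul, map_mul, map_mul, map_inv, hM, orbMob_D, ← map_inv, _root_.zpow_neg]
  all_goals
    simp only [sl_mul_apply, m1, m2, m3, m4, t1, t2, t3, t4, u1, u2, u3, u4]
    ring

/-- The product relation says that `KNM = ε T³` with `ε = ±1`. Since `K⁻¹ = -K`, all entries of `NM`
are known in terms of `K`; in particular the trace of `NM` is `-3εz`. Determinant one turns that
trace into a sum of squares, which settles `ε` and gives the Markov equation. -/
theorem markov {X Y Z : Orb} {p q x r s y u v z : ℤ} (hX : IsHalfTurn X p q x)
    (hY : IsHalfTurn Y r s y) (hZ : IsHalfTurn Z u v z) (hD : Z * Y * X = D) :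
    x * x + y * y + z * z = 3 * x * y * z ∧ 2 * p * r + q * y + s * x = -3 * z ∧
      2 * u * r + v * y + s * z = -3 * x ∧ r * x - p * y = z ∧ r * p + s * x = -u := by
  obtain ⟨hx, hp, M, hM, m1, m2, m3, m4⟩ := hX
  obtain ⟨hy, hr, N, hN, n1, n2, n3, n4⟩ := hY
  obtain ⟨hz, hu, K, hK, k1, k2, k3, k4⟩ := hZ
  obtain ⟨t1, t2, t3, t4⟩ := T_zpow_entries 3
  have hprod : mob (K * N * M) = mob (ModularGroup.T ^ (3 : ℤ)) := by
    rw [map_mul, map_mul, hK, hN, hM, ← map_mul, ← map_mul, hD, orbMob_D]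
  obtain ⟨ε, hε, e1, e2, e3, e4⟩ : ∃ ε : ℤ, (ε = 1 ∨ ε = -1) ∧
      (u * r + v * y) * p + (u * s - v * r) * x = ε ∧
      (u * r + v * y) * q - (u * s - v * r) * p = 3 * ε ∧
      (z * r - u * y) * p + (z * s + u * r) * x = 0 ∧
      (z * r - u * y) * q - (z * s + u * r) * p = ε := by
    have c1 := sl_mul_apply (K * N) M 0 0
    have c2 := sl_mul_apply (K * N) M 0 1
    have c3 := sl_mul_apply (K * N) M 1 0
    have c4 := sl_mul_apply (K * N) M 1 1
    simp only [sl_mul_apply K N, m1, m2, m3, m4, n1, n2, n3, n4, k1, k2, k3, k4] at c1 c2 c3 c4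
    rcases mob_eq_mob hprod with h | h
    · rw [h, t1] at c1; rw [h, t2] at c2; rw [h, t3] at c3; rw [h, t4] at c4
      exact ⟨1, Or.inl rfl, by linarith, by linarith, by linarith, by linarith⟩
    · rw [h] at c1 c2 c3 c4
      simp only [SpecialLinearGroup.coe_neg, Matrix.neg_apply, t1, t2, t3, t4] at c1 c2 c3 c4
      exact ⟨-1, Or.inr rfl, by linarith, by linarith, by linarith, by linarith⟩
  have g1 : r * x - p * y = ε * z := by
    linear_combination z * e1 - u * e3 + (r * x - p * y) * hu
  have g2 : r * p + s * x = -(ε * u) := by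
    linear_combination (-u) * e1 - v * e3 + (r * p + s * x) * hu
  have g3 : r * p + q * y = ε * (u - 3 * z) := by
    linear_combination (-z) * e2 + u * e4 + (r * p + q * y) * hu
  have g4 : z * s + u * r = ε * p := by
    linear_combination (-q) * e3 + p * e4 + (z * s + u * r) * hp
  have g5 : u * r + v * y = -(ε * p) - 3 * ε * x := by
    linear_combination (-p) * e1 - x * e2 + (u * r + v * y) * hp
  -- The entries `q` and `s` are eliminated through the two determinant relations.
  have key : x * y * (2 * p * r + q * y + s * x) =
      -(x * x + y * y + (r * x - p * y) * (r * x - p * y)) := by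
    linear_combination (y * y) * hp + (x * x) * hr
  have hxy : 0 < x * y := mul_pos hx hy
  have hε1 : ε = 1 := by
    -- For `ε = -1` the left side of `key` would be positive and the right side is not.
    rcases hε with h | h
    · exact h
    · exfalso
      have : 2 * p * r + q * y + s * x = 3 * z := by
        subst h; linarith
      rw [this] at key
      have : 0 < x * y * (3 * z) := by positivity
      nlinarith [mul_self_nonneg (r * x - p * y), mul_self_nonneg x, mul_self_nonneg y]
  subst hε1
  have h2 : 2 * p * r + q * y + s * x = -3 * z := by linarith
  refine ⟨?_, h2, by linarith, by linarith, by linarith⟩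
  rw [h2, g1] at key
  linarith

theorem IsHalfTurn.eq_Q₁ {X : Orb} {p q : ℤ} (h : IsHalfTurn X p q 1) : X = Q₁ p := by
  obtain ⟨-, hp, M, hM, m1, m2, m3, m4⟩ := h
  obtain ⟨a1, a2, a3, a4⟩ := halfTurn_entries p
  apply orbMob_injective
  rw [← hM, orbMob_Q₁]
  congr 1
  apply sl_ext <;> omega

/-- The triples obtained from `(X₀, Y₀, Z₀)` by the moves `L` and `R`. -/
inductive Descendant (X₀ Y₀ Z₀ : Orb) : Orb → Orb → Orb → Prop
  | base : Descendant X₀ Y₀ Z₀ X₀ Y₀ Z₀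
  | left {X Y Z : Orb} : Descendant X₀ Y₀ Z₀ X Y Z → Descendant X₀ Y₀ Z₀ Y (Y * X * Y) Z
  | right {X Y Z : Orb} : Descendant X₀ Y₀ Z₀ X Y Z → Descendant X₀ Y₀ Z₀ X (Y * Z * Y) Y

theorem Descendant.map {X₀ Y₀ Z₀ X Y Z : Orb} (h : Descendant X₀ Y₀ Z₀ X Y Z)
    (g : Orb →* Orb) : Descendant (g X₀) (g Y₀) (g Z₀) (g X) (g Y) (g Z) := by
  induction h with
  | base => exact .base
  | left _ ih => rw [map_mul, map_mul]; exact .left ih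
  | right _ ih => rw [map_mul, map_mul]; exact .right ih

/-- The numbers `y` and `3xz - y` are the roots of `T² - 3xzT + x² + z²`, and this polynomial is
nonpositive at `x` because `z² ≤ x² ≤ x²z`. So `x` lies between the roots, and `y` is the larger
one. -/
theorem vieta_le {x y z : ℤ} (hz : 0 < z) (hxy : x < y) (hzx : z ≤ x)
    (h : x * x + y * y + z * z = 3 * x * y * z) : 3 * x * z - y ≤ x := by
  by_contra hlt
  push Not at hlt
  have h1 : 0 < (y - x) * (3 * x * z - y - x) := mul_pos (by linarith) (by linarith)
  have h2 : z * z ≤ x * x := mul_self_le_mul_self hz.le hzx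
  have h3 : x * x ≤ x * x * z := le_mul_of_one_le_right (mul_self_nonneg x) hz
  nlinarith

/-- Induction on a bound for the largest entry `y`, kept in the middle. Conjugating the middle
element by the neighbour with the larger entry replaces `y` by the other Vieta root and puts that
neighbour in the middle. The move `left` or `right` undoes this. -/
theorem descendant_of_triple (N : ℕ) : ∀ {X Y Z : Orb} {p q x r s y u v z : ℤ},
    IsHalfTurn X p q x → IsHalfTurn Y r s y → IsHalfTurn Z u v z → X * X = 1 → Z * Z = 1 →
    Z * Y * X = D → x ≤ y → z ≤ y → y ≤ N →
    ∃ i, Descendant (Q₁ i) (Q₁ (i + 1)) (Q₁ (i + 2)) X Y Z := by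
  induction N with
  | zero =>
    intro X Y Z p q x r s y u v z hX hY hZ _ _ hD hxy hzy hN
    have := hY.1
    simp at hN; omega
  | succ N ih =>
    intro X Y Z p q x r s y u v z hX hY hZ hXX hZZ hD hxy hzy hN
    obtain ⟨hm, h1, h2, h3, h4⟩ := markov hX hY hZ hD
    have hx := hX.1
    have hz := hZ.1
    have hy := hY.1
    by_cases hy1 : y = 1
    · subst hy1
      obtain rfl : x = 1 := by omega
      obtain rfl : z = 1 := by omega
      -- All three entries are one, so the half-turns have integral centres, and the Markov
      -- relations make these consecutive.
      have hr := hY.2.1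
      have e1 : r = p + 1 := by omega
      have e2 : u = p + 2 := by
        subst e1; linear_combination h4 - hr
      subst e1 e2
      refine ⟨p, ?_⟩
      rw [← hX.eq_Q₁, ← hY.eq_Q₁, ← hZ.eq_Q₁]
      exact .base
    have hpos : 0 < 3 * x * z - y := by
      have : y * (3 * x * z - y) = x * x + z * z := by linear_combination -hm
      have h5 : 0 < y * (3 * x * z - y) := by rw [this]; positivity
      exact (mul_pos_iff_of_pos_left hy).1 h5
    -- A repeated maximum `x = y` would give `z² = x²(3z - 2)`, which for `x ≥ 2` is incompatible
    -- with `z ≤ x`.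
    have hxlt : x < y := by
      rcases hxy.lt_or_eq with h | h
      · exact h
      · exfalso
        subst h
        have e : z * z = x * x * (3 * z - 2) := by linear_combination hm
        have : z * z ≤ x * x := mul_self_le_mul_self hz.le hzy
        have : 2 ≤ x := by omega
        nlinarith
    have hzlt : z < y := by
      rcases hzy.lt_or_eq with h | h
      · exact h
      · exfalso
        subst h
        have e : x * x = z * z * (3 * x - 2) := by linear_combination hm
        have : x * x ≤ z * z := mul_self_le_mul_self hx.le hxy
        have : 2 ≤ z := by omega
        nlinarith
    rcases le_total z x with hzx | hxz
    · have hle := vieta_le hz hxlt hzx hm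
      have hW := hX.conj_involution hY (by rw [h1]; linarith)
      have ec : -((2 * p * r + q * y + s * x) * x + y) = 3 * x * z - y := by rw [h1]; ring
      rw [ec] at hW
      -- The smaller triple is `(XYX, X, Z)`; its product is again `ZYX` since `X² = 1`.
      obtain ⟨i, hi⟩ := ih hW hX hZ
        (by rw [show X * Y * X * (X * Y * X) = X * Y * (X * X) * Y * X by group, hXX, mul_one]
            rw [mul_assoc X, hY.mul_self, mul_one, hXX]) hZZ
        (by rw [← hD]; rw [show Z * X * (X * Y * X) = Z * (X * X) * Y * X by group, hXX]; group)
        hle hzx (by push_cast at hN; omega)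
      refine ⟨i, ?_⟩
      have := hi.left
      rwa [show X * (X * Y * X) * X = (X * X) * Y * (X * X) by group, hXX, one_mul, mul_one]
        at this
    · have hle := vieta_le hx hzlt hxz (by linear_combination hm)
      have hW := hZ.conj_involution hY (by rw [h2]; linarith)
      have ec : -((2 * u * r + v * y + s * z) * z + y) = 3 * z * x - y := by rw [h2]; ring
      rw [ec] at hW
      obtain ⟨i, hi⟩ := ih hX hZ hW hXX
        (by rw [show Z * Y * Z * (Z * Y * Z) = Z * Y * (Z * Z) * Y * Z by group, hZZ, mul_one]
            rw [mul_assoc Z, hY.mul_self, mul_one, hZZ])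
        (by rw [← hD]; rw [show Z * Y * Z * Z * X = Z * Y * (Z * Z) * X by group, hZZ]; group)
        hxz hle (by push_cast at hN; omega)
      refine ⟨i, ?_⟩
      have := hi.right
      rwa [show Z * (Z * Y * Z) * Z = (Z * Z) * Y * (Z * Z) by group, hZZ, one_mul, mul_one]
        at this

theorem period_of_prod {p : ℤ → Orb} (hprod : ∀ j, p (j + 2) * p (j + 1) * p j = D) (j : ℤ) :
    p (j + 3) = D * p j * D⁻¹ := by
  have h1 := hprod j
  have h2 := hprod (j + 1)
  rw [show j + 1 + 2 = j + 3 by ring, show j + 1 + 1 = j + 2 by ring] at h2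
  have h3 : p (j + 2) * p (j + 1) = D * (p j)⁻¹ := by rw [← h1]; group
  rw [mul_assoc, h3] at h2
  rw [eq_mul_inv_of_mul_eq h2]; group

/-- Every bi-infinite sequence of elliptic generators contains a triple obtained from a triple of
consecutive elements of `Q₁`. -/
theorem exists_descendant {p : ℤ → Orb} (hsq : ∀ j, p j * p j = 1) (hne : ∀ j, p j ≠ 1)
    (hprod : ∀ j, p (j + 2) * p (j + 1) * p j = D) :
    ∃ i j, Descendant (Q₁ i) (Q₁ (i + 1)) (Q₁ (i + 2)) (p j) (p (j + 1)) (p (j + 2)) := by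
  choose a b c h using fun j => exists_isHalfTurn (hsq j) (hne j)
  have hc : ∀ j, c (j + 3) = c j := by
    intro j
    obtain ⟨a', b', h'⟩ := (h j).conj_D
    have h'' := h (j + 3)
    rw [period_of_prod hprod] at h''
    exact (h''.unique h').2.2
  have key : ∀ j, c j ≤ c (j + 1) → c (j + 2) ≤ c (j + 1) → ∃ i j,
      Descendant (Q₁ i) (Q₁ (i + 1)) (Q₁ (i + 2)) (p j) (p (j + 1)) (p (j + 2)) := by
    intro j h1 h2
    obtain ⟨i, hi⟩ := descendant_of_triple (c (j + 1)).toNat (h j) (h (j + 1)) (h (j + 2))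
      (hsq _) (hsq _) (hprod j) h1 h2 (Int.self_le_toNat _)
    exact ⟨i, j, hi⟩
  -- The entries have period three, so some consecutive triple has its maximum in the middle.
  by_cases h1 : c 0 ≤ c 1
  · by_cases h2 : c 2 ≤ c 1
    · exact key 0 h1 h2
    · apply key 1 (by norm_num; omega)
      rw [show (1 : ℤ) + 2 = 0 + 3 by norm_num, hc]; norm_num; omega
  · by_cases h2 : c 2 ≤ c 0
    · apply key 2
      · rw [show (2 : ℤ) + 1 = 0 + 3 by norm_num, hc]; exact h2
      · rw [show (2 : ℤ) + 1 = 0 + 3 by norm_num, show (2 : ℤ) + 2 = 1 + 3 by norm_num, hc, hc]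
        omega
    · apply key 1 (by norm_num; omega)
      rw [show (1 : ℤ) + 2 = 0 + 3 by norm_num, hc]; norm_num; omega

/-! ### Slopes -/

/-- The determinant of two vectors. -/
def cross (u v : ℤ × ℤ) : ℤ := u.1 * v.2 - u.2 * v.1

theorem slopeOf_eq_iff {u v : ℤ × ℤ} (hu : u ≠ 0) (hv : v ≠ 0) :
    slopeOf u = slopeOf v ↔ cross u v = 0 := by
  obtain ⟨u1, u2⟩ := u
  obtain ⟨v1, v2⟩ := v
  simp only [ne_eq, Prod.mk_eq_zero, not_and] at hu hv
  unfold slopeOf cross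
  by_cases h1 : u1 = 0 <;> by_cases h2 : v1 = 0
  · simp [h1, h2]
  · have := hu h1
    simp [h1, h2, this, OnePoint.infty_ne_coe]
  · have := hv h2
    simp [h1, h2, this, OnePoint.coe_ne_infty]
  · have h1' : (u1 : ℚ) ≠ 0 := by exact_mod_cast h1
    have h2' : (v1 : ℚ) ≠ 0 := by exact_mod_cast h2
    simp only [h1, h2, if_false]
    rw [OnePoint.coe_eq_coe, div_eq_div_iff h1' h2']
    constructor
    · intro h
      have : u2 * v1 = v2 * u1 := by exact_mod_cast h
      linarith
    · intro h
      have : u2 * v1 = v2 * u1 := by linarith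
      exact_mod_cast this

theorem ne_zero_of_cross_left {u v : ℤ × ℤ} (h : cross u v ≠ 0) : u ≠ 0 := by
  rintro rfl; simp [cross] at h

theorem ne_zero_of_cross_right {u v : ℤ × ℤ} (h : cross u v ≠ 0) : v ≠ 0 := by
  rintro rfl; simp [cross] at h

theorem slopeOf_ne {u v : ℤ × ℤ} (h : cross u v ≠ 0) : slopeOf u ≠ slopeOf v :=
  fun h' => h ((slopeOf_eq_iff (ne_zero_of_cross_left h) (ne_zero_of_cross_right h)).1 h')

theorem slopeOf_neg (u : ℤ × ℤ) : slopeOf (-u) = slopeOf u := by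
  by_cases hu : u = 0
  · subst hu; simp
  · rw [slopeOf_eq_iff (neg_ne_zero.2 hu) hu]; simp [cross]; ring

/-- `X` acts on the lattice of punctures as the half-turn `x ↦ v - x`. -/
def IsRot (X : Orb) (v : ℤ × ℤ) : Prop := puncAct X = Equiv.subLeft v

theorem IsRot.ellSlope {X : Orb} {v : ℤ × ℤ} (h : IsRot X v) : ellSlope X = slopeOf v := by
  unfold PTB.ellSlope
  rw [h]; congr 1; exact sub_zero v

theorem IsRot.conj {X Y : Orb} {u v : ℤ × ℤ} (hX : IsRot X u) (hY : IsRot Y v) :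
    IsRot (X * Y * X) (u + u - v) := by
  unfold IsRot at *
  ext x <;> simp [map_mul, hX, hY] <;> ring

theorem isRot_A : IsRot A (1, 0) := orbLift_A _ _ _
theorem isRot_B : IsRot B (1, 1) := orbLift_B _ _ _
theorem isRot_C : IsRot C (0, 1) := orbLift_C _ _ _

theorem puncAct_D (x : ℤ × ℤ) : puncAct D x = -x := by
  have hA := isRot_A
  have hB := isRot_B
  have hC := isRot_C
  unfold IsRot at *
  rw [D, map_mul, map_mul, hA, hB, hC]
  ext <;> simp

theorem puncAct_D_inv (x : ℤ × ℤ) : puncAct D⁻¹ x = -x := by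
  rw [map_inv, Equiv.Perm.inv_eq_iff_eq, puncAct_D, neg_neg]

theorem IsRot.conj_D {X : Orb} {v : ℤ × ℤ} (hX : IsRot X v) : IsRot (D * X * D⁻¹) (-v) := by
  have : ∀ x, puncAct (D * X * D⁻¹) x = -v - x := by
    intro x
    rw [map_mul, map_mul, Equiv.Perm.mul_apply, Equiv.Perm.mul_apply, puncAct_D, puncAct_D_inv, hX]
    simp only [Equiv.subLeft_apply]; abel
  exact Equiv.ext this

theorem ellSlope_conj_D (X : Orb) : ellSlope (D * X * D⁻¹) = ellSlope X := by
  unfold ellSlope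
  rw [map_mul, map_mul, Equiv.Perm.mul_apply, Equiv.Perm.mul_apply, puncAct_D, puncAct_D_inv,
    slopeOf_neg, Prod.mk_zero_zero, neg_zero]

/-- The lattice half-turns of a triple `(X, Y, Z)` are given by a positive basis. -/
def IsRotTriple (X Y Z : Orb) (a c : ℤ × ℤ) : Prop :=
  IsRot X a ∧ IsRot Y (a + c) ∧ IsRot Z c ∧ cross a c = 1

theorem IsRotTriple.left {X Y Z : Orb} {a c : ℤ × ℤ} (h : IsRotTriple X Y Z a c) :
    IsRotTriple Y (Y * X * Y) Z (a + c) c := by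
  refine ⟨h.2.1, ?_, h.2.2.1, ?_⟩
  · have := h.2.1.conj h.1
    rwa [show a + c + (a + c) - a = a + c + c by abel] at this
  · have := h.2.2.2
    simp [cross] at this ⊢; linarith

theorem IsRotTriple.right {X Y Z : Orb} {a c : ℤ × ℤ} (h : IsRotTriple X Y Z a c) :
    IsRotTriple X (Y * Z * Y) Y a (a + c) := by
  refine ⟨h.1, ?_, h.2.1, ?_⟩
  · have := h.2.1.conj h.2.2.1
    rwa [show a + c + (a + c) - c = a + (a + c) by abel] at this
  · have := h.2.2.2
    simp [cross] at this ⊢; linarith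

theorem IsRotTriple.left_inv {X Y Z : Orb} {a c : ℤ × ℤ} (h : IsRotTriple X Y Z a c) :
    IsRotTriple (X * Y * X) X Z (a - c) c := by
  refine ⟨?_, ?_, h.2.2.1, ?_⟩
  · have := h.1.conj h.2.1
    rwa [show a + a - (a + c) = a - c by abel] at this
  · rw [sub_add_cancel]; exact h.1
  · have := h.2.2.2
    simp [cross] at this ⊢; linarith

theorem IsRotTriple.right_inv {X Y Z : Orb} {a c : ℤ × ℤ} (h : IsRotTriple X Y Z a c) :
    IsRotTriple X Z (Z * Y * Z) a (c - a) := by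
  refine ⟨h.1, ?_, ?_, ?_⟩
  · rw [add_sub_cancel]; exact h.2.2.1
  · have := h.2.2.1.conj h.2.1
    rwa [show c + c - (a + c) = c - a by abel] at this
  · have := h.2.2.2
    simp [cross] at this ⊢; linarith

theorem IsRotTriple.rotate {X Y Z : Orb} {a c : ℤ × ℤ} (h : IsRotTriple X Y Z a c) :
    IsRotTriple Y Z (D * X * D⁻¹) (a + c) (-a) := by
  refine ⟨h.2.1, ?_, h.1.conj_D, ?_⟩
  · rw [show a + c + -a = c by abel]; exact h.2.2.1
  · have := h.2.2.2
    simp [cross] at this ⊢; linarith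

theorem IsRotTriple.rotate_inv {X Y Z : Orb} {a c : ℤ × ℤ}
    (h : IsRotTriple Y Z (D * X * D⁻¹) a c) : IsRotTriple X Y Z (-c) (a + c) := by
  have h1 : IsRot X (-c) := by
    have h2 := h.2.2.1
    apply Equiv.ext
    intro x
    have h3 := Equiv.congr_fun h2 (-x)
    rw [map_mul, map_mul, Equiv.Perm.mul_apply, Equiv.Perm.mul_apply, puncAct_D,
      puncAct_D_inv, neg_neg] at h3
    simp only [Equiv.subLeft_apply] at h3 ⊢
    rw [← neg_neg (puncAct X x), h3]; abel
  refine ⟨h1, ?_, h.2.1, ?_⟩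
  · rw [show -c + (a + c) = a by abel]; exact h.1
  · have := h.2.2.2
    simp [cross] at this ⊢; linarith

/-- `v` is a combination of `a` and `c` with unequal positive coefficients. -/
def Beyond (a c v : ℤ × ℤ) : Prop := ∃ x y : ℤ, 1 ≤ x ∧ 1 ≤ y ∧ x ≠ y ∧ v = x • a + y • c

theorem Beyond.slopeOf_ne {a c v : ℤ × ℤ} (h : Beyond a c v) (hac : cross a c = 1) :
    slopeOf v ≠ slopeOf a ∧ slopeOf v ≠ slopeOf (a + c) ∧ slopeOf v ≠ slopeOf c := by
  obtain ⟨x, y, hx, hy, hxy, rfl⟩ := h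
  have e1 : cross (x • a + y • c) a = -y * cross a c := by simp [cross]; ring
  have e2 : cross (x • a + y • c) (a + c) = (x - y) * cross a c := by simp [cross]; ring
  have e3 : cross (x • a + y • c) c = x * cross a c := by simp [cross]; ring
  rw [hac, mul_one] at e1 e2 e3
  refine ⟨PTB.slopeOf_ne ?_, PTB.slopeOf_ne ?_, PTB.slopeOf_ne ?_⟩ <;> omega

/-- The moves `left` and `right` add the vectors `a`, `c` to each other, so descendants have
nonnegative coordinates forming a matrix of determinant one. The last three clauses say that a
member is either inherited from the original triple or has unequal positive coordinates, hence a
slope strictly inside one of the two halves of the cone. -/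
theorem Descendant.vectors {X₀ Y₀ Z₀ X Y Z : Orb} {a c : ℤ × ℤ}
    (h : Descendant X₀ Y₀ Z₀ X Y Z) (h₀ : IsRotTriple X₀ Y₀ Z₀ a c) :
    ∃ x y z w : ℤ, 0 ≤ x ∧ 0 ≤ y ∧ 0 ≤ z ∧ 0 ≤ w ∧ x * w - y * z = 1 ∧
      IsRotTriple X Y Z (x • a + y • c) (z • a + w • c) ∧
      ((X = X₀ ∧ Y = Y₀ ∧ Z = Z₀) ∨ (1 ≤ x + z ∧ 1 ≤ y + w ∧ x + z ≠ y + w)) ∧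
      ((X = X₀ ∨ X = Y₀ ∨ X = Z₀) ∨ (1 ≤ x ∧ 1 ≤ y ∧ x ≠ y)) ∧
      ((Z = X₀ ∨ Z = Y₀ ∨ Z = Z₀) ∨ (1 ≤ z ∧ 1 ≤ w ∧ z ≠ w)) := by
  induction h with
  | base => exact ⟨1, 0, 0, 1, by simpa using h₀⟩
  | left _ ih =>
    obtain ⟨x, y, z, w, hx, hy, hz, hw, hd, hr, hm, -, hZ⟩ := ih
    refine ⟨x + z, y + w, z, w, by omega, by omega, hz, hw, by linarith, ?_, Or.inr ?_, ?_, hZ⟩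
    · have := hr.left
      rwa [show x • a + y • c + (z • a + w • c) = (x + z) • a + (y + w) • c by
        rw [add_smul, add_smul]; abel] at this
    · have hxz : 1 ≤ x + z := by
        by_contra hlt
        obtain rfl : x = 0 := by omega
        obtain rfl : z = 0 := by omega
        simp at hd
      have hyw : 1 ≤ y + w := by
        by_contra hlt
        obtain rfl : y = 0 := by omega
        obtain rfl : w = 0 := by omega
        simp at hd
      -- If the coordinates of the new middle vector were equal to one number, that number would
      -- divide the determinant and be one, which is too small after a move.
      refine ⟨by omega, by omega, fun he => ?_⟩
      have h1 : (x + z + z) * (w - z) = 1 := by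
        linear_combination hd - z * he
      rcases Int.eq_one_or_neg_one_of_mul_eq_one' h1 with ⟨h2, h3⟩ | ⟨h2, h3⟩ <;> omega
    · rcases hm with ⟨-, h, -⟩ | h
      · exact Or.inl (Or.inr (Or.inl h))
      · exact Or.inr h
  | right _ ih =>
    obtain ⟨x, y, z, w, hx, hy, hz, hw, hd, hr, hm, hX, -⟩ := ih
    refine ⟨x, y, x + z, y + w, hx, hy, by omega, by omega, by linarith, ?_, Or.inr ?_, hX, ?_⟩
    · have := hr.right
      rwa [show x • a + y • c + (z • a + w • c) = (x + z) • a + (y + w) • c by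
        rw [add_smul, add_smul]; abel] at this
    · have hxz : 1 ≤ x + z := by
        by_contra hlt
        obtain rfl : x = 0 := by omega
        obtain rfl : z = 0 := by omega
        simp at hd
      have hyw : 1 ≤ y + w := by
        by_contra hlt
        obtain rfl : y = 0 := by omega
        obtain rfl : w = 0 := by omega
        simp at hd
      refine ⟨by omega, by omega, fun he => ?_⟩
      have h1 : (y + (y + w)) * (x - y) = 1 := by
        linear_combination hd + y * he
      rcases Int.eq_one_or_neg_one_of_mul_eq_one' h1 with ⟨h2, h3⟩ | ⟨h2, h3⟩ <;> omega
    · rcases hm with ⟨-, h, -⟩ | h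
      · exact Or.inl (Or.inr (Or.inl h))
      · exact Or.inr h

/-- The slope of a member of a descendant triple is that of a vertex of the original triangle only
if the member belongs to the original triple. -/
theorem Descendant.mem_of_slope {X₀ Y₀ Z₀ X Y Z : Orb} {a c : ℤ × ℤ}
    (h : Descendant X₀ Y₀ Z₀ X Y Z) (h₀ : IsRotTriple X₀ Y₀ Z₀ a c) :
    (∀ W, W = X ∨ W = Y ∨ W = Z →
      ellSlope W = slopeOf a ∨ ellSlope W = slopeOf (a + c) ∨ ellSlope W = slopeOf c →
      W = X₀ ∨ W = Y₀ ∨ W = Z₀) ∧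
    (ellSlope Y = slopeOf a ∨ ellSlope Y = slopeOf (a + c) ∨ ellSlope Y = slopeOf c →
      X = X₀ ∧ Y = Y₀ ∧ Z = Z₀) := by
  obtain ⟨x, y, z, w, hx, hy, hz, hw, hd, hr, hm, hX, hZ⟩ := h.vectors h₀
  have key : ∀ W (s t : ℤ), IsRot W (s • a + t • c) → (1 ≤ s ∧ 1 ≤ t ∧ s ≠ t) →
      ¬ (ellSlope W = slopeOf a ∨ ellSlope W = slopeOf (a + c) ∨ ellSlope W = slopeOf c) := by
    intro W s t hW hst
    have := (show Beyond a c (s • a + t • c) from ⟨s, t, hst.1, hst.2.1, hst.2.2, rfl⟩).slopeOf_ne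
      h₀.2.2.2
    rw [hW.ellSlope]
    tauto
  have hYr : IsRot Y ((x + z) • a + (y + w) • c) := by
    have := hr.2.1
    rwa [show x • a + y • c + (z • a + w • c) = (x + z) • a + (y + w) • c by
        rw [add_smul, add_smul]; abel] at this
  constructor
  · rintro W (rfl | rfl | rfl) hs
    · exact hX.resolve_right fun h' => key _ _ _ hr.1 h' hs
    · have := hm.resolve_right fun h' => key _ _ _ hYr h' hs
      exact Or.inr (Or.inl this.2.1)
    · exact hZ.resolve_right fun h' => key _ _ _ hr.2.2.1 h' hs
  · intro hs
    exact hm.resolve_right fun h' => key _ _ _ hYr h' hs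

/-! ### The automorphisms `F` and the generators `Q` -/

/-- Since both letters fix `D`, every level has the same period: conjugation by `D` shifts `Q f · n`
by three. -/
theorem letterAut_D (l : Letter) : letterAut l D = D := by
  cases l
  · change autR D = D
    rw [D, map_mul, map_mul, autR_A, autR_B, autR_C]
    rw [show B * (B * C * B) * A = (B * B) * C * B * A by group, B_sq, one_mul]
  · change autL D = D
    rw [D, map_mul, map_mul, autL_A, autL_B, autL_C]
    rw [show C * (B * A * B) * B = C * B * A * (B * B) by group, B_sq, mul_one]

/-- Levels run in both directions, so closure under the inverses of the letters is required as well.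
-/
theorem F_induction (f : ℤ → Letter) {p : MulAut Orb → Prop} (h1 : p 1)
    (hs : ∀ g l, p g → p (g * letterAut l)) (hi : ∀ g l, p g → p (g * (letterAut l)⁻¹)) (n : ℤ) :
    p (F f n) := by
  induction n using Int.induction_on with
  | zero => exact h1
  | succ i ih =>
    rw [F_rec, add_sub_cancel_right]; exact hs _ _ ih
  | pred i ih =>
    have := F_rec f (-(i : ℤ))
    rw [← mul_inv_eq_iff_eq_mul] at this
    rw [← this]; exact hi _ _ ih

theorem F_D (f : ℤ → Letter) (n : ℤ) : F f n D = D := by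
  apply F_induction f (p := fun g => g D = D) rfl
  · intro g l hg; rw [MulAut.mul_apply, letterAut_D, hg]
  · intro g l hg
    have : (letterAut l)⁻¹ D = D := by
      rw [MulAut.inv_apply, MulEquiv.symm_apply_eq, letterAut_D]
    rw [MulAut.mul_apply, this, hg]

theorem Q₁_add_three (m : ℤ) : Q₁ (m + 3) = D * Q₁ m * D⁻¹ := by
  unfold Q₁
  rw [show (m + 3) / 3 = m / 3 + 1 by omega, show (m + 3) % 3 = m % 3 by omega]
  simp only [MulAut.conj_apply, _root_.zpow_add, zpow_one]
  rw [show D ^ (m / 3) * D = D * D ^ (m / 3) by group, _root_.mul_inv_rev]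
  group

theorem Q₁_zero : Q₁ 0 = A := by simp [Q₁]
theorem Q₁_one : Q₁ 1 = B := by simp [Q₁]
theorem Q₁_two : Q₁ 2 = C := by simp [Q₁]

variable (f : ℤ → Letter)

theorem Q_add_three (m n : ℤ) : Q f (m + 3) n = D * Q f m n * D⁻¹ := by
  unfold Q
  rw [Q₁_add_three, map_mul, map_mul, map_inv, F_D]

theorem Q_injective (n : ℤ) : Function.Injective fun m => Q f m n :=
  (F f (n - 1)).injective.comp Q₁_injective

theorem induction_three {p : ℤ → Prop} (h0 : p 0) (h1 : p 1) (h2 : p 2)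
    (hs : ∀ m, p m ↔ p (m + 3)) (m : ℤ) : p m := by
  have key : ∀ k : ℤ, (p (3 * k) ∧ p (3 * k + 1) ∧ p (3 * k + 2)) := by
    intro k
    induction k using Int.induction_on with
    | zero => exact ⟨h0, h1, h2⟩
    | succ i ih =>
      rw [hs, hs (3 * i + 1), hs (3 * i + 2)] at ih
      convert ih using 3 <;> ring
    | pred i ih =>
      rw [hs, hs (3 * (-i - 1) + 1), hs (3 * (-i - 1) + 2)]
      convert ih using 3 <;> ring
  obtain ⟨k0, k1, k2⟩ := key (m / 3)
  have : m = 3 * (m / 3) ∨ m = 3 * (m / 3) + 1 ∨ m = 3 * (m / 3) + 2 := by omega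
  rcases this with h | h | h <;> rw [h] <;> assumption

theorem Q_mul_self (m n : ℤ) : Q f m n * Q f m n = 1 := by
  unfold Q
  rw [← map_mul]
  have : Q₁ m * Q₁ m = 1 := by
    unfold Q₁
    rw [← map_mul]
    split_ifs
    · rw [A_sq, map_one]
    · rw [B_sq, map_one]
    · rw [C_sq, map_one]
  rw [this, map_one]

theorem Q_prod (m n : ℤ) : Q f (m + 2) n * Q f (m + 1) n * Q f m n = D := by
  revert m
  have h0 : Q f 2 n * Q f 1 n * Q f 0 n = D := by
    unfold Q
    rw [← map_mul, ← map_mul, Q₁_zero, Q₁_one, Q₁_two]; exact F_D f _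
  have e3 := Q_add_three f 0 n
  have e4 := Q_add_three f 1 n
  apply induction_three
  · simpa using h0
  · norm_num at e3 ⊢
    rw [e3]; rw [← h0]; group
  · norm_num at e3 e4 ⊢
    rw [e3, e4]; rw [← h0]; group
  · intro m
    rw [show m + 3 + 2 = m + 2 + 3 by ring, show m + 3 + 1 = m + 1 + 3 by ring, Q_add_three,
      Q_add_three, Q_add_three f m]
    rw [show D * Q f (m + 2) n * D⁻¹ * (D * Q f (m + 1) n * D⁻¹) * (D * Q f m n * D⁻¹) =
      D * (Q f (m + 2) n * Q f (m + 1) n * Q f m n) * D⁻¹ by group]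
    rw [mul_inv_eq_iff_eq_mul, mul_right_inj]

theorem Q_three_mul (f : ℤ → Letter) (m r n : ℤ) :
    Q f (3 * m + r) n = D ^ m * Q f r n * (D ^ m)⁻¹ := by
  induction m using Int.induction_on with
  | zero => simp
  | succ i ih =>
    rw [show 3 * ((i : ℤ) + 1) + r = 3 * i + r + 3 by ring, Q_add_three, ih, _root_.zpow_add_one]
    rw [show D ^ (i : ℤ) * D = D * D ^ (i : ℤ) by group]; group
  | pred i ih =>
    have h := Q_add_three f (3 * (-(i : ℤ) - 1) + r) n
    rw [show 3 * (-(i : ℤ) - 1) + r + 3 = 3 * -(i : ℤ) + r by ring, ih] at h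
    have : Q f (3 * (-(i : ℤ) - 1) + r) n =
        D⁻¹ * (D * Q f (3 * (-(i : ℤ) - 1) + r) n * D⁻¹) * D := by group
    rw [this, ← h, _root_.zpow_sub_one]
    rw [show D ^ (-(i : ℤ)) * D⁻¹ = D⁻¹ * D ^ (-(i : ℤ)) by group]; group

theorem Q_zero (f : ℤ → Letter) (n : ℤ) : Q f 0 n = F f (n - 1) A := by rw [Q, Q₁_zero]
theorem Q_one (f : ℤ → Letter) (n : ℤ) : Q f 1 n = F f (n - 1) B := by rw [Q, Q₁_one]
theorem Q_two (f : ℤ → Letter) (n : ℤ) : Q f 2 n = F f (n - 1) C := by rw [Q, Q₁_two]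

theorem F_apply_of_R {f : ℤ → Letter} {n : ℤ} (h : f n = Letter.R) (X : Orb) :
    F f n X = F f (n - 1) (autR X) := by
  rw [F_rec, h]; rfl

theorem F_apply_of_L {f : ℤ → Letter} {n : ℤ} (h : f n = Letter.L) (X : Orb) :
    F f n X = F f (n - 1) (autL X) := by
  rw [F_rec, h]; rfl

variable {f : ℤ → Letter}

/-- This and the next three lemmas are the coincidences along slanted edges: only the members with
index `1` modulo `3` are introduced at the new level. -/
theorem Q_zero_succ_of_R {n : ℤ} (h : f n = Letter.R) (m : ℤ) :
    Q f (3 * m) (n + 1) = Q f (3 * m) n := by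
  have e (k : ℤ) := Q_three_mul f m 0 k
  simp only [add_zero] at e
  rw [e, e, Q_zero, Q_zero, add_sub_cancel_right, F_apply_of_R h, autR_A]

theorem Q_two_succ_of_R {n : ℤ} (h : f n = Letter.R) (m : ℤ) :
    Q f (3 * m + 2) (n + 1) = Q f (3 * m + 1) n := by
  rw [Q_three_mul, Q_three_mul, Q_one, Q_two, add_sub_cancel_right, F_apply_of_R h, autR_C]

theorem Q_zero_succ_of_L {n : ℤ} (h : f n = Letter.L) (m : ℤ) :
    Q f (3 * m) (n + 1) = Q f (3 * m + 1) n := by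
  have e := Q_three_mul f m 0 (n + 1)
  rw [add_zero] at e
  rw [e, Q_three_mul, Q_zero, Q_one, add_sub_cancel_right, F_apply_of_L h, autL_A]

theorem Q_two_succ_of_L {n : ℤ} (h : f n = Letter.L) (m : ℤ) :
    Q f (3 * m + 2) (n + 1) = Q f (3 * m + 2) n := by
  rw [Q_three_mul, Q_three_mul, Q_two, Q_two, add_sub_cancel_right, F_apply_of_L h, autL_C]

/-! ### Slopes of the sequences `Q f · n` -/

variable (f)

/-- The image of the origin under `Q_{0,n}`. -/
def vecA (n : ℤ) : ℤ × ℤ := puncAct (Q f 0 n) (0, 0)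

/-- The image of the origin under `Q_{2,n}`. -/
def vecC (n : ℤ) : ℤ × ℤ := puncAct (Q f 2 n) (0, 0)

theorem IsRot.vec {X : Orb} {v : ℤ × ℤ} (h : IsRot X v) : puncAct X (0, 0) = v := by
  rw [h]; exact sub_zero v

/-- Every letter and its inverse acts on triples by an elementary basis change of `ℤ²`, so the
positive basis present at level `1` persists at all levels. -/
theorem isRotTriple_zero (n : ℤ) :
    IsRotTriple (Q f 0 n) (Q f 1 n) (Q f 2 n) (vecA f n) (vecC f n) := by
  have h : ∃ a c, IsRotTriple (F f (n - 1) A) (F f (n - 1) B) (F f (n - 1) C) a c := by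
    apply F_induction f (p := fun g => ∃ a c, IsRotTriple (g A) (g B) (g C) a c)
    · exact ⟨(1, 0), (0, 1), isRot_A, isRot_B, isRot_C, rfl⟩
    · rintro g l ⟨a, c, h⟩
      cases l
      · have h' : IsRotTriple (g (autR A)) (g (autR B)) (g (autR C)) a (a + c) := by
          rw [autR_A, autR_B, autR_C, map_mul, map_mul]; exact h.right
        exact ⟨_, _, h'⟩
      · have h' : IsRotTriple (g (autL A)) (g (autL B)) (g (autL C)) (a + c) c := by
          rw [autL_A, autL_B, autL_C, map_mul, map_mul]; exact h.left
        exact ⟨_, _, h'⟩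
    · rintro g l ⟨a, c, h⟩
      cases l
      · have eA : autR⁻¹ A = A := by rw [MulAut.inv_apply, MulEquiv.symm_apply_eq, autR_A]
        have eB : autR⁻¹ B = C := by rw [MulAut.inv_apply, MulEquiv.symm_apply_eq, autR_C]
        have eC : autR⁻¹ C = C * B * C := by
          rw [MulAut.inv_apply, MulEquiv.symm_apply_eq, map_mul, map_mul, autR_B, autR_C,
            conj_conj B_sq]
        have h' : IsRotTriple (g (autR⁻¹ A)) (g (autR⁻¹ B)) (g (autR⁻¹ C)) a (c - a) := by
          rw [eA, eB, eC, map_mul, map_mul]; exact h.right_inv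
        exact ⟨_, _, h'⟩
      · have eA : autL⁻¹ A = A * B * A := by
          rw [MulAut.inv_apply, MulEquiv.symm_apply_eq, map_mul, map_mul, autL_A, autL_B,
            conj_conj B_sq]
        have eB : autL⁻¹ B = A := by rw [MulAut.inv_apply, MulEquiv.symm_apply_eq, autL_A]
        have eC : autL⁻¹ C = C := by rw [MulAut.inv_apply, MulEquiv.symm_apply_eq, autL_C]
        have h' : IsRotTriple (g (autL⁻¹ A)) (g (autL⁻¹ B)) (g (autL⁻¹ C)) (a - c) c := by
          rw [eA, eB, eC, map_mul, map_mul]; exact h.left_inv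
        exact ⟨_, _, h'⟩
  obtain ⟨a, c, h⟩ := h
  rw [← Q_zero, ← Q_one, ← Q_two] at h
  have h1 : vecA f n = a := h.1.vec
  have h2 : vecC f n = c := h.2.2.1.vec
  rw [h1, h2]; exact h

theorem cross_vec (n : ℤ) : cross (vecA f n) (vecC f n) = 1 := (isRotTriple_zero f n).2.2.2

/-- The set of slopes of the sequence `Q_{·,n}`. -/
def tri (n : ℤ) : Set (OnePoint ℚ) :=
  {slopeOf (vecA f n), slopeOf (vecA f n + vecC f n), slopeOf (vecC f n)}

/-- A shift by one turns the basis `(a, c)` into `(a + c, -a)`, with the same three slopes. -/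
theorem exists_isRotTriple (n i : ℤ) : ∃ a c,
    IsRotTriple (Q f i n) (Q f (i + 1) n) (Q f (i + 2) n) a c ∧
    ({slopeOf a, slopeOf (a + c), slopeOf c} : Set (OnePoint ℚ)) = tri f n := by
  induction i using Int.induction_on with
  | zero => exact ⟨_, _, isRotTriple_zero f n, rfl⟩
  | succ i ih =>
    obtain ⟨a, c, h, ht⟩ := ih
    refine ⟨a + c, -a, ?_, ?_⟩
    · have := h.rotate
      rw [← Q_add_three] at this
      convert this using 2 <;> ring
    · rw [← ht, show a + c + -a = c by abel, slopeOf_neg]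
      grind
  | pred i ih =>
    obtain ⟨a, c, h, ht⟩ := ih
    refine ⟨-c, a + c, ?_, ?_⟩
    · have h3 := Q_add_three f (-i - 1) n
      rw [show -(i : ℤ) + 2 = -i - 1 + 3 by ring, h3] at h
      have := h.rotate_inv
      convert this using 2 <;> ring
    · rw [← ht, show -c + (a + c) = a by abel, slopeOf_neg]
      grind

theorem slopes_Q (i n : ℤ) : ({ellSlope (Q f i n), ellSlope (Q f (i + 1) n),
    ellSlope (Q f (i + 2) n)} : Set (OnePoint ℚ)) = tri f n := by
  obtain ⟨a, c, h, ht⟩ := exists_isRotTriple f n i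
  rw [h.1.ellSlope, h.2.1.ellSlope, h.2.2.1.ellSlope, ht]

/-! ### Uniqueness of the sequence associated with a triangle -/

/-- The automorphism `F f (n - 1)` fixes `D` and carries `Q₁` to level `n`; the descent for level
`1` is transported by it. -/
theorem exists_descendant_Q {p : ℤ → Orb} (hsq : ∀ j, p j * p j = 1) (hne : ∀ j, p j ≠ 1)
    (hprod : ∀ j, p (j + 2) * p (j + 1) * p j = D) (n : ℤ) : ∃ i j,
    Descendant (Q f i n) (Q f (i + 1) n) (Q f (i + 2) n) (p j) (p (j + 1)) (p (j + 2)) := by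
  set g := F f (n - 1)
  have hD : g⁻¹ D = D := by rw [MulAut.inv_apply, MulEquiv.symm_apply_eq]; exact (F_D f _).symm
  obtain ⟨i, j, h⟩ := exists_descendant (p := fun j => g⁻¹ (p j))
    (fun j => by rw [← map_mul, hsq, map_one])
    (fun j h => hne j ((map_eq_one_iff (g⁻¹) (MulEquiv.injective _)).1 h))
    (fun j => by rw [← map_mul, ← map_mul, hprod, hD])
  refine ⟨i, j, ?_⟩
  have := h.map g.toMonoidHom
  simp only [MulEquiv.toMonoidHom_eq_coe, MonoidHom.coe_coe, MulAut.apply_inv_self] at this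
  exact this

/-- The sequence contains a triple descending from one of level `n`. A member of that triple with a
slope of level `n` is one of the original three by `Descendant.mem_of_slope`; the other members are
its conjugates by powers of `D`, which have the same slopes. -/
theorem exists_eq_Q {p : ℤ → Orb} (hsq : ∀ j, p j * p j = 1) (hne : ∀ j, p j ≠ 1)
    (hprod : ∀ j, p (j + 2) * p (j + 1) * p j = D) (n k : ℤ) (hk : ellSlope (p k) ∈ tri f n) :
    ∃ i, p k = Q f i n := by
  obtain ⟨i, j, h⟩ := exists_descendant_Q f hsq hne hprod n
  obtain ⟨a, c, hr, ht⟩ := exists_isRotTriple f n i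
  have key := (h.mem_of_slope hr).1
  have hmem : ∀ W, W = p j ∨ W = p (j + 1) ∨ W = p (j + 2) → ellSlope W ∈ tri f n →
      ∃ i, W = Q f i n := by
    intro W hW hs
    rw [← ht] at hs
    rcases key W hW hs with h | h | h
    exacts [⟨_, h⟩, ⟨_, h⟩, ⟨_, h⟩]
  have := induction_three (p := fun m => ellSlope (p (m + j)) ∈ tri f n →
    ∃ i, p (m + j) = Q f i n) ?_ ?_ ?_ ?_ (k - j)
  · rw [sub_add_cancel] at this; exact this hk
  · apply hmem; left; simp
  · apply hmem; right; left; rw [add_comm]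
  · apply hmem; right; right; rw [add_comm]
  · intro m
    have e : p (m + 3 + j) = D * p (m + j) * D⁻¹ := by
      rw [show m + 3 + j = m + j + 3 by ring]; exact period_of_prod hprod _
    rw [e, ellSlope_conj_D]
    apply imp_congr_right
    intro _
    constructor
    · rintro ⟨i, hi⟩
      exact ⟨i + 3, by rw [Q_add_three, hi]⟩
    · rintro ⟨i, hi⟩
      refine ⟨i - 3, ?_⟩
      have := Q_add_three f (i - 3) n
      rw [sub_add_cancel, ← hi] at this
      simpa using this

/-- When the middle member of the descendant triple also has a slope of level `n`, no move was made,
so the whole triples agree and periodicity does the rest. -/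
theorem eq_Q_of_slopes {p : ℤ → Orb} (hsq : ∀ j, p j * p j = 1) (hne : ∀ j, p j ≠ 1)
    (hprod : ∀ j, p (j + 2) * p (j + 1) * p j = D) (n : ℤ) (hk : ∀ k, ellSlope (p k) ∈ tri f n) :
    ∃ i, ∀ k, p k = Q f (k + i) n := by
  obtain ⟨i, j, h⟩ := exists_descendant_Q f hsq hne hprod n
  obtain ⟨a, c, hr, ht⟩ := exists_isRotTriple f n i
  have hY := hk (j + 1)
  rw [← ht] at hY
  obtain ⟨h0, h1, h2⟩ := (h.mem_of_slope hr).2 hY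
  refine ⟨i - j, fun k => ?_⟩
  have := induction_three (p := fun m => p (m + j) = Q f (m + i) n) ?_ ?_ ?_ ?_ (k - j)
  · rw [sub_add_cancel, sub_add_eq_add_sub, add_sub_assoc] at this; exact this
  · simpa using h0
  · rw [add_comm 1 j, add_comm 1 i]; exact h1
  · rw [add_comm 2 j, add_comm 2 i]; exact h2
  · intro m
    rw [show m + 3 + j = m + j + 3 by ring, show m + 3 + i = m + i + 3 by ring, Q_add_three,
      period_of_prod hprod]
    simp

/-- If one member were trivial, its two successors would differ by the factor `D`, which acts by
`-1` and fixes the origin. They would share a slope, and a Farey triangle has three. -/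
theorem IsAssociated.ne_one {τ : Set (OnePoint ℚ)} {p : ℤ → Orb} (h : IsAssociated τ p) (j : ℤ) :
    p j ≠ 1 := by
  have hs := h.slopes j
  have hc := h.farey.1
  intro h1
  have h2 : p (j + 2) * p (j + 1) = D := by rw [← h.prod j, h1, mul_one]
  have hv : puncAct (p (j + 1)) (0, 0) = puncAct (p (j + 2)) (0, 0) := by
    have h3 : p (j + 1) = p (j + 2) * D := by rw [← h2, ← mul_assoc, h.sq, one_mul]
    rw [h3, map_mul, Equiv.Perm.mul_apply, puncAct_D]; simp
  have he : ellSlope (p (j + 1)) = ellSlope (p (j + 2)) := by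
    unfold ellSlope; rw [hv]
  rw [he, Set.pair_eq_singleton] at hs
  have := Set.ncard_insert_le (ellSlope (p j)) {ellSlope (p (j + 2))}
  rw [hs, hc, Set.ncard_singleton] at this
  omega

/-- The product `D` of a triple lies in the subgroup it generates, and with `D` the triple can be
shifted by one in either direction. -/
theorem closure_Q (n j : ℤ) :
    Subgroup.closure {Q f j n, Q f (j + 1) n, Q f (j + 2) n} = (⊤ : Subgroup Orb) := by
  have h0 : Subgroup.closure {Q f 0 n, Q f (0 + 1) n, Q f (0 + 2) n} = (⊤ : Subgroup Orb) := by
    have := congrArg (Subgroup.map (F f (n - 1)).toMonoidHom) closure_ABC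
    rw [MonoidHom.map_closure, Subgroup.map_top_of_surjective _ (F f (n - 1)).surjective] at this
    rw [← this]
    congr 1
    simp only [zero_add, Q_zero, Q_one, Q_two]
    simp [Set.image_insert_eq]
  have hD : ∀ j, D ∈ Subgroup.closure {Q f j n, Q f (j + 1) n, Q f (j + 2) n} := by
    intro j
    rw [← Q_prod f j n]
    apply mul_mem (mul_mem _ _) <;> apply Subgroup.subset_closure <;> simp
  have hs : ∀ j, Subgroup.closure {Q f j n, Q f (j + 1) n, Q f (j + 2) n} =
      Subgroup.closure {Q f (j + 1) n, Q f (j + 1 + 1) n, Q f (j + 1 + 2) n} := by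
    intro j
    have e : Q f (j + 1 + 2) n = D * Q f j n * D⁻¹ := by
      rw [show j + 1 + 2 = j + 3 by ring]; exact Q_add_three f j n
    have e' : Q f j n = D⁻¹ * Q f (j + 1 + 2) n * D := by rw [e]; group
    have e'' : Q f (j + 1 + 1) n = Q f (j + 2) n := by rw [show j + 1 + 1 = j + 2 by ring]
    apply le_antisymm <;> rw [Subgroup.closure_le]
    · rintro x (rfl | rfl | rfl)
      · have hD' := hD (j + 1)
        rw [e']
        exact mul_mem (mul_mem (inv_mem hD') (Subgroup.subset_closure (by simp))) hD'
      · apply Subgroup.subset_closure; simp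
      · rw [← e'']; apply Subgroup.subset_closure; simp
    · rintro x (rfl | rfl | rfl)
      · apply Subgroup.subset_closure; simp
      · rw [e'']; apply Subgroup.subset_closure; simp
      · rw [e]
        exact mul_mem (mul_mem (hD j) (Subgroup.subset_closure (by simp))) (inv_mem (hD j))
  induction j using Int.induction_on with
  | zero => exact h0
  | succ i ih => rw [← hs]; exact ih
  | pred i ih =>
    rw [hs, sub_add_cancel]; exact ih

section Associated

variable {f} {σ : ℤ → Set (OnePoint ℚ)}

theorem isAssociated_iff (hσ : ∀ n, σ n = tri f n)
    (hF : ∀ n, IsFareyTriangle (σ n)) (n : ℤ) (p : ℤ → Orb) :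
    IsAssociated (σ n) p ↔ ∃ i, ∀ k, p k = Q f (k + i) n := by
  constructor
  · intro h
    apply eq_Q_of_slopes f h.sq h.ne_one h.prod
    intro k
    rw [← hσ, ← h.slopes k]; simp
  · rintro ⟨i, hi⟩
    obtain rfl : p = fun k => Q f (k + i) n := funext hi
    refine ⟨⟨fun j => Q_mul_self f _ _, fun j => ?_, fun j => ?_⟩, hF n, fun j => ?_⟩
    · rw [show j + 2 + i = j + i + 2 by ring, show j + 1 + i = j + i + 1 by ring]
      exact Q_prod f _ _
    · rw [show j + 2 + i = j + i + 2 by ring, show j + 1 + i = j + i + 1 by ring]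
      exact closure_Q f _ _
    · rw [show j + 2 + i = j + i + 2 by ring, show j + 1 + i = j + i + 1 by ring, hσ]
      exact slopes_Q f _ _

/-- An elliptic generator may come from a sequence associated with any Farey triangle, only its own
slope being a vertex of some `σ n`. This is why `exists_eq_Q`, about a single member, is needed here
and `eq_Q_of_slopes` does not suffice. -/
theorem isDeltaVertex_iff (hσ : ∀ n, σ n = tri f n)
    (hF : ∀ n, IsFareyTriangle (σ n)) (X : Orb) : IsDeltaVertex σ X ↔ ∃ m n, X = Q f m n := by
  constructor
  · rintro ⟨⟨τ, p, j, hp, rfl⟩, n, hn⟩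
    rw [hσ] at hn
    obtain ⟨i, hi⟩ := exists_eq_Q f hp.sq hp.ne_one hp.prod n j hn
    exact ⟨i, n, hi⟩
  · rintro ⟨m, n, rfl⟩
    have : IsAssociated (σ n) (fun k => Q f (k + 0) n) :=
      (isAssociated_iff hσ hF n _).2 ⟨0, fun _ => rfl⟩
    simpa using this.isDeltaVertex m

theorem isDeltaEdge_iff (hσ : ∀ n, σ n = tri f n)
    (hF : ∀ n, IsFareyTriangle (σ n)) (X Y : Orb) :
    IsDeltaEdge σ X Y ↔ ∃ m n, X = Q f m n ∧ Y = Q f (m + 1) n := by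
  constructor
  · rintro ⟨n, p, j, hp, rfl, rfl⟩
    obtain ⟨i, hi⟩ := (isAssociated_iff hσ hF n _).1 hp
    refine ⟨j + i, n, hi j, ?_⟩
    rw [hi, add_right_comm]
  · rintro ⟨m, n, rfl, rfl⟩
    exact ⟨n, fun k => Q f (k + 0) n, m, (isAssociated_iff hσ hF n _).2 ⟨0, fun _ => rfl⟩,
      by simp, by simp⟩

theorem isDeltaFace_iff (hσ : ∀ n, σ n = tri f n)
    (hF : ∀ n, IsFareyTriangle (σ n)) (X Y Z : Orb) :
    IsDeltaFace σ X Y Z ↔ ∃ m n, X = Q f m n ∧ Y = Q f (m + 1) n ∧ Z = Q f (m + 2) n ∧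
      ∃ i, (X = Q f i (n - 1) ∧ Z = Q f (i + 1) (n - 1)) ∨
        (X = Q f i (n + 1) ∧ Z = Q f (i + 1) (n + 1)) := by
  constructor
  · rintro ⟨n, ⟨p, j, hp, rfl, rfl, rfl⟩, n', hn', p', k, hp', h1, h2⟩
    obtain ⟨i, hi⟩ := (isAssociated_iff hσ hF n _).1 hp
    obtain ⟨i', hi'⟩ := (isAssociated_iff hσ hF n' _).1 hp'
    refine ⟨j + i, n, hi j, by rw [hi, add_right_comm], by rw [hi, add_right_comm], k + i', ?_⟩
    rw [← h1, ← h2, hi', hi', add_right_comm k 1 i']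
    rcases hn' with rfl | rfl
    · exact Or.inl ⟨rfl, rfl⟩
    · exact Or.inr ⟨rfl, rfl⟩
  · rintro ⟨m, n, hX, hY, hZ, i, h⟩
    have ha : ∀ n, IsAssociated (σ n) (fun k => Q f (k + 0) n) := fun n =>
      (isAssociated_iff hσ hF n _).2 ⟨0, fun _ => rfl⟩
    refine ⟨n, ⟨_, m, ha n, by simp [hX], by simp [hY], by simp [hZ]⟩, ?_⟩
    rcases h with h | h
    · exact ⟨n - 1, Or.inl rfl, _, i, ha _, by simp [h.1], by simp [h.2]⟩
    · exact ⟨n + 1, Or.inr rfl, _, i, ha _, by simp [h.1], by simp [h.2]⟩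

end Associated

/-! ### Farey triangles -/

theorem cross_comb (u v t : ℤ × ℤ) : cross u v • t = cross t v • u + cross u t • v := by
  ext <;> simp [cross] <;> ring

theorem slopeOf_primVec (s : OnePoint ℚ) : slopeOf (primVec s) = s := by
  induction s using OnePoint.rec with
  | infty => rfl
  | coe s =>
    change slopeOf ((s.den : ℤ), s.num) = _
    unfold slopeOf
    rw [if_neg (by simp)]
    congr 1
    push_cast
    exact Rat.num_div_den s

theorem isCoprime_primVec (s : OnePoint ℚ) : IsCoprime (primVec s).1 (primVec s).2 := by
  induction s using OnePoint.rec with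
  | infty => exact isCoprime_one_right
  | coe s =>
    change IsCoprime (s.den : ℤ) s.num
    rw [Int.isCoprime_iff_gcd_eq_one, Int.gcd_comm]
    exact s.reduced

theorem primVec_ne_zero (s : OnePoint ℚ) : primVec s ≠ 0 := by
  intro h
  have := isCoprime_primVec s
  rw [h] at this
  exact not_isUnit_zero (isCoprime_zero_left.1 this)

theorem primVec_slopeOf {u : ℤ × ℤ} (hu : IsCoprime u.1 u.2) :
    primVec (slopeOf u) = u ∨ primVec (slopeOf u) = -u := by
  have hu0 : u ≠ 0 := by rintro rfl; exact not_isUnit_zero (isCoprime_zero_left.1 hu)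
  set t := primVec (slopeOf u)
  have ht : cross u t = 0 :=
    (slopeOf_eq_iff hu0 (primVec_ne_zero _)).1 (slopeOf_primVec _).symm
  obtain ⟨a, b, hab⟩ := hu
  have htc : IsCoprime t.1 t.2 := isCoprime_primVec _
  unfold cross at ht
  have h1 : t.1 = (a * t.1 + b * t.2) * u.1 := by linear_combination (-t.1) * hab - b * ht
  have h2 : t.2 = (a * t.1 + b * t.2) * u.2 := by linear_combination (-t.2) * hab + a * ht
  set k := a * t.1 + b * t.2
  have hk : IsUnit k := htc.isUnit_of_dvd' ⟨_, h1⟩ ⟨_, h2⟩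
  rcases Int.isUnit_iff.1 hk with h | h <;> rw [h] at h1 h2
  · left; ext <;> linarith
  · right; ext <;> simp <;> linarith

theorem isCoprime_of_cross {u v : ℤ × ℤ} (h : |cross u v| = 1) :
    IsCoprime u.1 u.2 ∧ IsCoprime v.1 v.2 := by
  unfold cross at h
  rcases eq_or_eq_neg_of_abs_eq h with h | h
  · exact ⟨⟨v.2, -v.1, by linarith⟩, ⟨-u.2, u.1, by linarith⟩⟩
  · exact ⟨⟨-v.2, v.1, by linarith⟩, ⟨u.2, -u.1, by linarith⟩⟩

theorem abs_cross_primVec {u t : ℤ × ℤ} (hu : IsCoprime u.1 u.2) :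
    |cross t (primVec (slopeOf u))| = |cross t u| := by
  rcases primVec_slopeOf hu with h | h <;> rw [h]
  rw [show cross t (-u) = -cross t u by simp [cross]; ring, abs_neg]

theorem cross_ne_zero_of_abs {u v : ℤ × ℤ} (h : |cross u v| = 1) : cross u v ≠ 0 := by
  intro h0; rw [h0] at h; simp at h

/-- The two Farey triangles with a given edge. -/
theorem IsFareyTriangle.eq_of_edge {τ : Set (OnePoint ℚ)} (hτ : IsFareyTriangle τ) {u v : ℤ × ℤ}
    (huv : |cross u v| = 1) (hu : slopeOf u ∈ τ) (hv : slopeOf v ∈ τ) :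
    τ = {slopeOf u, slopeOf v, slopeOf (u + v)} ∨ τ = {slopeOf u, slopeOf v, slopeOf (u - v)} := by
  have hne : slopeOf u ≠ slopeOf v := slopeOf_ne (cross_ne_zero_of_abs huv)
  obtain ⟨w, hw⟩ : ∃ w, τ = {slopeOf u, slopeOf v, w} ∧ w ≠ slopeOf u ∧ w ≠ slopeOf v := by
    have hfin : τ.Finite := Set.finite_of_ncard_pos (by rw [hτ.1]; norm_num)
    have hsub : ({slopeOf u, slopeOf v} : Set (OnePoint ℚ)) ⊆ τ := by
      rintro x (rfl | rfl) <;> assumption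
    have hc := Set.ncard_sdiff_add_ncard_of_subset hsub hfin
    rw [Set.ncard_pair hne, hτ.1] at hc
    obtain ⟨w, hw⟩ := Set.ncard_eq_one.1 (show (τ \ {slopeOf u, slopeOf v}).ncard = 1 by omega)
    have hwm : w ∈ τ \ {slopeOf u, slopeOf v} := by rw [hw]; rfl
    refine ⟨w, ?_, fun h => hwm.2 (Or.inl h), fun h => hwm.2 (Or.inr h)⟩
    rw [← Set.sdiff_union_of_subset hsub, hw]
    grind
  obtain ⟨rfl, hwu, hwv⟩ := hw
  obtain ⟨hcu, hcv⟩ := isCoprime_of_cross huv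
  have h1 : |cross (primVec w) u| = 1 := by
    rw [← abs_cross_primVec hcu]
    exact hτ.2 (by simp) hu hwu
  have h2 : |cross (primVec w) v| = 1 := by
    rw [← abs_cross_primVec hcv]
    exact hτ.2 (by simp) hv hwv
  have key := cross_comb u v (primVec w)
  have h3 : cross u (primVec w) = -cross (primVec w) u := by unfold cross; ring
  rw [h3] at key
  have hw : slopeOf (primVec w) = slopeOf (u + v) ∨ slopeOf (primVec w) = slopeOf (u - v) := by
    -- Cramer's rule with all three determinants equal to `±1`.
    have : primVec w = u + v ∨ primVec w = -(u + v) ∨ primVec w = u - v ∨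
        primVec w = -(u - v) := by
      rcases eq_or_eq_neg_of_abs_eq huv with e | e <;>
      rcases eq_or_eq_neg_of_abs_eq h1 with e1 | e1 <;>
      rcases eq_or_eq_neg_of_abs_eq h2 with e2 | e2 <;>
      rw [e, e1, e2] at key <;>
      simp only [one_smul, neg_smul, neg_neg, neg_eq_iff_eq_neg] at key
      · right; right; left; rw [key]; abel
      · right; left; rw [key]; abel
      · left; rw [key]
      · right; right; right; rw [key]; abel
      · right; right; right; rw [key]; abel
      · left; rw [key]; abel
      · right; left; rw [key]
      · right; right; left; rw [key]; abel
    rcases this with h | h | h | h <;> rw [h]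
    · exact Or.inl rfl
    · exact Or.inl (slopeOf_neg _)
    · exact Or.inr rfl
    · exact Or.inr (slopeOf_neg _)
  rw [slopeOf_primVec] at hw
  rcases hw with rfl | rfl
  · exact Or.inl rfl
  · exact Or.inr rfl

/-- A path of adjacent Farey triangles without backtracking turns left or right at each step. -/
theorem farey_step {τ ρ τ' : Set (OnePoint ℚ)} {u v : ℤ × ℤ} (huv : |cross u v| = 1)
    (hτ : τ = {slopeOf u, slopeOf (u + v), slopeOf v})
    (hρ : ρ = {slopeOf u, slopeOf v, slopeOf (u - v)})
    (h' : IsFareyTriangle τ') (hc : (τ ∩ τ').ncard = 2) (h1 : τ' ≠ τ) (h2 : τ' ≠ ρ) :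
    τ' = {slopeOf u, slopeOf (u + (u + v)), slopeOf (u + v)} ∨
      τ' = {slopeOf (u + v), slopeOf (u + v + v), slopeOf v} := by
  have huv' : ¬ (slopeOf u ∈ τ' ∧ slopeOf v ∈ τ') := by
    rintro ⟨hu, hv⟩
    rcases h'.eq_of_edge huv hu hv with h | h
    · apply h1; rw [h, hτ]; grind
    · exact h2 (h.trans hρ.symm)
  obtain ⟨x, y, hxy, hxy'⟩ := Set.ncard_eq_two.1 hc
  have hx : x ∈ τ ∩ τ' := by rw [hxy']; simp
  have hy : y ∈ τ ∩ τ' := by rw [hxy']; simp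
  have hm : slopeOf (u + v) ∈ τ' ∧ (slopeOf u ∈ τ' ∨ slopeOf v ∈ τ') := by
    obtain ⟨hx1, hx2⟩ := hx
    obtain ⟨hy1, hy2⟩ := hy
    rw [hτ] at hx1 hy1
    rcases hx1 with rfl | rfl | rfl <;> rcases hy1 with rfl | rfl | rfl <;> tauto
  obtain ⟨hm, hu | hv⟩ := hm
  · have e : |cross u (u + v)| = 1 := by rw [← huv]; simp [cross]; ring_nf
    rcases h'.eq_of_edge e hu hm with h | h
    · left; rw [h]; grind
    · exfalso; apply h1; rw [h, hτ, show u - (u + v) = -v by abel, slopeOf_neg]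
  · have e : |cross (u + v) v| = 1 := by rw [← huv]; simp [cross]; ring_nf
    rcases h'.eq_of_edge e hm hv with h | h
    · right; rw [h]; grind
    · exfalso; apply h1; rw [h, hτ, add_sub_cancel_right]; grind

/-! ### Sides of the axis -/

/-- A quadratic form that is negative on the vectors whose slopes lie to the right of the geodesic
from `μm` to `μp`. -/
def axisForm (μm μp : ℝ) (v : ℤ × ℤ) : ℝ := (μp - μm) * ((v.2 - μm * v.1) * (v.2 - μp * v.1))

/-- Around an edge of the Farey tessellation this relates the values at the two opposite vertices,
as in Conway's topograph; it is all that is needed to decide on which side of the axis a new vertex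
lies. -/
theorem axisForm_parallelogram (μm μp : ℝ) (u v : ℤ × ℤ) :
    axisForm μm μp (u + v) + axisForm μm μp (u - v) =
      2 * (axisForm μm μp u + axisForm μm μp v) := by
  simp [axisForm]; ring

theorem axisForm_neg (μm μp : ℝ) (u : ℤ × ℤ) : axisForm μm μp (-u) = axisForm μm μp u := by
  simp only [axisForm, Prod.fst_neg, Prod.snd_neg, Int.cast_neg]; ring

theorem onRight_slopeOf {μm μp : ℝ} (hne : μm ≠ μp) {v : ℤ × ℤ} (hv : v ≠ 0) :
    OnRight μm μp (slopeOf v) ↔ axisForm μm μp v < 0 := by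
  obtain ⟨x, y⟩ := v
  unfold slopeOf axisForm
  by_cases hx : x = 0
  · subst hx
    have hy : (y : ℝ) ≠ 0 := by
      intro h; apply hv; ext <;> simp; exact_mod_cast h
    simp only [if_true, Int.cast_zero, mul_zero, sub_zero, OnRight]
    have := mul_self_pos.2 hy
    constructor
    · intro h; nlinarith
    · intro h; by_contra h'; nlinarith
  · simp only [hx, if_false]
    have hx' : (x : ℝ) ≠ 0 := by exact_mod_cast hx
    change (if μm < μp then μm < (((y : ℚ) / x : ℚ) : ℝ) ∧ (((y : ℚ) / x : ℚ) : ℝ) < μp else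
      (((y : ℚ) / x : ℚ) : ℝ) < μp ∨ μm < (((y : ℚ) / x : ℚ) : ℝ)) ↔ _
    push_cast
    set s : ℝ := (y : ℝ) / x with hs
    have hy : (y : ℝ) = s * x := by rw [hs]; field_simp
    have e : ((y : ℝ) - μm * x) * (y - μp * x) = (s - μm) * (s - μp) * (x * x) := by
      rw [hy]; ring
    have hxx : (0 : ℝ) < x * x := mul_self_pos.2 hx'
    rw [e, ← mul_assoc, mul_comm _ (x * x : ℝ), ← smul_eq_mul (x * x : ℝ),
      smul_neg_iff_of_pos_left hxx]
    split_ifs with h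
    · rw [← smul_eq_mul, smul_neg_iff_of_pos_left (sub_pos.2 h)]
      constructor
      · rintro ⟨h1, h2⟩; exact mul_neg_of_pos_of_neg (by linarith) (by linarith)
      · intro h1
        rcases mul_neg_iff.1 h1 with ⟨h2, h3⟩ | ⟨h2, h3⟩
        · exact ⟨by linarith, by linarith⟩
        · linarith
    · have h' : μp < μm := lt_of_le_of_ne (not_lt.1 h) hne.symm
      rw [← smul_eq_mul, smul_neg_iff_of_neg_left (sub_neg.2 h')]
      constructor
      · rintro (h1 | h1)
        · exact mul_pos_of_neg_of_neg (by linarith) (by linarith)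
        · exact mul_pos (by linarith) (by linarith)
      · intro h1
        rcases mul_pos_iff.1 h1 with ⟨h2, h3⟩ | ⟨h2, h3⟩
        · exact Or.inr (by linarith)
        · exact Or.inl (by linarith)

theorem crosses_iff {μm μp : ℝ} (hne : μm ≠ μp) {u v w : ℤ × ℤ} (hu : u ≠ 0) (hv : v ≠ 0)
    (hw : w ≠ 0) : Crosses μm μp {slopeOf u, slopeOf v, slopeOf w} ↔
      (axisForm μm μp u < 0 ∨ axisForm μm μp v < 0 ∨ axisForm μm μp w < 0) ∧
      (0 ≤ axisForm μm μp u ∨ 0 ≤ axisForm μm μp v ∨ 0 ≤ axisForm μm μp w) := by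
  simp [Crosses, onRight_slopeOf hne, hu, hv, hw]

theorem vec_succ_of_R {f : ℤ → Letter} {n : ℤ} (h : f n = Letter.R) :
    vecA f (n + 1) = vecA f n ∧ vecC f (n + 1) = vecA f n + vecC f n := by
  have h0 := Q_zero_succ_of_R h 0
  have h2 := Q_two_succ_of_R h 0
  norm_num at h0 h2
  refine ⟨by rw [vecA, h0]; rfl, ?_⟩
  rw [vecC, h2]
  exact (isRotTriple_zero f n).2.1.vec

theorem vec_succ_of_L {f : ℤ → Letter} {n : ℤ} (h : f n = Letter.L) :
    vecA f (n + 1) = vecA f n + vecC f n ∧ vecC f (n + 1) = vecC f n := by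
  have h0 := Q_zero_succ_of_L h 0
  have h2 := Q_two_succ_of_L h 0
  norm_num at h0 h2
  refine ⟨?_, by rw [vecC, h2]; rfl⟩
  rw [vecA, h0]
  exact (isRotTriple_zero f n).2.1.vec

theorem turn_eq_R {μm μp : ℝ} {σ : ℤ → Set (OnePoint ℚ)} {n : ℤ}
    (h : ∃ v ∈ σ (n - 1) ∩ σ n ∩ σ (n + 1), OnRight μm μp v) : turn μm μp σ n = Letter.R :=
  if_pos h

theorem turn_eq_L {μm μp : ℝ} {σ : ℤ → Set (OnePoint ℚ)} {n : ℤ}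
    (h : ¬ ∃ v ∈ σ (n - 1) ∩ σ n ∩ σ (n + 1), OnRight μm μp v) : turn μm μp σ n = Letter.L :=
  if_neg h

/-- The fixed points are the roots of `bT² - (d - a)T - c`; these are Vieta's formulas, together
with the product of the eigenvalues. -/
theorem eigen_eqs {φ : SpecialLinearGroup (Fin 2) ℤ} {μm μp lm lp : ℝ}
    (hm : IsEigenSlope φ lm μm) (hp : IsEigenSlope φ lp μp) (hlm : |lm| < 1) (hlp : 1 < |lp|) :
    μm ≠ μp ∧ (φ 0 1 : ℝ) ≠ 0 ∧ (φ 0 1 : ℝ) * (μp + μm) = φ 1 1 - φ 0 0 ∧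
      (φ 0 1 : ℝ) * (μp * μm) = - φ 1 0 ∧ lm * lp = 1 := by
  obtain ⟨m1, m2⟩ := hm
  obtain ⟨p1, p2⟩ := hp
  have hll : lm ≠ lp := by rintro rfl; linarith
  have hb : (φ 0 1 : ℝ) * (μp - μm) = lp - lm := by linarith
  have hb0 : (φ 0 1 : ℝ) * (μp - μm) ≠ 0 := by rw [hb]; exact sub_ne_zero.2 hll.symm
  obtain ⟨hb1, hb2⟩ := mul_ne_zero_iff.1 hb0
  have hs : (φ 0 1 : ℝ) * (μp + μm) = φ 1 1 - φ 0 0 := by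
    apply mul_right_cancel₀ hb2
    subst m1 p1
    linear_combination (-1) * p2 + m2
  have hpr : (φ 0 1 : ℝ) * (μp * μm) = - φ 1 0 := by
    subst m1 p1
    linear_combination p2 + μp * hs
  have hdet : (φ 0 0 : ℝ) * φ 1 1 - φ 0 1 * φ 1 0 = 1 := by
    have := φ.det_coe
    rw [Matrix.det_fin_two] at this
    exact_mod_cast this
  refine ⟨fun h => hb2 (by rw [h, sub_self]), hb1, hs, hpr, ?_⟩
  subst m1 p1
  linear_combination (φ 0 0 : ℝ) * hs + (φ 0 1 : ℝ) * hpr + hdet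

theorem slopeMap_eq (φ : SpecialLinearGroup (Fin 2) ℤ) (s : OnePoint ℚ) :
    slopeMap φ s = slopeOf (φ 0 0 * (primVec s).1 + φ 0 1 * (primVec s).2,
      φ 1 0 * (primVec s).1 + φ 1 1 * (primVec s).2) := rfl

theorem cross_linear (φ : SpecialLinearGroup (Fin 2) ℤ) (u v : ℤ × ℤ) :
    cross (φ 0 0 * u.1 + φ 0 1 * u.2, φ 1 0 * u.1 + φ 1 1 * u.2)
      (φ 0 0 * v.1 + φ 0 1 * v.2, φ 1 0 * v.1 + φ 1 1 * v.2) = cross u v := by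
  have := φ.det_coe
  rw [Matrix.det_fin_two] at this
  simp only [cross]
  linear_combination (u.1 * v.2 - u.2 * v.1) * this

theorem linear_ne_zero (φ : SpecialLinearGroup (Fin 2) ℤ) {u : ℤ × ℤ} (hu : u ≠ 0) :
    (φ 0 0 * u.1 + φ 0 1 * u.2, φ 1 0 * u.1 + φ 1 1 * u.2) ≠ (0 : ℤ × ℤ) := by
  have : cross u (-u.2, u.1) ≠ 0 := by
    simp only [cross]
    intro h
    apply hu
    have h1 : u.1 * u.1 + u.2 * u.2 = 0 := by linarith
    ext
    · exact mul_self_eq_zero.1 (by nlinarith [mul_self_nonneg u.1, mul_self_nonneg u.2])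
    · exact mul_self_eq_zero.1 (by nlinarith [mul_self_nonneg u.1, mul_self_nonneg u.2])
  rw [← cross_linear φ] at this
  exact ne_zero_of_cross_left this

theorem slopeMap_injective (φ : SpecialLinearGroup (Fin 2) ℤ) :
    Function.Injective (slopeMap φ) := by
  intro s t h
  rw [slopeMap_eq, slopeMap_eq, slopeOf_eq_iff (linear_ne_zero φ (primVec_ne_zero s))
    (linear_ne_zero φ (primVec_ne_zero t)), cross_linear,
    ← slopeOf_eq_iff (primVec_ne_zero s) (primVec_ne_zero t), slopeOf_primVec,
    slopeOf_primVec] at h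
  exact h

/-- Up to the factor `μp - μm`, `b` times the axis form is the form `by² - (d - a)xy - cx²`, which
`φ` preserves because its determinant is one. -/
theorem onRight_slopeMap {φ : SpecialLinearGroup (Fin 2) ℤ} {μm μp lm lp : ℝ}
    (hm : IsEigenSlope φ lm μm) (hp : IsEigenSlope φ lp μp) (hlm : |lm| < 1) (hlp : 1 < |lp|)
    (s : OnePoint ℚ) : OnRight μm μp (slopeMap φ s) ↔ OnRight μm μp s := by
  obtain ⟨hne, hb, hs, hpr, -⟩ := eigen_eqs hm hp hlm hlp
  have hdet : (φ 0 0 : ℝ) * φ 1 1 - φ 0 1 * φ 1 0 = 1 := by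
    have := φ.det_coe
    rw [Matrix.det_fin_two] at this
    exact_mod_cast this
  conv_rhs => rw [← slopeOf_primVec s]
  rw [slopeMap_eq, onRight_slopeOf hne (linear_ne_zero φ (primVec_ne_zero s)),
    onRight_slopeOf hne (primVec_ne_zero s)]
  have : axisForm μm μp (φ 0 0 * (primVec s).1 + φ 0 1 * (primVec s).2,
      φ 1 0 * (primVec s).1 + φ 1 1 * (primVec s).2) = axisForm μm μp (primVec s) := by
    apply mul_left_cancel₀ hb
    simp only [axisForm]
    push_cast
    generalize ((primVec s).1 : ℝ) = x
    generalize ((primVec s).2 : ℝ) = y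
    have e : ∀ x y : ℝ, (φ 0 1 : ℝ) * ((μp - μm) * ((y - μm * x) * (y - μp * x))) = (μp - μm) *
        (φ 0 1 * (y * y) - (φ 1 1 - φ 0 0) * (x * y) - φ 1 0 * (x * x)) := by
      intro x y
      linear_combination (μp - μm) * (-(x * y) * hs + x * x * hpr)
    rw [e, e]
    linear_combination (μp - μm) *
      (φ 0 1 * (y * y) - (φ 1 1 - φ 0 0) * (x * y) - φ 1 0 * (x * x)) * hdet
  rw [this]

/-! ### The triangles along the axis -/

section Sequence

variable {φ : SpecialLinearGroup (Fin 2) ℤ} {μm μp : ℝ} {σ : ℤ → Set (OnePoint ℚ)}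

theorem turn_periodic (hμm : IsRepulsive φ μm) (hμp : IsAttractive φ μp) {p : ℤ}
    (hp : ∀ n, slopeMap φ '' σ n = σ (n + p)) (n : ℤ) :
    turn μm μp σ (n + p) = turn μm μp σ n := by
  obtain ⟨lm, hlm, hm⟩ := hμm
  obtain ⟨lp, hlp, hq⟩ := hμp
  have e : σ (n + p - 1) ∩ σ (n + p) ∩ σ (n + p + 1) =
      slopeMap φ '' (σ (n - 1) ∩ σ n ∩ σ (n + 1)) := by
    rw [Set.image_inter (slopeMap_injective φ), Set.image_inter (slopeMap_injective φ), hp, hp, hp]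
    congr 2 <;> ring_nf
  have key : (∃ v ∈ σ (n + p - 1) ∩ σ (n + p) ∩ σ (n + p + 1), OnRight μm μp v) ↔
      ∃ v ∈ σ (n - 1) ∩ σ n ∩ σ (n + 1), OnRight μm μp v := by
    rw [e]
    simp only [Set.exists_mem_image, onRight_slopeMap hm hq hlm hlp]
  by_cases h : ∃ v ∈ σ (n - 1) ∩ σ n ∩ σ (n + 1), OnRight μm μp v
  · rw [turn_eq_R h, turn_eq_R (key.2 h)]
  · rw [turn_eq_L h, turn_eq_L (fun h' => h (key.1 h'))]

theorem IsFareySequence.isFareyTriangle (hσ : IsFareySequence φ μm μp σ) (n : ℤ) :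
    IsFareyTriangle (σ n) := by
  have : σ n ∈ Set.range σ := ⟨n, rfl⟩
  rw [hσ.range] at this
  exact this.1

theorem IsFareySequence.crosses (hσ : IsFareySequence φ μm μp σ) (n : ℤ) :
    Crosses μm μp (σ n) := by
  have : σ n ∈ Set.range σ := ⟨n, rfl⟩
  rw [hσ.range] at this
  exact this.2

/-- The triangles after the first one lie in the first quadrant. -/
theorem IsFareySequence.nonneg (hσ : IsFareySequence φ μm μp σ)
    (hσ₀ : σ 0 = {OnePoint.some 0, OnePoint.infty, OnePoint.some (-1)})
    (hσ₁ : σ 1 = {OnePoint.some 0, OnePoint.some 1, OnePoint.infty}) (k : ℕ) :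
    ∃ u v : ℤ × ℤ, (0 ≤ u.1 ∧ 0 ≤ u.2 ∧ 0 ≤ v.1 ∧ 0 ≤ v.2) ∧ |cross u v| = 1 ∧
      σ (k + 1) = {slopeOf u, slopeOf (u + v), slopeOf v} ∧
      σ k = {slopeOf u, slopeOf v, slopeOf (u - v)} := by
  induction k with
  | zero =>
    refine ⟨(1, 0), (0, 1), by simp, by simp [cross], ?_, ?_⟩
    · rw [Nat.cast_zero, zero_add, hσ₁]; simp [slopeOf]
    · rw [Nat.cast_zero, hσ₀]; simp [slopeOf]
  | succ k ih =>
    obtain ⟨u, v, hpos, hc, h1, h0⟩ := ih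
    have hcard := hσ.adj (k + 1)
    push_cast
    rcases farey_step hc h1 h0 (hσ.isFareyTriangle (k + 1 + 1)) hcard
      (fun h => by have := hσ.inj h; omega) (fun h => by have := hσ.inj h; omega) with h | h
    · refine ⟨u, u + v, ?_, ?_, h, ?_⟩
      · simp only [Prod.fst_add, Prod.snd_add]; omega
      · rw [← hc]; simp only [cross, Prod.fst_add, Prod.snd_add]; ring_nf
      · rw [h1, show u - (u + v) = -v by abel, slopeOf_neg]
    · refine ⟨u + v, v, ?_, ?_, h, ?_⟩
      · simp only [Prod.fst_add, Prod.snd_add]; omega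
      · rw [← hc]; simp only [cross, Prod.fst_add, Prod.snd_add]; ring_nf
      · rw [h1, add_sub_cancel_right]; grind

/-- The first two triangles are crossed through the edge from `0` to `∞`, so these slopes lie on
different sides. Which one is on the right depends on the direction of the axis, and that is fixed
by the requirement that `φ` shifts indices upwards. -/
theorem orientation (hφ : 2 < |φ 0 0 + φ 1 1|) (hμm : IsRepulsive φ μm)
    (hμp : IsAttractive φ μp) (hσ : IsFareySequence φ μm μp σ)
    (hσ₀ : σ 0 = {OnePoint.some 0, OnePoint.infty, OnePoint.some (-1)})
    (hσ₁ : σ 1 = {OnePoint.some 0, OnePoint.some 1, OnePoint.infty}) :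
    axisForm μm μp (1, 0) < 0 ∧ 0 ≤ axisForm μm μp (0, 1) := by
  obtain ⟨lm, hlm, hm⟩ := hμm
  obtain ⟨lp, hlp, hq⟩ := hμp
  obtain ⟨hne, hb, hs, hpr, hll⟩ := eigen_eqs hm hq hlm hlp
  have e0 : (OnePoint.some 0 : OnePoint ℚ) = slopeOf (1, 0) := by simp [slopeOf]
  have e1 : (OnePoint.some 1 : OnePoint ℚ) = slopeOf (1, 1) := by simp [slopeOf]
  have e2 : (OnePoint.some (-1) : OnePoint ℚ) = slopeOf (1, -1) := by simp [slopeOf]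
  have e3 : (OnePoint.infty : OnePoint ℚ) = slopeOf (0, 1) := by simp [slopeOf]
  have c0 := hσ.crosses 0
  have c1 := hσ.crosses 1
  rw [hσ₀, e0, e2, e3, crosses_iff hne (by decide) (by decide) (by decide)] at c0
  rw [hσ₁, e0, e1, e3, crosses_iff hne (by decide) (by decide) (by decide)] at c1
  have hpar := axisForm_parallelogram μm μp (1, 0) (0, 1)
  norm_num at hpar
  by_cases hA : axisForm μm μp (1, 0) < 0 <;> by_cases hC : axisForm μm μp (0, 1) < 0
  · exfalso
    -- With `0` and `∞` both on the right, the slopes `1` and `-1` would both have to be off it,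
    -- against the parallelogram law.
    rcases c1.2 with h | h | h
    · linarith
    · rcases c0.2 with h' | h' | h' <;> linarith
    · linarith
  · exact ⟨hA, not_lt.1 hC⟩
  · exfalso
    -- The reversed direction forces `μp < 0 < μm`. Then `φ` moves `0` towards `μp`, to a negative
    -- slope, whereas it maps `σ 1` to a later triangle, whose slopes are nonnegative or infinite.
    have hpm : μp < μm := by simpa [axisForm] using hC
    have hle : μp * μm ≤ 0 := by
      simp only [axisForm, Int.cast_zero, Int.cast_one] at hA
      by_contra hlt
      push Not at hlt
      apply hA
      have := mul_pos hlt (sub_pos.2 hpm)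
      nlinarith
    have hdet := φ.det_coe
    rw [Matrix.det_fin_two] at hdet
    have hc0 : (φ 1 0 : ℝ) ≠ 0 := by
      intro h
      have h' : φ 1 0 = 0 := by exact_mod_cast h
      rw [h', mul_zero, sub_zero] at hdet
      rcases Int.eq_one_or_neg_one_of_mul_eq_one' hdet with ⟨h1, h2⟩ | ⟨h1, h2⟩ <;>
        rw [h1, h2] at hφ <;> norm_num at hφ
    have hlt : μp * μm < 0 := by
      refine lt_of_le_of_ne hle fun h => hc0 ?_
      rw [h, mul_zero] at hpr; linarith
    have hp0 : μp < 0 := by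
      by_contra h
      nlinarith [mul_nonneg (not_lt.1 h) ((not_lt.1 h).trans hpm.le)]
    have hm0 : 0 < μm := by
      by_contra h
      nlinarith [mul_nonneg_of_nonpos_of_nonpos hp0.le (not_lt.1 h)]
    have hneg : φ 0 0 * φ 1 0 < 0 := by
      obtain ⟨m1, -⟩ := hm
      obtain ⟨p1, -⟩ := hq
      have g1 : (φ 0 0 : ℝ) * (μm - μp) = lp * μm - lm * μp := by
        linear_combination μm * p1 - μp * m1
      have g2 : (φ 0 1 : ℝ) * (μm - μp) = lm - lp := by linarith
      have hlp2 : 1 < lp * lp := by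
        have := abs_mul_abs_self lp; nlinarith
      have hlm2 : 0 < lm * lm := mul_self_pos.2 (left_ne_zero_of_mul (by rw [hll]; norm_num))
      have hlm3 : lm * lm < 1 := by
        have := abs_mul_abs_self lm
        have := abs_nonneg lm
        nlinarith
      -- The product of `g1` and `g2`, simplified by `lm * lp = 1`; both summands on the right are
      -- negative.
      have g3 : (φ 0 0 : ℝ) * φ 0 1 * ((μm - μp) * (μm - μp)) =
          (1 - lp * lp) * μm + (1 - lm * lm) * μp := by
        linear_combination (φ 0 1 : ℝ) * (μm - μp) * g1 + (lp * μm - lm * μp) * g2 +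
          (μm + μp) * hll
      have g4 : (φ 0 0 : ℝ) * φ 0 1 < 0 := by
        have : (φ 0 0 : ℝ) * φ 0 1 * ((μm - μp) * (μm - μp)) < 0 := by
          rw [g3]; nlinarith
        by_contra h
        nlinarith [mul_nonneg (not_lt.1 h) (mul_self_nonneg (μm - μp))]
      have g5 : (0 : ℝ) < φ 0 1 * φ 1 0 := by
        have : (φ 0 1 : ℝ) * φ 1 0 = φ 0 1 * φ 0 1 * (-(μp * μm)) := by
          linear_combination (φ 0 1 : ℝ) * hpr
        rw [this]
        exact mul_pos (mul_self_pos.2 hb) (by linarith)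
      have g6 : (φ 0 0 : ℝ) * φ 1 0 < 0 := by
        by_contra h
        have h1 := mul_nonneg (not_lt.1 h) (mul_self_nonneg (φ 0 1 : ℝ))
        have h2 := mul_neg_of_neg_of_pos g4 g5
        nlinarith
      exact_mod_cast g6
    obtain ⟨p, hp, hdir⟩ := hσ.dir
    have hmem : slopeMap φ (OnePoint.some 0) ∈ σ (1 + p) := by
      rw [← hdir]; exact ⟨_, by rw [hσ₁]; simp, rfl⟩
    obtain ⟨k, rfl⟩ := Int.eq_ofNat_of_zero_le hp.le
    obtain ⟨u, v, hpos, hc, h1, -⟩ := hσ.nonneg hσ₀ hσ₁ k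
    rw [add_comm, h1] at hmem
    have hmap : slopeMap φ (OnePoint.some 0) = slopeOf (φ 0 0, φ 1 0) := by
      rw [slopeMap_eq]
      change slopeOf (φ 0 0 * ((0 : ℚ).den : ℤ) + φ 0 1 * (0 : ℚ).num,
        φ 1 0 * ((0 : ℚ).den : ℤ) + φ 1 1 * (0 : ℚ).num) = _
      simp
    have key : ∀ w : ℤ × ℤ, 0 ≤ w.1 → 0 ≤ w.2 → w ≠ 0 → slopeMap φ (OnePoint.some 0) ≠
        slopeOf w := by
      intro w h1 h2 hw h
      have hnz : (φ 0 0, φ 1 0) ≠ (0 : ℤ × ℤ) := by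
        intro h; simp only [Prod.mk_eq_zero] at h; rw [h.1] at hneg; simp at hneg
      rw [hmap, slopeOf_eq_iff hnz hw] at h
      simp only [cross] at h
      have hz1 : φ 0 0 * φ 0 0 * w.2 = φ 0 0 * φ 1 0 * w.1 := by linear_combination φ 0 0 * h
      have hz2 : 0 ≤ φ 0 0 * φ 0 0 * w.2 := mul_nonneg (mul_self_nonneg _) h2
      have hw1 : w.1 = 0 := by
        by_contra h'
        have : 0 < w.1 := by omega
        have := mul_neg_of_neg_of_pos hneg this
        omega
      have hw2 : w.2 = 0 := by
        rw [hw1, mul_zero] at hz1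
        rcases mul_eq_zero.1 hz1 with h | h
        · rw [mul_self_eq_zero] at h; rw [h] at hneg; simp at hneg
        · exact h
      exact hw (Prod.ext hw1 hw2)
    have hcu := cross_ne_zero_of_abs hc
    have huv : u + v ≠ 0 := by
      apply ne_zero_of_cross_left (v := v)
      rwa [show cross (u + v) v = cross u v by simp [cross]; ring]
    rcases hmem with h | h | h
    · exact key u hpos.1 hpos.2.1 (ne_zero_of_cross_left hcu) h
    · exact key (u + v) (by simp; omega) (by simp; omega) huv h
    · exact key v hpos.2.2.1 hpos.2.2.2 (ne_zero_of_cross_right hcu) h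
  · exfalso
    rcases c1.1 with h | h | h
    · linarith
    · rcases c0.1 with h' | h' | h' <;> linarith
    · linarith

/-- Triangle number `n` has the slopes of the sequence `Q_{·,n}`, and the axis crosses it with the
slope of `Q_{0,n}` to the right. -/
def Adapted (μm μp : ℝ) (σ : ℤ → Set (OnePoint ℚ)) (f : ℤ → Letter) (n : ℤ) : Prop :=
  σ n = tri f n ∧
  σ (n - 1) = {slopeOf (vecA f n), slopeOf (vecC f n), slopeOf (vecA f n - vecC f n)} ∧
  axisForm μm μp (vecA f n) < 0 ∧ 0 ≤ axisForm μm μp (vecC f n)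

/-- The next triangle contains `a + c` and one of `a`, `c`. If it contains `a` it is crossed, and by
the parallelogram law `a + c` cannot be on the right; then `a` is the common vertex and the turn is
`R`. The other case is symmetric, and in both the letter changes `vecA`, `vecC` into the new basis.
-/
theorem Adapted.succ (hσ : IsFareySequence φ μm μp σ) (hne : μm ≠ μp) {f : ℤ → Letter}
    (hf : f = turn μm μp σ) {n : ℤ} (h : Adapted μm μp σ f n) : Adapted μm μp σ f (n + 1) := by
  obtain ⟨h0, h1, hA, hC⟩ := h
  have hc := cross_vec f n
  unfold tri at h0
  set a := vecA f n with ha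
  set c := vecC f n with hc'
  have hc1 : |cross a c| = 1 := by rw [hc]; rfl
  have hac0 : a + c ≠ 0 := ne_zero_of_cross_left (v := c) (by
    rw [show cross (a + c) c = cross a c by simp [cross]; ring, hc]; norm_num)
  have hpar1 := axisForm_parallelogram μm μp a (a + c)
  have hpar2 := axisForm_parallelogram μm μp (a + c) c
  rw [show a - (a + c) = -c by abel, axisForm_neg] at hpar1
  rw [add_sub_cancel_right] at hpar2
  have a0 : a ≠ 0 := ne_zero_of_cross_left (by rw [hc]; norm_num : cross a c ≠ 0)
  have c0 : c ≠ 0 := ne_zero_of_cross_right (by rw [hc]; norm_num : cross a c ≠ 0)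
  have hcr := hσ.crosses (n + 1)
  rcases farey_step hc1 h0 h1 (hσ.isFareyTriangle (n + 1)) (hσ.adj n)
    (fun h => by have := hσ.inj h; omega) (fun h => by have := hσ.inj h; omega) with h | h
  · have haac0 : a + (a + c) ≠ 0 := ne_zero_of_cross_left (v := c) (by
      rw [show cross (a + (a + c)) c = 2 * cross a c by simp [cross]; ring, hc]; norm_num)
    have hB : 0 ≤ axisForm μm μp (a + c) := by
      -- Otherwise the opposite vertex `2a + c` would be on the right as well, leaving no vertex of
      -- the triangle off the right side.
      by_contra hB
      rw [h, crosses_iff hne a0 haac0 hac0] at hcr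
      rcases hcr.2 with h' | h' | h' <;> linarith
    have hR : f n = Letter.R := by
      rw [hf]
      apply turn_eq_R
      refine ⟨slopeOf a, ⟨⟨?_, ?_⟩, ?_⟩, (onRight_slopeOf hne a0).2 hA⟩
      · rw [h1]; simp
      · rw [h0]; simp
      · rw [h]; simp
    obtain ⟨eA, eC⟩ := vec_succ_of_R hR
    rw [← ha] at eA eC
    rw [← hc'] at eC
    refine ⟨?_, ?_, by rw [eA]; exact hA, by rw [eC]; exact hB⟩
    · rw [tri, eA, eC, h]
    · rw [eA, eC, add_sub_cancel_right, h0, show a - (a + c) = -c by abel, slopeOf_neg]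
  · have hacc0 : a + c + c ≠ 0 := ne_zero_of_cross_left (v := c) (by
      rw [show cross (a + c + c) c = cross a c by simp [cross]; ring, hc]; norm_num)
    have hB : axisForm μm μp (a + c) < 0 := by
      by_contra hB
      rw [h, crosses_iff hne hac0 hacc0 c0] at hcr
      rcases hcr.1 with h' | h' | h' <;> linarith
    have hL : f n = Letter.L := by
      rw [hf]
      apply turn_eq_L
      rintro ⟨v, ⟨⟨hv1, hv2⟩, hv3⟩, hv⟩
      rw [h1] at hv1
      rw [h0] at hv2
      rw [h] at hv3
      have ne1 : slopeOf a ≠ slopeOf (a + c) := slopeOf_ne (by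
        rw [show cross a (a + c) = cross a c by simp [cross]; ring, hc]; norm_num)
      have ne2 : slopeOf a ≠ slopeOf (a + c + c) := slopeOf_ne (by
        rw [show cross a (a + c + c) = 2 * cross a c by simp [cross]; ring, hc]; norm_num)
      have ne3 : slopeOf a ≠ slopeOf c := slopeOf_ne (by rw [hc]; norm_num)
      have ne4 : slopeOf (a + c) ≠ slopeOf c := slopeOf_ne (by
        rw [show cross (a + c) c = cross a c by simp [cross]; ring, hc]; norm_num)
      have ne5 : slopeOf (a + c) ≠ slopeOf (a - c) := slopeOf_ne (by
        rw [show cross (a + c) (a - c) = -2 * cross a c by simp [cross]; ring, hc]; norm_num)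
      rcases hv2 with rfl | rfl | rfl
      · rcases hv3 with h' | h' | h' <;> tauto
      · rcases hv1 with h' | h' | h'
        · exact ne1 h'.symm
        · exact ne4 h'
        · exact ne5 h'
      · rw [onRight_slopeOf hne c0] at hv; linarith
    obtain ⟨eA, eC⟩ := vec_succ_of_L hL
    rw [← hc'] at eA eC
    rw [← ha] at eA
    refine ⟨?_, ?_, by rw [eA]; exact hB, by rw [eC]; exact hC⟩
    · rw [tri, eA, eC, h]
    · rw [eA, eC, add_sub_cancel_right, add_sub_cancel_right, h0]; grind

/-- The same step read backwards, with the basis `(a, -c)`: from `σ n` across `σ (n - 1)`, whose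
third vertex has direction `a - c`. -/
theorem Adapted.pred (hσ : IsFareySequence φ μm μp σ) (hne : μm ≠ μp) {f : ℤ → Letter}
    (hf : f = turn μm μp σ) {n : ℤ} (h : Adapted μm μp σ f n) : Adapted μm μp σ f (n - 1) := by
  obtain ⟨h0, h1, hA, hC⟩ := h
  have hc := cross_vec f n
  unfold tri at h0
  set a := vecA f n with ha
  set c := vecC f n with hc'
  have hc1 : |cross a (-c)| = 1 := by
    rw [show cross a (-c) = -cross a c by simp [cross]; ring, hc]; rfl
  have hpar1 := axisForm_parallelogram μm μp a (a - c)
  have hpar2 := axisForm_parallelogram μm μp (a - c) (-c)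
  rw [show a - (a - c) = c by abel] at hpar1
  rw [show a - c - -c = a by abel, axisForm_neg] at hpar2
  have a0 : a ≠ 0 := ne_zero_of_cross_left (by rw [hc]; norm_num : cross a c ≠ 0)
  have c0 : c ≠ 0 := ne_zero_of_cross_right (by rw [hc]; norm_num : cross a c ≠ 0)
  have hac0 : a - c ≠ 0 := ne_zero_of_cross_left (v := c) (by
    rw [show cross (a - c) c = cross a c by simp [cross]; ring, hc]; norm_num)
  have hcr := hσ.crosses (n - 1 - 1)
  have hadj := hσ.adj (n - 1 - 1)
  rw [Set.inter_comm, sub_add_cancel] at hadj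
  have h1' : σ (n - 1) = {slopeOf a, slopeOf (a + -c), slopeOf (-c)} := by
    rw [h1, slopeOf_neg, ← sub_eq_add_neg]; grind
  have h0' : σ n = {slopeOf a, slopeOf (-c), slopeOf (a - -c)} := by
    rw [h0, slopeOf_neg, sub_neg_eq_add]; grind
  rcases farey_step hc1 h1' h0' (hσ.isFareyTriangle (n - 1 - 1)) hadj
    (fun h => by have := hσ.inj h; omega) (fun h => by have := hσ.inj h; omega) with h | h <;>
    rw [← sub_eq_add_neg] at h
  · have haac0 : a + (a - c) ≠ 0 := ne_zero_of_cross_left (v := c) (by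
      rw [show cross (a + (a - c)) c = 2 * cross a c by simp [cross]; ring, hc]; norm_num)
    have hB : 0 ≤ axisForm μm μp (a - c) := by
      by_contra hB
      rw [h, crosses_iff hne a0 haac0 hac0] at hcr
      rcases hcr.2 with h' | h' | h' <;> linarith
    have hR : f (n - 1) = Letter.R := by
      rw [hf]
      apply turn_eq_R
      refine ⟨slopeOf a, ⟨⟨?_, ?_⟩, ?_⟩, (onRight_slopeOf hne a0).2 hA⟩
      · rw [h]; simp
      · rw [h1]; simp
      · rw [sub_add_cancel, h0]; simp
    obtain ⟨eA, eC⟩ := vec_succ_of_R hR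
    rw [sub_add_cancel, ← ha] at eA
    rw [sub_add_cancel, ← hc', ← eA] at eC
    have eC' : vecC f (n - 1) = c - a := by rw [eC]; abel
    refine ⟨?_, ?_, by rw [← eA]; exact hA, ?_⟩
    · rw [tri, ← eA, eC', h1, add_sub_cancel, ← neg_sub a c, slopeOf_neg]
    · rw [← eA, eC', h, ← neg_sub a c, slopeOf_neg, sub_neg_eq_add]; grind
    · rw [eC', ← neg_sub a c, axisForm_neg]; exact hB
  · have hacc0 : a - c + -c ≠ 0 := ne_zero_of_cross_left (v := c) (by
      rw [show cross (a - c + -c) c = cross a c by simp [cross]; ring, hc]; norm_num)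
    have hB : axisForm μm μp (a - c) < 0 := by
      by_contra hB
      rw [h, crosses_iff hne hac0 hacc0 (neg_ne_zero.2 c0), axisForm_neg] at hcr
      rcases hcr.1 with h' | h' | h' <;> linarith
    have hL : f (n - 1) = Letter.L := by
      rw [hf]
      apply turn_eq_L
      rintro ⟨v, ⟨⟨hv1, hv2⟩, hv3⟩, hv⟩
      rw [h, slopeOf_neg] at hv1
      rw [h1] at hv2
      rw [sub_add_cancel, h0] at hv3
      have ne1 : slopeOf a ≠ slopeOf (a - c) := slopeOf_ne (by
        rw [show cross a (a - c) = -cross a c by simp [cross]; ring, hc]; norm_num)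
      have ne2 : slopeOf a ≠ slopeOf (a - c + -c) := slopeOf_ne (by
        rw [show cross a (a - c + -c) = -2 * cross a c by simp [cross]; ring, hc]; norm_num)
      have ne3 : slopeOf a ≠ slopeOf c := slopeOf_ne (by rw [hc]; norm_num)
      have ne4 : slopeOf (a - c) ≠ slopeOf c := slopeOf_ne (by
        rw [show cross (a - c) c = cross a c by simp [cross]; ring, hc]; norm_num)
      have ne5 : slopeOf (a - c) ≠ slopeOf (a + c) := slopeOf_ne (by
        rw [show cross (a - c) (a + c) = 2 * cross a c by simp [cross]; ring, hc]; norm_num)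
      rcases hv2 with rfl | rfl | rfl
      · rcases hv1 with h' | h' | h' <;> tauto
      · rw [onRight_slopeOf hne c0] at hv; linarith
      · rcases hv3 with h' | h' | h'
        · exact ne1 h'.symm
        · exact ne5 h'
        · exact ne4 h'
    obtain ⟨eA, eC⟩ := vec_succ_of_L hL
    rw [sub_add_cancel, ← hc'] at eC
    rw [sub_add_cancel, ← ha, ← eC] at eA
    have eA' : vecA f (n - 1) = a - c := by rw [eA]; abel
    refine ⟨?_, ?_, by rw [eA']; exact hB, by rw [← eC]; exact hC⟩
    · rw [tri, ← eC, eA', sub_add_cancel, h1]; grind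
    · rw [← eC, eA', h, slopeOf_neg, ← sub_eq_add_neg]; grind

theorem farey_eq_tri (hφ : 2 < |φ 0 0 + φ 1 1|) (hμm : IsRepulsive φ μm)
    (hμp : IsAttractive φ μp) (hσ : IsFareySequence φ μm μp σ)
    (hσ₀ : σ 0 = {OnePoint.some 0, OnePoint.infty, OnePoint.some (-1)})
    (hσ₁ : σ 1 = {OnePoint.some 0, OnePoint.some 1, OnePoint.infty})
    {f : ℤ → Letter} (hf : f = turn μm μp σ) (n : ℤ) : σ n = tri f n := by
  have hne : μm ≠ μp := by
    obtain ⟨lm, hlm, hm⟩ := hμm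
    obtain ⟨lp, hlp, hq⟩ := hμp
    exact (eigen_eqs hm hq hlm hlp).1
  obtain ⟨o1, o2⟩ := orientation hφ hμm hμp hσ hσ₀ hσ₁
  have hA : vecA f 1 = (1, 0) := by
    rw [vecA, Q_zero]; exact isRot_A.vec
  have hC : vecC f 1 = (0, 1) := by
    rw [vecC, Q_two]; exact isRot_C.vec
  have base : Adapted μm μp σ f 1 := by
    refine ⟨?_, ?_, by rwa [hA], by rwa [hC]⟩
    · rw [tri, hA, hC, hσ₁]; simp [slopeOf]
    · rw [hA, hC, sub_self, hσ₀]; simp [slopeOf]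
  have : ∀ k : ℤ, Adapted μm μp σ f (k + 1) := by
    intro k
    induction k using Int.induction_on with
    | zero => exact base
    | succ i ih => exact ih.succ hσ hne hf
    | pred i ih =>
      have := ih.pred hσ hne hf
      rwa [sub_add_eq_add_sub]
  have h := this (n - 1)
  rw [sub_add_cancel] at h
  exact h.1

/-- The letters are periodic with the period by which `φ` shifts the triangles, and both letters
occur. -/
theorem letters_unbounded (hμm : IsRepulsive φ μm) (hμp : IsAttractive φ μp)
    (hσ : IsFareySequence φ μm μp σ) {f : ℤ → Letter} (hf : f = turn μm μp σ)
    (hf₀ : f 0 = Letter.L) (hf₁ : f 1 = Letter.R) (l : Letter) (N : ℤ) :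
    (∃ k < N, f k = l) ∧ ∃ k > N, f k = l := by
  obtain ⟨p, hp, hdir⟩ := hσ.dir
  have hper : Function.Periodic f p := by
    intro n; rw [hf]; exact turn_periodic hμm hμp hdir n
  obtain ⟨j, hj⟩ : ∃ j, f j = l := by cases l; exacts [⟨1, hf₁⟩, ⟨0, hf₀⟩]
  have h (k : ℤ) : f (j + k * p) = f j := hper.int_mul k j
  constructor
  · refine ⟨j + (-(|j - N| + 1)) * p, ?_, by rw [h, hj]⟩
    have := le_abs_self (j - N)
    nlinarith [abs_nonneg (j - N)]
  · refine ⟨j + (|j - N| + 1) * p, ?_, by rw [h, hj]⟩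
    have := neg_abs_le (j - N)
    nlinarith [abs_nonneg (j - N)]

end Sequence

/-! ### Indices with a given letter -/

/-- Each letter occurs arbitrarily far in both directions. -/
def Recurrent (f : ℤ → Letter) : Prop :=
  ∀ (l : Letter) (N : ℤ), (∃ k < N, f k = l) ∧ ∃ k > N, f k = l

/-- The greatest index below `n` with letter `l`. -/
noncomputable def lastIdx (f : ℤ → Letter) (l : Letter) (n : ℤ) : ℤ := sSup {k | f k = l ∧ k < n}

theorem letter_ne : Letter.R ≠ Letter.L := by intro h; cases h

theorem eq_R_of_ne {l : Letter} (h : l ≠ Letter.L) : l = Letter.R := by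
  cases l
  · rfl
  · exact absurd rfl h

theorem eq_L_of_ne {l : Letter} (h : l ≠ Letter.R) : l = Letter.L := by
  cases l
  · exact absurd rfl h
  · rfl

section LastIdx

variable {f : ℤ → Letter}

theorem lastIdx_spec (hf : Recurrent f) (l : Letter) (n : ℤ) :
    f (lastIdx f l n) = l ∧ lastIdx f l n < n ∧ ∀ k, f k = l → k < n → k ≤ lastIdx f l n := by
  have hne : ({k | f k = l ∧ k < n} : Set ℤ).Nonempty := by
    obtain ⟨k, hk, hl⟩ := (hf l n).1
    exact ⟨k, hl, hk⟩
  have hb : BddAbove ({k | f k = l ∧ k < n} : Set ℤ) := ⟨n, fun k hk => hk.2.le⟩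
  have hm := Int.csSup_mem hne hb
  exact ⟨hm.1, hm.2, fun k h1 h2 => le_csSup hb ⟨h1, h2⟩⟩

theorem lastIdx_eq (hf : Recurrent f) {l : Letter} {n j : ℤ} (h1 : f j = l) (h2 : j < n)
    (h3 : ∀ k, f k = l → k < n → k ≤ j) : lastIdx f l n = j := by
  obtain ⟨a, b, c⟩ := lastIdx_spec hf l n
  exact le_antisymm (h3 _ a b) (c _ h1 h2)

theorem lastIdx_succ_of_eq (hf : Recurrent f) {l : Letter} {n : ℤ} (h : f n = l) :
    lastIdx f l (n + 1) = n :=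
  lastIdx_eq hf h (by omega) fun k _ hk => by omega

theorem lastIdx_succ_of_ne (hf : Recurrent f) {l : Letter} {n : ℤ} (h : f n ≠ l) :
    lastIdx f l (n + 1) = lastIdx f l n := by
  obtain ⟨a, b, c⟩ := lastIdx_spec hf l n
  refine lastIdx_eq hf a (by omega) fun k hk hkn => c k hk ?_
  rcases (show k < n ∨ k = n by omega) with h' | rfl
  · exact h'
  · exact absurd hk h

/-- Used for quantities that are reset at each occurrence of `l` and carried along unchanged by the
other letter. -/
theorem last_induction (hf : Recurrent f) (l : Letter) {p : ℤ → ℤ → Prop}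
    (hb : ∀ n, f n = l → p (n + 1) n) (hs : ∀ n j, f n ≠ l → p n j → p (n + 1) j) (n : ℤ) :
    p n (lastIdx f l n) := by
  obtain ⟨a, b, c⟩ := lastIdx_spec hf l n
  set j := lastIdx f l n
  have : ∀ i : ℕ, j + 1 + i ≤ n → p (j + 1 + i) j := by
    intro i
    induction i with
    | zero => intro _; simpa using hb j a
    | succ i ih =>
      intro hi
      push_cast at hi ⊢
      rw [← add_assoc]
      refine hs _ _ (fun h => ?_) (ih (by omega))
      have := c _ h (by omega)
      omega
  have h := this (n - j - 1).toNat (by omega)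
  rwa [show j + 1 + ((n - j - 1).toNat : ℤ) = n by omega] at h

theorem nextIdx_spec (hf : Recurrent f) (n : ℤ) :
    f (nextIdx f n) = f n ∧ n < nextIdx f n ∧ ∀ k, f k = f n → n < k → nextIdx f n ≤ k := by
  have hne : ({k | f k = f n ∧ n < k} : Set ℤ).Nonempty := by
    obtain ⟨k, hk, hl⟩ := (hf (f n) n).2
    exact ⟨k, hl, hk⟩
  have hb : BddBelow ({k | f k = f n ∧ n < k} : Set ℤ) := ⟨n, fun k hk => hk.2.le⟩
  have hm := Int.csInf_mem hne hb
  exact ⟨hm.1, hm.2, fun k h1 h2 => csInf_le hb ⟨h1, h2⟩⟩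

theorem prevIdx_eq (n : ℤ) : prevIdx f n = lastIdx f (f n) n := rfl

theorem nextIdx_prevIdx (hf : Recurrent f) (n : ℤ) : nextIdx f (prevIdx f n) = n := by
  obtain ⟨a, b, c⟩ := lastIdx_spec hf (f n) n
  obtain ⟨a', b', c'⟩ := nextIdx_spec hf (prevIdx f n)
  rw [prevIdx_eq] at *
  have h1 := c' n a.symm b
  by_contra hne
  have := c _ (a'.trans a) (by omega)
  omega

theorem lastIdx_eq_iff (hf : Recurrent f) (i n : ℤ) :
    lastIdx f (f i) (n + 1) = i ↔ i ≤ n ∧ n < nextIdx f i := by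
  obtain ⟨a, b, c⟩ := nextIdx_spec hf i
  constructor
  · intro h
    obtain ⟨a', b', c'⟩ := lastIdx_spec hf (f i) (n + 1)
    rw [h] at b' c'
    refine ⟨by omega, ?_⟩
    by_contra hlt
    have := c' _ a (by omega)
    omega
  · rintro ⟨h1, h2⟩
    refine lastIdx_eq hf rfl (by omega) fun k hk hkn => ?_
    by_contra hlt
    have := c k hk (by omega)
    omega

/-- The relations between the last indices of the two letters. -/
theorem lastIdx_facts (hf : Recurrent f) (n : ℤ) :
    lastIdx f .L n < n ∧ lastIdx f .R n < n ∧ lastIdx f .L n ≠ lastIdx f .R n ∧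
    ((f n = .R ∧ lastIdx f .R (n + 1) = n ∧ lastIdx f .L (n + 1) = lastIdx f .L n) ∨
      (f n = .L ∧ lastIdx f .L (n + 1) = n ∧ lastIdx f .R (n + 1) = lastIdx f .R n)) := by
  refine ⟨(lastIdx_spec hf _ _).2.1, (lastIdx_spec hf _ _).2.1, fun h => ?_, ?_⟩
  · have h1 := (lastIdx_spec hf .L n).1
    have h2 := (lastIdx_spec hf .R n).1
    rw [h, h2] at h1
    exact letter_ne h1
  · by_cases h : f n = .R
    · exact Or.inl ⟨h, lastIdx_succ_of_eq hf h,
        lastIdx_succ_of_ne hf (by rw [h]; exact letter_ne)⟩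
    · have h' := eq_L_of_ne h
      exact Or.inr ⟨h', lastIdx_succ_of_eq hf h', lastIdx_succ_of_ne hf h⟩

end LastIdx

/-! ### The vertices -/

/-- The elliptic generator first appearing at level `v.2`, in the period `v.1`. -/
def gen (f : ℤ → Letter) (v : ℤ × ℤ) : Orb := Q f (3 * v.1 + 1) v.2

theorem ellSlope_gen (f : ℤ → Letter) (v : ℤ × ℤ) :
    ellSlope (gen f v) = slopeOf (vecA f v.2 + vecC f v.2) := by
  have h : ∀ m : ℤ, ellSlope (Q f (3 * m + 1) v.2) = ellSlope (Q f 1 v.2) := by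
    intro m
    induction m using Int.induction_on with
    | zero => simp
    | succ i ih =>
      rw [show 3 * ((i : ℤ) + 1) + 1 = 3 * i + 1 + 3 by ring, Q_add_three, ellSlope_conj_D, ih]
    | pred i ih =>
      rw [← ih, show 3 * -(i : ℤ) + 1 = 3 * (-i - 1) + 1 + 3 by ring, Q_add_three,
        ellSlope_conj_D]
  rw [gen, h]
  exact (isRotTriple_zero f v.2).2.1.ellSlope

theorem descendant_Q (f : ℤ → Letter) (n : ℤ) (k : ℕ) :
    Descendant (Q f 0 n) (Q f 1 n) (Q f 2 n) (Q f 0 (n + k)) (Q f 1 (n + k)) (Q f 2 (n + k)) := by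
  induction k with
  | zero => simpa using Descendant.base
  | succ k ih =>
    push_cast
    rw [← add_assoc]
    generalize n + (k : ℤ) = i at ih
    by_cases h : f i = .R
    · have h0 := Q_zero_succ_of_R h 0
      have h2 := Q_two_succ_of_R h 0
      norm_num at h0 h2
      have h1 : Q f 1 (i + 1) = Q f 1 i * Q f 2 i * Q f 1 i := by
        rw [Q_one, Q_one, Q_two, add_sub_cancel_right, F_apply_of_R h, autR_B, map_mul, map_mul]
      rw [h0, h1, h2]
      exact ih.right
    · have h := eq_L_of_ne h
      have h0 := Q_zero_succ_of_L h 0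
      have h2 := Q_two_succ_of_L h 0
      norm_num at h0 h2
      have h1 : Q f 1 (i + 1) = Q f 1 i * Q f 0 i * Q f 1 i := by
        rw [Q_one, Q_one, Q_zero, add_sub_cancel_right, F_apply_of_L h, autL_B, map_mul, map_mul]
      rw [h0, h1, h2]
      exact ih.left

/-- At level `n + 1` the vector `a + c` of level `n` has become one of the two basis vectors, while
the vector of a later generator has both coordinates positive in that basis. -/
theorem slope_gen_ne (f : ℤ → Letter) {n n' : ℤ} (h : n < n') :
    slopeOf (vecA f n + vecC f n) ≠ slopeOf (vecA f n' + vecC f n') := by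
  obtain ⟨k, rfl⟩ : ∃ k : ℕ, n' = n + 1 + k := ⟨(n' - n - 1).toNat, by omega⟩
  obtain ⟨x, y, z, w, hx, hy, hz, hw, hd, hr, -⟩ :=
    (descendant_Q f (n + 1) k).vectors (isRotTriple_zero f (n + 1))
  have hxz : 1 ≤ x + z := by
    by_contra hlt
    obtain rfl : x = 0 := by omega
    obtain rfl : z = 0 := by omega
    simp at hd
  have hyw : 1 ≤ y + w := by
    by_contra hlt
    obtain rfl : y = 0 := by omega
    obtain rfl : w = 0 := by omega
    simp at hd
  have e1 : vecA f (n + 1 + k) = x • vecA f (n + 1) + y • vecC f (n + 1) := hr.1.vec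
  have e2 : vecC f (n + 1 + k) = z • vecA f (n + 1) + w • vecC f (n + 1) := hr.2.2.1.vec
  apply slopeOf_ne
  have hc := cross_vec f n
  rw [e1, e2]
  by_cases hR : f n = .R
  · obtain ⟨a1, a2⟩ := vec_succ_of_R hR
    rw [a1, a2]
    have : cross (vecA f n + vecC f n) (x • vecA f n + y • (vecA f n + vecC f n) +
        (z • vecA f n + w • (vecA f n + vecC f n))) =
        -(x + z) * cross (vecA f n) (vecC f n) := by
      simp [cross]; ring
    rw [this, hc]; omega
  · obtain ⟨a1, a2⟩ := vec_succ_of_L (eq_L_of_ne hR)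
    rw [a1, a2]
    have : cross (vecA f n + vecC f n) (x • (vecA f n + vecC f n) + y • vecC f n +
        (z • (vecA f n + vecC f n) + w • vecC f n)) =
        (y + w) * cross (vecA f n) (vecC f n) := by
      simp [cross]; ring
    rw [this, hc]; omega

/-- Slopes separate the levels, and within one level the sequence is injective. -/
theorem gen_injective (f : ℤ → Letter) : Function.Injective (gen f) := by
  rintro ⟨m, n⟩ ⟨m', n'⟩ h
  have hs : ellSlope (gen f (m, n)) = ellSlope (gen f (m', n')) := by rw [h]
  rw [ellSlope_gen, ellSlope_gen] at hs
  rcases lt_trichotomy n n' with hlt | rfl | hlt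
  · exact absurd hs (slope_gen_ne f hlt)
  · have := Q_injective f n h
    simp only [Prod.mk.injEq, and_true]; omega
  · exact absurd hs.symm (slope_gen_ne f hlt)

/-- The index of `Q_{j,n}`. -/
noncomputable def lat (f : ℤ → Letter) (j n : ℤ) : ℤ × ℤ :=
  (j / 3, if j % 3 = 0 then lastIdx f .L n else if j % 3 = 1 then n else lastIdx f .R n)

section Lat

variable {f : ℤ → Letter}

theorem lat_zero (m n : ℤ) : lat f (3 * m) n = (m, lastIdx f .L n) := by
  unfold lat
  rw [show 3 * m / 3 = m by omega, if_pos (by omega)]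

theorem lat_one (m n : ℤ) : lat f (3 * m + 1) n = (m, n) := by
  unfold lat
  rw [show (3 * m + 1) / 3 = m by omega, if_neg (by omega), if_pos (by omega)]

theorem lat_two (m n : ℤ) : lat f (3 * m + 2) n = (m, lastIdx f .R n) := by
  unfold lat
  rw [show (3 * m + 2) / 3 = m by omega, if_neg (by omega), if_neg (by omega)]

theorem lat_three (m n : ℤ) : lat f (3 * m + 3) n = (m + 1, lastIdx f .L n) := by
  rw [show 3 * m + 3 = 3 * (m + 1) by ring, lat_zero]

theorem lat_four (m n : ℤ) : lat f (3 * m + 4) n = (m + 1, n) := by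
  rw [show 3 * m + 4 = 3 * (m + 1) + 1 by ring, lat_one]

theorem mod_three_cases (j : ℤ) : ∃ m, j = 3 * m ∨ j = 3 * m + 1 ∨ j = 3 * m + 2 :=
  ⟨j / 3, by omega⟩

/-- Following the slanted edges downwards: `Q f (3 * m) n` is carried along by `R` and was
introduced at the last `L`; `Q f (3 * m + 2) n` behaves in the same way with the letters exchanged.
-/
theorem Q_eq_gen (hf : Recurrent f) (j n : ℤ) : Q f j n = gen f (lat f j n) := by
  obtain ⟨m, rfl | rfl | rfl⟩ := mod_three_cases j
  · rw [lat_zero]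
    refine last_induction hf .L (p := fun n j => Q f (3 * m) n = gen f (m, j)) ?_ ?_ n
    · intro n hn; exact Q_zero_succ_of_L hn m
    · intro n j hn h
      rw [Q_zero_succ_of_R (eq_R_of_ne hn)]; exact h
  · rw [lat_one]; rfl
  · rw [lat_two]
    refine last_induction hf .R (p := fun n j => Q f (3 * m + 2) n = gen f (m, j)) ?_ ?_ n
    · intro n hn; exact Q_two_succ_of_R hn m
    · intro n j hn h
      rw [Q_two_succ_of_L (eq_L_of_ne hn)]; exact h

theorem Q_eq_iff (hf : Recurrent f) {j n j' n' : ℤ} :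
    Q f j n = Q f j' n' ↔ lat f j n = lat f j' n' := by
  rw [Q_eq_gen hf, Q_eq_gen hf, (gen_injective f).eq_iff]

/-- The vertex to which the slanted edge number `k` above level `n` collapses. -/
noncomputable def ver (f : ℤ → Letter) (n k : ℤ) : ℤ × ℤ :=
  (k / 2, if k % 2 = 0 then lastIdx f .L (n + 1) else lastIdx f .R (n + 1))

/-- The third vertex of the face between the slanted edges number `k` and `k + 1` above
level `n`. -/
noncomputable def mid (f : ℤ → Letter) (n k : ℤ) : ℤ × ℤ :=
  if k % 2 = 0 then (k / 2, n + 1) else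
    match f n with
    | .R => (k / 2, lastIdx f .R n)
    | .L => (k / 2 + 1, lastIdx f .L n)

theorem ver_even (n m : ℤ) : ver f n (2 * m) = (m, lastIdx f .L (n + 1)) := by
  unfold ver
  rw [show 2 * m / 2 = m by omega, if_pos (by omega)]

theorem ver_odd (n m : ℤ) : ver f n (2 * m + 1) = (m, lastIdx f .R (n + 1)) := by
  unfold ver
  rw [show (2 * m + 1) / 2 = m by omega, if_neg (by omega)]

theorem ver_even' (n m : ℤ) : ver f n (2 * m + 1 + 1) = (m + 1, lastIdx f .L (n + 1)) := by
  rw [show 2 * m + 1 + 1 = 2 * (m + 1) by ring, ver_even]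

theorem mid_even (n m : ℤ) : mid f n (2 * m) = (m, n + 1) := by
  unfold mid
  rw [show 2 * m / 2 = m by omega, if_pos (by omega)]

theorem mid_odd_of_R {n : ℤ} (h : f n = .R) (m : ℤ) :
    mid f n (2 * m + 1) = (m, lastIdx f .R n) := by
  unfold mid
  rw [show (2 * m + 1) / 2 = m by omega, if_neg (by omega), h]

theorem mid_odd_of_L {n : ℤ} (h : f n = .L) (m : ℤ) :
    mid f n (2 * m + 1) = (m + 1, lastIdx f .L n) := by
  unfold mid
  rw [show (2 * m + 1) / 2 = m by omega, if_neg (by omega), h]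

theorem mid_odd_cases (hf : Recurrent f) (n : ℤ) :
    (lastIdx f .R (n + 1) = n ∧ lastIdx f .L (n + 1) = lastIdx f .L n ∧
      ∀ m, mid f n (2 * m + 1) = (m, lastIdx f .R n)) ∨
    (lastIdx f .L (n + 1) = n ∧ lastIdx f .R (n + 1) = lastIdx f .R n ∧
      ∀ m, mid f n (2 * m + 1) = (m + 1, lastIdx f .L n)) := by
  rcases (lastIdx_facts hf n).2.2.2 with ⟨h, e1, e2⟩ | ⟨h, e1, e2⟩
  · exact Or.inl ⟨e1, e2, mid_odd_of_R h⟩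
  · exact Or.inr ⟨e1, e2, mid_odd_of_L h⟩

theorem even_or_odd_cases (k : ℤ) : ∃ m, k = 2 * m ∨ k = 2 * m + 1 := ⟨k / 2, by omega⟩

theorem lat_ne_succ (hf : Recurrent f) (j n : ℤ) : lat f j n ≠ lat f (j + 1) n := by
  obtain ⟨h1, h2, h3, -⟩ := lastIdx_facts hf n
  obtain ⟨m, rfl | rfl | rfl⟩ := mod_three_cases j
  · rw [lat_zero, lat_one]; simp; omega
  · rw [show 3 * m + 1 + 1 = 3 * m + 2 by ring, lat_one, lat_two]; simp; omega
  · rw [show 3 * m + 2 + 1 = 3 * m + 3 by ring, lat_two, lat_three]; simp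

/-- The endpoints of a horizontal edge determine it. -/
theorem lat_edge_unique (hf : Recurrent f) {j n j' n' : ℤ}
    (h : (lat f j n = lat f j' n' ∧ lat f (j + 1) n = lat f (j' + 1) n') ∨
      (lat f j n = lat f (j' + 1) n' ∧ lat f (j + 1) n = lat f j' n')) : j = j' ∧ n = n' := by
  obtain ⟨h1, h2, h3, -⟩ := lastIdx_facts hf n
  obtain ⟨h1', h2', h3', -⟩ := lastIdx_facts hf n'
  -- One of the two last indices at level `n` is `n - 1`; this is what keeps the edges of different
  -- levels apart.
  have k := (lastIdx_facts hf (n - 1)).2.2.2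
  have k' := (lastIdx_facts hf (n' - 1)).2.2.2
  rw [sub_add_cancel] at k k'
  have hn : n = n' → lastIdx f .L n = lastIdx f .L n' ∧ lastIdx f .R n = lastIdx f .R n' := by
    rintro rfl; exact ⟨rfl, rfl⟩
  obtain ⟨m, hj⟩ := mod_three_cases j
  obtain ⟨m', hj'⟩ := mod_three_cases j'
  rcases hj with rfl | rfl | rfl <;> rcases hj' with rfl | rfl | rfl <;>
  simp only [show ∀ a : ℤ, 3 * a + 1 + 1 = 3 * a + 2 from fun a => by ring,
    show ∀ a : ℤ, 3 * a + 2 + 1 = 3 * a + 3 from fun a => by ring,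
    lat_zero, lat_one, lat_two, lat_three, Prod.mk.injEq] at h <;> omega

theorem ver_mid_distinct (hf : Recurrent f) (n k : ℤ) : ver f n k ≠ mid f n k ∧
    mid f n k ≠ ver f n (k + 1) ∧ ver f n k ≠ ver f n (k + 1) := by
  obtain ⟨h1, h2, h3, -⟩ := lastIdx_facts hf (n + 1)
  obtain ⟨h1', h2', h3', k4⟩ := lastIdx_facts hf n
  obtain ⟨m, rfl | rfl⟩ := even_or_odd_cases k
  · rw [ver_even, ver_odd, mid_even]
    simp only [ne_eq, Prod.mk.injEq]; omega
  · rcases k4 with ⟨h, e1, e2⟩ | ⟨h, e1, e2⟩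
    · rw [ver_even', ver_odd, mid_odd_of_R h]
      simp only [ne_eq, Prod.mk.injEq]; omega
    · rw [ver_even', ver_odd, mid_odd_of_L h]
      simp only [ne_eq, Prod.mk.injEq]; omega

/-- The vertices of a face determine it. -/
theorem face_unique (hf : Recurrent f) {n k n' k' : ℤ}
    (h : ({ver f n k, mid f n k, ver f n (k + 1)} : Set (ℤ × ℤ)) =
      {ver f n' k', mid f n' k', ver f n' (k' + 1)}) : n = n' ∧ k = k' := by
  have hA : ∀ v ∈ ({ver f n k, mid f n k, ver f n (k + 1)} : Set (ℤ × ℤ)),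
      v ∈ ({ver f n' k', mid f n' k', ver f n' (k' + 1)} : Set (ℤ × ℤ)) := fun v hv => h ▸ hv
  have hB : ∀ v ∈ ({ver f n' k', mid f n' k', ver f n' (k' + 1)} : Set (ℤ × ℤ)),
      v ∈ ({ver f n k, mid f n k, ver f n (k + 1)} : Set (ℤ × ℤ)) := fun v hv => h ▸ hv
  clear h
  simp only [Set.mem_insert_iff, Set.mem_singleton_iff, forall_eq_or_imp, forall_eq] at hA hB
  obtain ⟨h1, h2, h3, -⟩ := lastIdx_facts hf n
  obtain ⟨h1', h2', h3', -⟩ := lastIdx_facts hf n'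
  obtain ⟨m, rfl | rfl⟩ := even_or_odd_cases k <;>
  obtain ⟨m', rfl | rfl⟩ := even_or_odd_cases k' <;>
  rcases mid_odd_cases hf n with ⟨e1, e2, e⟩ | ⟨e1, e2, e⟩ <;>
  rcases mid_odd_cases hf n' with ⟨e1', e2', e'⟩ | ⟨e1', e2', e'⟩ <;>
  simp only [ver_even, ver_even', ver_odd, mid_even, e, e', Prod.mk.injEq, e1, e2, e1', e2']
    at hA hB <;>
  omega

end Lat

/-! ### The simplices of `Δ*(φ)` -/

section Faces

variable {f : ℤ → Letter}

/-- Between two successive slanted edges above level `n` there are two horizontal edges on one side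
and one on the other. The two form a consecutive triple, and the single one says that its outer
members are adjacent at the neighbouring level. For even `k` the two edges are on top, for odd `k`
at the bottom. -/
theorem gen_face_iff (hf : Recurrent f) (X Y Z : Orb) :
    (∃ m n, X = Q f m n ∧ Y = Q f (m + 1) n ∧ Z = Q f (m + 2) n ∧
      ∃ i, (X = Q f i (n - 1) ∧ Z = Q f (i + 1) (n - 1)) ∨
        (X = Q f i (n + 1) ∧ Z = Q f (i + 1) (n + 1))) ↔
    ∃ n k, X = gen f (ver f n k) ∧ Y = gen f (mid f n k) ∧ Z = gen f (ver f n (k + 1)) := by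
  have a1 : ∀ a : ℤ, 3 * a + 1 + 1 = 3 * a + 2 := fun a => by ring
  have a2 : ∀ a : ℤ, 3 * a + 2 + 1 = 3 * a + 3 := fun a => by ring
  have a3 : ∀ a : ℤ, 3 * a + 1 + 2 = 3 * a + 3 := fun a => by ring
  have a4 : ∀ a : ℤ, 3 * a + 2 + 2 = 3 * a + 4 := fun a => by ring
  constructor
  · rintro ⟨j, n, rfl, rfl, rfl, i, hi⟩
    simp only [Q_eq_iff hf] at hi
    simp only [Q_eq_gen hf, (gen_injective f).eq_iff]
    obtain ⟨m, rfl | rfl | rfl⟩ := mod_three_cases j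
    -- The triples starting at index `0` modulo `3` give a face below them whatever the letter. The
    -- remaining triples can only give a face above, and which of them do so depends on the letter.
    · refine ⟨n - 1, 2 * m, ?_⟩
      rw [lat_zero, lat_one, lat_two, ver_even, ver_odd, mid_even]
      simp
    all_goals
      obtain ⟨h1, h2, h3, -⟩ := lastIdx_facts hf n
      obtain ⟨h1', h2', h3', -⟩ := lastIdx_facts hf (n - 1)
      refine ⟨n, 2 * m + 1, ?_⟩
      obtain ⟨m', rfl | rfl | rfl⟩ := mod_three_cases i <;>
      rcases mid_odd_cases hf n with ⟨e1, e2, e⟩ | ⟨e1, e2, e⟩ <;>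
      simp only [a1, a2, a3, a4, lat_zero, lat_one, lat_two, lat_three, lat_four, ver_odd,
        ver_even', e, e1, e2, Prod.mk.injEq, true_and, and_true] at hi ⊢ <;> omega
  · rintro ⟨n, k, rfl, rfl, rfl⟩
    simp only [Q_eq_gen hf, (gen_injective f).eq_iff]
    obtain ⟨m, rfl | rfl⟩ := even_or_odd_cases k
    · refine ⟨3 * m, n + 1, ?_, ?_, ?_, ?_⟩
      · rw [lat_zero, ver_even]
      · rw [lat_one, mid_even]
      · rw [lat_two, ver_odd]
      · rcases mid_odd_cases hf n with ⟨e1, e2, -⟩ | ⟨e1, e2, -⟩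
        · refine ⟨3 * m, Or.inl ?_⟩
          rw [add_sub_cancel_right, lat_zero, lat_one, ver_even, ver_odd, e1, e2]
          exact ⟨rfl, rfl⟩
        · refine ⟨3 * m + 1, Or.inl ?_⟩
          rw [add_sub_cancel_right, a1, lat_one, lat_two, ver_even, ver_odd, e1, e2]
          exact ⟨rfl, rfl⟩
    · rcases mid_odd_cases hf n with ⟨e1, e2, e⟩ | ⟨e1, e2, e⟩
      · refine ⟨3 * m + 1, n, ?_, ?_, ?_, 3 * m + 2, Or.inr ?_⟩ <;>
        simp only [a1, a2, a3, lat_one, lat_two, lat_three, ver_odd, ver_even', e, e1, e2, and_self]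
      · refine ⟨3 * m + 2, n, ?_, ?_, ?_, 3 * m + 2, Or.inr ?_⟩ <;>
        simp only [a2, a4, lat_two, lat_three, lat_four, ver_odd, ver_even', e, e1, e2, and_self]

end Faces

/-! ### Quotient maps and components -/

/-- Equal fibres make each map factor through the other; all the homeomorphisms below are produced
in this way. -/
theorem exists_homeomorph_of_isQuotientMap {Z X Y : Type*} [TopologicalSpace Z]
    [TopologicalSpace X] [TopologicalSpace Y] {p : Z → X} {q : Z → Y} (hp : IsQuotientMap p)
    (hq : IsQuotientMap q) (h : ∀ z z', p z = p z' ↔ q z = q z') :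
    ∃ g : X ≃ₜ Y, ∀ z, g (p z) = q z := by
  have e1 : ∀ z, q (Function.surjInv hp.surjective (p z)) = q z := fun z =>
    (h _ _).1 (Function.surjInv_eq hp.surjective _)
  have e2 : ∀ z, p (Function.surjInv hq.surjective (q z)) = p z := fun z =>
    (h _ _).2 (Function.surjInv_eq hq.surjective _)
  refine ⟨{ toFun := fun x => q (Function.surjInv hp.surjective x)
            invFun := fun y => p (Function.surjInv hq.surjective y)
            left_inv := ?_
            right_inv := ?_
            continuous_toFun := ?_
            continuous_invFun := ?_ }, e1⟩
  · intro x
    obtain ⟨z, rfl⟩ := hp.surjective x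
    simp only [e1, e2]
  · intro y
    obtain ⟨z, rfl⟩ := hq.surjective y
    simp only [e1, e2]
  · rw [hp.continuous_iff]
    exact hq.continuous.congr fun z => (e1 z).symm
  · rw [hq.continuous_iff]
    exact hp.continuous.congr fun z => (e2 z).symm

section Components

variable {X Y : Type*} [TopologicalSpace X] [TopologicalSpace Y]

theorem sUnion_components (U : Set X) : ⋃₀ components U = U := by
  ext x
  constructor
  · rintro ⟨_, ⟨y, hy, rfl⟩, hx⟩
    exact connectedComponentIn_subset U y hx
  · intro hx
    exact ⟨_, ⟨x, hx, rfl⟩, mem_connectedComponentIn hx⟩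

/-- Disjoint open connected sets are the components of their union, since each is separated from the
union of the others. -/
theorem components_sUnion {S : Set (Set X)} (ho : ∀ s ∈ S, IsOpen s) (hc : ∀ s ∈ S, IsConnected s)
    (hd : ∀ s ∈ S, ∀ t ∈ S, ∀ x, x ∈ s → x ∈ t → s = t) : components (⋃₀ S) = S := by
  have key : ∀ s ∈ S, ∀ x ∈ s, connectedComponentIn (⋃₀ S) x = s := by
    intro s hs x hx
    apply Set.Subset.antisymm
    · have hpre : IsPreconnected (connectedComponentIn (⋃₀ S) x) :=
        isPreconnected_connectedComponentIn
      have hopen : IsOpen (⋃₀ (S \ {s})) := isOpen_sUnion fun t ht => ho t ht.1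
      have hdisj : Disjoint s (⋃₀ (S \ {s})) := by
        rw [Set.disjoint_left]
        rintro y hy ⟨t, ⟨ht, hne⟩, hyt⟩
        exact hne (hd s hs t ht y hy hyt).symm
      apply hpre.subset_left_of_subset_union (ho s hs) hopen hdisj
      · intro y hy
        obtain ⟨t, ht, hyt⟩ := connectedComponentIn_subset _ _ hy
        by_cases hts : t = s
        · exact Or.inl (hts ▸ hyt)
        · exact Or.inr ⟨t, ⟨ht, hts⟩, hyt⟩
      · exact ⟨x, mem_connectedComponentIn ⟨s, hs, hx⟩, hx⟩
    · exact (hc s hs).isPreconnected.subset_connectedComponentIn hx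
        fun y hy => ⟨s, hs, hy⟩
  ext V
  constructor
  · rintro ⟨x, ⟨s, hs, hx⟩, rfl⟩
    rw [key s hs x hx]; exact hs
  · intro hV
    obtain ⟨x, hx⟩ := (hc V hV).nonempty
    exact ⟨x, ⟨V, hV, hx⟩, (key V hV x hx).symm⟩

theorem image_components (g : X ≃ₜ Y) (U : Set X) :
    Set.image g '' components U = components (g '' U) := by
  have key : ∀ x ∈ U, g '' connectedComponentIn U x = connectedComponentIn (g '' U) (g x) :=
    fun x hx => g.image_connectedComponentIn hx
  ext V
  constructor
  · rintro ⟨_, ⟨x, hx, rfl⟩, rfl⟩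
    exact ⟨g x, ⟨x, hx, rfl⟩, key x hx⟩
  · rintro ⟨_, ⟨x, hx, rfl⟩, rfl⟩
    exact ⟨_, ⟨x, hx, rfl⟩, key x hx⟩

/-- Composition of isomorphisms of cell decompositions. -/
def CellIso.trans {Z : Type*} [TopologicalSpace Z] {K : CellDecomp X} {K' : CellDecomp Y}
    {K'' : CellDecomp Z} (g : CellIso K K') (h : CellIso K' K'') : CellIso K K'' where
  toHomeomorph := g.toHomeomorph.trans h.toHomeomorph
  map_verts := by
    rw [← h.map_verts, ← g.map_verts, Set.image_image]; rfl
  map_edges := by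
    rw [← h.map_edges, ← g.map_edges, Set.image_image]
    congr 1; ext s : 1; rw [Set.image_image]; rfl
  map_faces := by
    rw [← h.map_faces, ← g.map_faces, Set.image_image]
    congr 1; ext s : 1; rw [Set.image_image]; rfl

theorem isQuotientMap_mk (S : Set (Set X)) : IsQuotientMap (Collapse.mk S) :=
  isQuotientMap_quot_mk

theorem Collapse.mk_eq {S : Set (Set X)} {x y : X} {e : Set X} (he : e ∈ S) (hx : x ∈ closure e)
    (hy : y ∈ closure e) : Collapse.mk S x = Collapse.mk S y :=
  Quot.sound ⟨e, he, hx, hy⟩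

theorem Collapse.apply_eq_of_mk_eq {α : Type*} {S : Set (Set X)} {x y : X} {u : X → α}
    (hu : ∀ e ∈ S, ∀ x ∈ closure e, ∀ y ∈ closure e, u x = u y)
    (h : Collapse.mk S x = Collapse.mk S y) : u x = u y :=
  congrArg (Quot.lift u fun x y ⟨e, he, hx, hy⟩ => hu e he x hx y hy) h

end Components

/-! ### Decompositions of horizontal strips of the plane -/

open unitInterval in
/-- The plane is decomposed into the horizontal strips between successive integral levels, and the
`n`-th strip is decomposed by the curves `t ↦ (E n k t, n + t)`; the region between two successive
curves is parametrized by the unit square. -/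
def strip (E : ℤ → ℤ → ℝ → ℝ) (z : (ℤ × ℤ) × (I × I)) : ℝ × ℝ :=
  ((1 - z.2.1) * E z.1.1 z.1.2 z.2.2 + z.2.1 * E z.1.1 (z.1.2 + 1) z.2.2, z.1.1 + z.2.2)

/-- A family of curves decomposing the strips. -/
structure IsKnots (E : ℤ → ℤ → ℝ → ℝ) : Prop where
  cont : ∀ n k, Continuous (E n k)
  mono : ∀ n k t, 0 ≤ t → t ≤ 1 → E n k t ≤ E n (k + 1) t
  strict : ∀ n k t, 0 < t → t < 1 → E n k t < E n (k + 1) t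
  bdd : ∃ κ K : ℝ, 0 < κ ∧ ∀ n k t, 0 ≤ t → t ≤ 1 → |E n k t - κ * k| ≤ K

namespace IsKnots

open unitInterval

variable {E : ℤ → ℤ → ℝ → ℝ}

theorem continuous_strip (hE : IsKnots E) : Continuous (strip E) := by
  rw [continuous_prod_of_discrete_left]
  rintro ⟨n, k⟩
  have h1 := hE.cont n k
  have h2 := hE.cont n (k + 1)
  simp only [strip]
  fun_prop

theorem monotone (hE : IsKnots E) (n : ℤ) {t : ℝ} (h0 : 0 ≤ t) (h1 : t ≤ 1) :
    Monotone fun k => E n k t :=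
  monotone_int_of_le_succ fun k => hE.mono n k t h0 h1

theorem strictMono (hE : IsKnots E) (n : ℤ) {t : ℝ} (h0 : 0 < t) (h1 : t < 1) :
    StrictMono fun k => E n k t :=
  strictMono_int_of_lt_succ fun k => hE.strict n k t h0 h1

/-- The curves stay within bounded distance of an arithmetic progression, so only finitely many
positions compete and a greatest one exists. -/
theorem exists_between (hE : IsKnots E) (n : ℤ) {t : ℝ} (h0 : 0 ≤ t) (h1 : t ≤ 1) (x : ℝ) :
    ∃ k, E n k t ≤ x ∧ x < E n (k + 1) t := by
  obtain ⟨κ, K, hκ, hb⟩ := hE.bdd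
  have hB : ∃ b : ℤ, ∀ k, E n k t ≤ x → k ≤ b := by
    refine ⟨⌈(x + K) / κ⌉, fun k hk => ?_⟩
    have := abs_le.1 (hb n k t h0 h1)
    have h2 : (k : ℝ) ≤ (x + K) / κ := by rw [le_div_iff₀ hκ]; linarith
    exact_mod_cast h2.trans (Int.le_ceil _)
  have hN : ∃ k, E n k t ≤ x := by
    refine ⟨⌊(x - K) / κ⌋, ?_⟩
    have := abs_le.1 (hb n ⌊(x - K) / κ⌋ t h0 h1)
    have h2 : (⌊(x - K) / κ⌋ : ℝ) ≤ (x - K) / κ := Int.floor_le _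
    rw [le_div_iff₀ hκ] at h2
    linarith
  obtain ⟨k, hk, hm⟩ := Int.exists_greatest_of_bdd hB hN
  refine ⟨k, hk, ?_⟩
  by_contra hlt
  have := hm _ (not_lt.1 hlt)
  omega

theorem surjective_strip (hE : IsKnots E) : Function.Surjective (strip E) := by
  rintro ⟨x, y⟩
  have ht0 := Int.fract_nonneg y
  have ht1 := (Int.fract_lt_one y).le
  obtain ⟨k, hk, hk'⟩ := hE.exists_between ⌊y⌋ ht0 ht1 x
  have hpos : 0 < E ⌊y⌋ (k + 1) (Int.fract y) - E ⌊y⌋ k (Int.fract y) := by linarith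
  refine ⟨((⌊y⌋, k), ⟨(x - E ⌊y⌋ k (Int.fract y)) /
    (E ⌊y⌋ (k + 1) (Int.fract y) - E ⌊y⌋ k (Int.fract y)), ?_, ?_⟩, ⟨Int.fract y, ht0, ht1⟩), ?_⟩
  · exact div_nonneg (by linarith) hpos.le
  · rw [div_le_one hpos]; linarith
  · simp only [strip, Int.floor_add_fract, Prod.mk.injEq, and_true]
    field_simp
    ring

theorem strip_mem (hE : IsKnots E) (n k : ℤ) (s t : I) :
    E n k t ≤ (strip E ((n, k), (s, t))).1 ∧ (strip E ((n, k), (s, t))).1 ≤ E n (k + 1) t := by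
  have h := hE.mono n k t t.2.1 t.2.2
  have h0 := s.2.1
  have h1 := s.2.2
  simp only [strip]
  constructor <;> nlinarith

/-- The images of the compact squares form a locally finite family, by the bound on the curves, so
`strip` is a closed map. -/
theorem isQuotientMap_strip (hE : IsKnots E) : IsQuotientMap (strip E) := by
  refine IsClosedMap.isQuotientMap ?_ hE.continuous_strip hE.surjective_strip
  intro C hC
  have hU : strip E '' C = ⋃ i : ℤ × ℤ, strip E '' (C ∩ {z | z.1 = i}) := by
    rw [← Set.image_iUnion]
    congr 1
    ext z
    simp
  rw [hU]
  have hslice : ∀ i : ℤ × ℤ, IsCompact ({z | z.1 = i} : Set ((ℤ × ℤ) × (I × I))) := by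
    intro i
    have : ({z | z.1 = i} : Set ((ℤ × ℤ) × (I × I))) = {i} ×ˢ Set.univ := by
      ext z; simp
    rw [this]
    exact isCompact_singleton.prod isCompact_univ
  refine LocallyFinite.isClosed_iUnion ?_ fun i =>
    (((hslice i).inter_left hC).image hE.continuous_strip).isClosed
  obtain ⟨κ, K, hκ, hb⟩ := hE.bdd
  rintro ⟨x, y⟩
  refine ⟨Set.Ioo (x - 1) (x + 1) ×ˢ Set.Ioo (y - 1) (y + 1),
    prod_mem_nhds (Ioo_mem_nhds (by linarith) (by linarith))
      (Ioo_mem_nhds (by linarith) (by linarith)), ?_⟩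
  refine Set.Finite.subset ((Set.finite_Icc ⌊y - 2⌋ ⌈y + 1⌉).prod
    (Set.finite_Icc ⌊(x - 1 - K) / κ - 1⌋ ⌈(x + 1 + K) / κ⌉)) ?_
  rintro ⟨n, k⟩ ⟨w, ⟨⟨⟨n', k'⟩, ⟨s, t⟩⟩, ⟨-, hz⟩, rfl⟩, hw⟩
  simp only [Set.mem_ofPred_eq, Prod.mk.injEq] at hz
  obtain ⟨rfl, rfl⟩ := hz
  obtain ⟨h1, h2⟩ := hE.strip_mem n' k' s t
  have b1 := abs_le.1 (hb n' k' t t.2.1 t.2.2)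
  have b2 := abs_le.1 (hb n' (k' + 1) t t.2.1 t.2.2)
  push_cast at b2
  obtain ⟨⟨c1, c2⟩, c3, c4⟩ := hw
  have t0 := t.2.1
  have t1 := t.2.2
  simp only [strip] at c3 c4
  refine ⟨⟨?_, ?_⟩, ?_, ?_⟩
  · have : ((⌊y - 2⌋ : ℤ) : ℝ) ≤ n' := (Int.floor_le _).trans (by linarith)
    exact_mod_cast this
  · have : (n' : ℝ) ≤ (⌈y + 1⌉ : ℤ) := le_trans (by linarith) (Int.le_ceil _)
    exact_mod_cast this
  · have h3 : (x - 1 - K) / κ - 1 ≤ k' := by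
      rw [sub_le_iff_le_add, div_le_iff₀ hκ]; linarith
    have : ((⌊(x - 1 - K) / κ - 1⌋ : ℤ) : ℝ) ≤ k' := (Int.floor_le _).trans h3
    exact_mod_cast this
  · have h3 : (k' : ℝ) ≤ (x + 1 + K) / κ := by
      rw [le_div_iff₀ hκ]; linarith
    have : (k' : ℝ) ≤ (⌈(x + 1 + K) / κ⌉ : ℤ) := h3.trans (Int.le_ceil _)
    exact_mod_cast this

/-- Two points of the parameter space over the same point of an open strip. -/
def SamePoint (z z' : (ℤ × ℤ) × (I × I)) : Prop :=
  z.1.1 = z'.1.1 ∧ z.2.2 = z'.2.2 ∧ ((z.1.2 = z'.1.2 ∧ z.2.1 = z'.2.1) ∨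
    (z'.1.2 = z.1.2 + 1 ∧ z.2.1 = 1 ∧ z'.2.1 = 0) ∨
    (z.1.2 = z'.1.2 + 1 ∧ z.2.1 = 0 ∧ z'.2.1 = 1))

theorem level_eq {n n' : ℤ} {t t' : ℝ} (h0 : 0 < t) (h1 : t < 1) (h0' : 0 ≤ t') (h1' : t' ≤ 1)
    (h : (n : ℝ) + t = n' + t') : n = n' ∧ t = t' := by
  have hn : n = n' := by
    have a1 : (n : ℝ) < n' + 1 := by linarith
    have a2 : (n' : ℝ) < n + 1 := by linarith
    have b1 : n < n' + 1 := by exact_mod_cast a1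
    have b2 : n' < n + 1 := by exact_mod_cast a2
    omega
  subst hn
  exact ⟨rfl, by linarith⟩

/-- Inside an open strip the curves are strictly ordered, so squares are glued only along their
common sides. At integral levels curves may meet, and the fibres are treated separately. -/
theorem strip_eq_iff (hE : IsKnots E) {z z' : (ℤ × ℤ) × (I × I)} (h0 : 0 < (z.2.2 : ℝ))
    (h1 : (z.2.2 : ℝ) < 1) : strip E z = strip E z' ↔ SamePoint z z' := by
  obtain ⟨⟨n, k⟩, s, t⟩ := z
  obtain ⟨⟨n', k'⟩, s', t'⟩ := z'
  simp only at h0 h1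
  simp only [SamePoint]
  constructor
  · intro h
    have hy := congrArg Prod.snd h
    simp only [strip] at hy
    obtain ⟨rfl, htt⟩ := level_eq h0 h1 t'.2.1 t'.2.2 hy
    obtain rfl := Subtype.ext htt
    refine ⟨rfl, rfl, ?_⟩
    have hx := congrArg Prod.fst h
    have hm := hE.strictMono n h0 h1
    have m1 := hE.strip_mem n k s t
    have m2 := hE.strip_mem n k' s' t
    rw [← hx] at m2
    have k1 : k ≤ k' + 1 := hm.le_iff_le.1 (m1.1.trans m2.2)
    have k2 : k' ≤ k + 1 := hm.le_iff_le.1 (m2.1.trans m1.2)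
    rcases (by omega : k = k' ∨ k' = k + 1 ∨ k = k' + 1) with rfl | rfl | rfl
    · left
      refine ⟨rfl, Subtype.ext ?_⟩
      have hs := hE.strict n k t h0 h1
      simp only [strip] at hx
      have : ((s : ℝ) - s') * (E n (k + 1) t - E n k t) = 0 := by linarith
      rcases mul_eq_zero.1 this with h' | h' <;> linarith
    · right; left
      have e1 := le_antisymm m1.2 m2.1
      have hs := hE.strict n k t h0 h1
      have hs' := hE.strict n (k + 1) t h0 h1
      have e2 := hx.symm.trans e1
      simp only [strip] at e1 e2
      refine ⟨rfl, Subtype.ext ?_, Subtype.ext ?_⟩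
      · have : (1 - (s : ℝ)) * (E n (k + 1) t - E n k t) = 0 := by linarith
        rcases mul_eq_zero.1 this with h' | h'
        · simp only [Set.Icc.coe_one]; linarith
        · linarith
      · have : (s' : ℝ) * (E n (k + 1 + 1) t - E n (k + 1) t) = 0 := by linarith
        rcases mul_eq_zero.1 this with h' | h'
        · simpa using h'
        · linarith
    · right; right
      have e1 := le_antisymm m1.1 m2.2
      have hs := hE.strict n k' t h0 h1
      have hs' := hE.strict n (k' + 1) t h0 h1
      have e2 := e1.trans hx
      simp only [strip] at e1 e2
      refine ⟨rfl, Subtype.ext ?_, Subtype.ext ?_⟩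
      · have : (s : ℝ) * (E n (k' + 1 + 1) t - E n (k' + 1) t) = 0 := by linarith
        rcases mul_eq_zero.1 this with h' | h'
        · simpa using h'
        · linarith
      · have : (1 - (s' : ℝ)) * (E n (k' + 1) t - E n k' t) = 0 := by linarith
        rcases mul_eq_zero.1 this with h' | h'
        · simp only [Set.Icc.coe_one]; linarith
        · linarith
  · rintro ⟨rfl, rfl, ⟨rfl, rfl⟩ | ⟨rfl, rfl, rfl⟩ | ⟨rfl, rfl, rfl⟩⟩ <;> simp [strip]

end IsKnots

/-- The open curves of a decomposition of the strips. -/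
def openKnot (E : ℤ → ℤ → ℝ → ℝ) (n k : ℤ) : Set (ℝ × ℝ) :=
  {x | ∃ t : ℝ, 0 < t ∧ t < 1 ∧ x = (E n k t, n + t)}

/-- The open regions of a decomposition of the strips. -/
def openCell (E : ℤ → ℤ → ℝ → ℝ) (n k : ℤ) : Set (ℝ × ℝ) :=
  {x | n < x.2 ∧ x.2 < n + 1 ∧ E n k (x.2 - n) < x.1 ∧ x.1 < E n (k + 1) (x.2 - n)}

namespace IsKnots

open unitInterval

variable {E : ℤ → ℤ → ℝ → ℝ}

theorem strip_mem_openCell (hE : IsKnots E) {z : (ℤ × ℤ) × (I × I)} (h0 : 0 < (z.2.2 : ℝ))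
    (h1 : (z.2.2 : ℝ) < 1) (h2 : 0 < (z.2.1 : ℝ)) (h3 : (z.2.1 : ℝ) < 1) :
    strip E z ∈ openCell E z.1.1 z.1.2 := by
  obtain ⟨⟨n, k⟩, s, t⟩ := z
  have hs := hE.strict n k t h0 h1
  simp only at h0 h1 h2 h3
  refine ⟨?_, ?_, ?_, ?_⟩ <;> simp only [strip, add_sub_cancel_left]
  · linarith
  · linarith
  · nlinarith
  · nlinarith

theorem exists_of_mem_openCell {n k : ℤ} {x : ℝ × ℝ} (hx : x ∈ openCell E n k) :
    ∃ z : (ℤ × ℤ) × (I × I), strip E z = x ∧ z.1 = (n, k) ∧ 0 < (z.2.2 : ℝ) ∧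
      (z.2.2 : ℝ) < 1 ∧ 0 < (z.2.1 : ℝ) ∧ (z.2.1 : ℝ) < 1 := by
  obtain ⟨h1, h2, h3, h4⟩ := hx
  obtain ⟨x, y⟩ := x
  simp only at h1 h2 h3 h4
  set a := E n k (y - n)
  set b := E n (k + 1) (y - n)
  have hba : 0 < b - a := by linarith
  have q0 : 0 < (x - a) / (b - a) := div_pos (by linarith) hba
  have q1 : (x - a) / (b - a) < 1 := by rw [div_lt_one hba]; linarith
  refine ⟨((n, k), ⟨(x - a) / (b - a), q0.le, q1.le⟩, ⟨y - n, by linarith, by linarith⟩), ?_,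
    rfl, ?_, ?_, q0, q1⟩
  · simp only [strip, Prod.mk.injEq]
    refine ⟨?_, by ring⟩
    change (1 - (x - a) / (b - a)) * a + (x - a) / (b - a) * b = x
    field_simp
    ring
  · change 0 < y - n; linarith
  · change y - n < 1; linarith

theorem isOpen_openCell (hE : IsKnots E) (n k : ℤ) : IsOpen (openCell E n k) := by
  have h1 := hE.cont n k
  have h2 := hE.cont n (k + 1)
  have c1 : Continuous fun x : ℝ × ℝ => E n k (x.2 - n) := by fun_prop
  have c2 : Continuous fun x : ℝ × ℝ => E n (k + 1) (x.2 - n) := by fun_prop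
  exact (isOpen_lt continuous_const continuous_snd).inter
    ((isOpen_lt continuous_snd continuous_const).inter
    ((isOpen_lt c1 continuous_fst).inter (isOpen_lt continuous_fst c2)))

theorem isConnected_openCell (hE : IsKnots E) (n k : ℤ) : IsConnected (openCell E n k) := by
  have h1 := hE.cont n k
  have h2 := hE.cont n (k + 1)
  have hI : openCell E n k = (fun u : ℝ × ℝ =>
      (((1 - u.1) * E n k u.2 + u.1 * E n (k + 1) u.2, n + u.2) : ℝ × ℝ)) ''
      (Set.Ioo 0 1 ×ˢ Set.Ioo 0 1) := by
    ext x
    constructor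
    · intro hx
      obtain ⟨⟨⟨n', k'⟩, s, t⟩, rfl, hz, a, b, c, d⟩ := exists_of_mem_openCell hx
      simp only [Prod.mk.injEq] at hz
      obtain ⟨rfl, rfl⟩ := hz
      exact ⟨(s, t), ⟨⟨c, d⟩, a, b⟩, rfl⟩
    · rintro ⟨⟨s, t⟩, ⟨⟨c, d⟩, a, b⟩, rfl⟩
      exact hE.strip_mem_openCell (z := ((n, k), ⟨s, c.le, d.le⟩, ⟨t, a.le, b.le⟩)) a b c d
  rw [hI]
  have hne : (Set.Ioo (0 : ℝ) 1).Nonempty := Set.nonempty_Ioo.2 one_pos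
  refine ((isConnected_Ioo one_pos).prod (isConnected_Ioo one_pos)).image _ ?_
  fun_prop

theorem floor_eq {n : ℤ} {y : ℝ} (h : n < y) (h' : y < n + 1) : ⌊y⌋ = n :=
  Int.floor_eq_iff.2 ⟨h.le, h'⟩

theorem openCell_disjoint (hE : IsKnots E) {n k n' k' : ℤ} {x : ℝ × ℝ}
    (hx : x ∈ openCell E n k) (hx' : x ∈ openCell E n' k') : n = n' ∧ k = k' := by
  obtain ⟨h1, h2, h3, h4⟩ := hx
  obtain ⟨h1', h2', h3', h4'⟩ := hx'
  obtain rfl : n = n' := (floor_eq h1 h2).symm.trans (floor_eq h1' h2')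
  have hm := hE.strictMono n (t := x.2 - n) (by linarith) (by linarith)
  have a1 : k < k' + 1 := hm.lt_iff_lt.1 (h3.trans h4')
  have a2 : k' < k + 1 := hm.lt_iff_lt.1 (h3'.trans h4)
  exact ⟨rfl, by omega⟩

theorem openKnot_disjoint (hE : IsKnots E) {n k n' k' : ℤ} {x : ℝ × ℝ}
    (hx : x ∈ openKnot E n k) (hx' : x ∈ openKnot E n' k') : n = n' ∧ k = k' := by
  obtain ⟨t, h0, h1, rfl⟩ := hx
  obtain ⟨t', h0', h1', he⟩ := hx'
  simp only [Prod.mk.injEq] at he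
  obtain ⟨rfl, rfl⟩ := level_eq h0 h1 h0'.le h1'.le he.2
  exact ⟨rfl, (hE.strictMono n h0 h1).injective he.1⟩

theorem not_mem_openKnot_of_mem_openCell (hE : IsKnots E) {n k n' k' : ℤ} {x : ℝ × ℝ}
    (hx : x ∈ openCell E n k) : x ∉ openKnot E n' k' := by
  rintro ⟨t, h0, h1, rfl⟩
  obtain ⟨h1', h2', h3', h4'⟩ := hx
  simp only at h1' h2' h3' h4'
  obtain ⟨rfl, ht⟩ := level_eq (t' := n' + t - n) h0 h1 (by linarith) (by linarith)
    (show (n' : ℝ) + t = n + (n' + t - n) by ring)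
  rw [← ht] at h3' h4'
  have hm := hE.strictMono n' h0 h1
  have a1 : k < k' := hm.lt_iff_lt.1 h3'
  have a2 : k' < k + 1 := hm.lt_iff_lt.1 h4'
  omega

/-- Every point is on an integral level, on an open curve or in an open region. -/
theorem cases_point (hE : IsKnots E) (x : ℝ × ℝ) :
    (∃ n : ℤ, x.2 = n) ∨ (∃ n k, x ∈ openKnot E n k) ∨ ∃ n k, x ∈ openCell E n k := by
  by_cases hn : ∃ n : ℤ, x.2 = n
  · exact Or.inl hn
  right
  obtain ⟨x, y⟩ := x
  have ht0 : 0 < Int.fract y := by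
    refine lt_of_le_of_ne (Int.fract_nonneg y) fun h => hn ⟨⌊y⌋, ?_⟩
    have := Int.floor_add_fract y
    simp only; linarith
  have ht1 := Int.fract_lt_one y
  have hy := Int.floor_add_fract y
  have hy' : y - ⌊y⌋ = Int.fract y := rfl
  obtain ⟨k, hk, hk'⟩ := hE.exists_between ⌊y⌋ ht0.le ht1.le x
  rcases hk.eq_or_lt with hk | hk
  · exact Or.inl ⟨⌊y⌋, k, Int.fract y, ht0, ht1, by rw [hk, hy]⟩
  · refine Or.inr ⟨⌊y⌋, k, ?_, ?_, ?_, ?_⟩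
    · simp only; linarith
    · simp only; linarith
    · rw [hy']; exact hk
    · rw [hy']; exact hk'

theorem components_openCell (hE : IsKnots E) :
    components (⋃₀ {s | ∃ n k, s = openCell E n k}) = {s | ∃ n k, s = openCell E n k} := by
  apply components_sUnion
  · rintro _ ⟨n, k, rfl⟩; exact hE.isOpen_openCell n k
  · rintro _ ⟨n, k, rfl⟩; exact hE.isConnected_openCell n k
  · rintro _ ⟨n, k, rfl⟩ _ ⟨n', k', rfl⟩ x hx hx'
    obtain ⟨rfl, rfl⟩ := hE.openCell_disjoint hx hx'
    rfl

theorem openKnot_not_level {n k m : ℤ} {x : ℝ × ℝ} (hx : x ∈ openKnot E n k) : x.2 ≠ m := by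
  obtain ⟨t, h0, h1, rfl⟩ := hx
  intro h
  obtain ⟨-, h⟩ := level_eq (n' := m) (t' := 0) h0 h1 le_rfl zero_le_one (by simpa using h)
  exact h0.ne' h

theorem openCell_not_level {n k m : ℤ} {x : ℝ × ℝ} (hx : x ∈ openCell E n k) : x.2 ≠ m := by
  obtain ⟨h1, h2, -⟩ := hx
  intro h
  rw [h] at h1 h2
  norm_cast at h1 h2
  omega

end IsKnots

/-! ### The straight edges -/

theorem mem_edge {m n m' n' : ℤ} {x : ℝ × ℝ} :
    x ∈ edge m n m' n' ↔
      ∃ t : ℝ, 0 < t ∧ t < 1 ∧ x = (m + t * (m' - m), n + t * (n' - n)) := by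
  rw [edge, openSegment_eq_image]
  constructor
  · rintro ⟨t, ⟨h0, h1⟩, rfl⟩
    refine ⟨t, h0, h1, ?_⟩
    simp only [pt, Prod.smul_mk, Prod.mk_add_mk, smul_eq_mul, Prod.mk.injEq]
    constructor <;> ring
  · rintro ⟨t, h0, h1, rfl⟩
    refine ⟨t, ⟨h0, h1⟩, ?_⟩
    simp only [pt, Prod.smul_mk, Prod.mk_add_mk, smul_eq_mul, Prod.mk.injEq]
    constructor <;> ring

theorem mem_closure_edge {m n m' n' : ℤ} {x : ℝ × ℝ} :
    x ∈ closure (edge m n m' n') ↔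
      ∃ t : ℝ, 0 ≤ t ∧ t ≤ 1 ∧ x = (m + t * (m' - m), n + t * (n' - n)) := by
  rw [edge, closure_openSegment, segment_eq_image]
  constructor
  · rintro ⟨t, ⟨h0, h1⟩, rfl⟩
    refine ⟨t, h0, h1, ?_⟩
    simp only [pt, Prod.smul_mk, Prod.mk_add_mk, smul_eq_mul, Prod.mk.injEq]
    constructor <;> ring
  · rintro ⟨t, h0, h1, rfl⟩
    refine ⟨t, ⟨h0, h1⟩, ?_⟩
    simp only [pt, Prod.smul_mk, Prod.mk_add_mk, smul_eq_mul, Prod.mk.injEq]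
    constructor <;> ring

theorem edge_eq_openKnot {E : ℤ → ℤ → ℝ → ℝ} {n k m m' : ℤ}
    (h : ∀ t, E n k t = m + t * (m' - m)) : edge m n m' (n + 1) = openKnot E n k := by
  ext x
  rw [mem_edge]
  simp only [openKnot, Set.mem_ofPred_eq, h]
  push_cast
  simp

theorem mem_closure_openKnot {E : ℤ → ℤ → ℝ → ℝ} {n k m m' : ℤ}
    (h : ∀ t, E n k t = m + t * (m' - m)) {x : ℝ × ℝ} :
    x ∈ closure (openKnot E n k) ↔ ∃ t : ℝ, 0 ≤ t ∧ t ≤ 1 ∧ x = (E n k t, n + t) := by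
  rw [← edge_eq_openKnot h, mem_closure_edge]
  simp only [h]
  push_cast
  simp

/-! ### The slanted and the vertical edges of `CWΔ(φ)` -/

/-- The slanted (`k` even) and vertical (`k` odd) edges above level `n`, from left to right. -/
noncomputable def knot (f : ℤ → Letter) (n k : ℤ) (t : ℝ) : ℝ :=
  3 * (k / 4 : ℤ) + if k % 4 = 0 then (match f n with | .R => 0 | .L => 1 - t)
    else if k % 4 = 1 then 1
    else if k % 4 = 2 then (match f n with | .R => 1 + t | .L => 2)
    else d f n + t * (d f (n + 1) - d f n)

section Knot

variable {f : ℤ → Letter}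

theorem knot_zero_R {n : ℤ} (h : f n = .R) (m : ℤ) (t : ℝ) : knot f n (4 * m) t = 3 * m := by
  simp [knot, h]

theorem knot_zero_L {n : ℤ} (h : f n = .L) (m : ℤ) (t : ℝ) :
    knot f n (4 * m) t = 3 * m + 1 - t := by
  simp [knot, h]; ring

theorem knot_one (n m : ℤ) (t : ℝ) : knot f n (4 * m + 1) t = 3 * m + 1 := by
  simp [knot, show (4 * m + 1) % 4 = 1 by omega, show (4 * m + 1) / 4 = m by omega]

theorem knot_two_R {n : ℤ} (h : f n = .R) (m : ℤ) (t : ℝ) :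
    knot f n (4 * m + 2) t = 3 * m + 1 + t := by
  simp [knot, h, show (4 * m + 2) % 4 = 2 by omega, show (4 * m + 2) / 4 = m by omega]; ring

theorem knot_two_L {n : ℤ} (h : f n = .L) (m : ℤ) (t : ℝ) :
    knot f n (4 * m + 2) t = 3 * m + 2 := by
  simp [knot, h, show (4 * m + 2) % 4 = 2 by omega, show (4 * m + 2) / 4 = m by omega]

theorem knot_three (n m : ℤ) (t : ℝ) :
    knot f n (4 * m + 3) t = 3 * m + d f n + t * (d f (n + 1) - d f n) := by
  simp [knot, show (4 * m + 3) % 4 = 3 by omega, show (4 * m + 3) / 4 = m by omega]; ring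

theorem d_R {n : ℤ} (h : f n = .R) : d f n = 2 := by simp [d, h]

theorem d_L {n : ℤ} (h : f n = .L) : d f n = 3 := by simp [d, h]

theorem R_or_L (l : Letter) : l = .R ∨ l = .L := by cases l <;> simp

theorem knot_four_R {n : ℤ} (h : f n = .R) (m : ℤ) (t : ℝ) :
    knot f n (4 * m + 4) t = 3 * m + 3 := by
  rw [show 4 * m + 4 = 4 * (m + 1) by ring, knot_zero_R h]; push_cast; ring

theorem knot_four_L {n : ℤ} (h : f n = .L) (m : ℤ) (t : ℝ) :
    knot f n (4 * m + 4) t = 3 * m + 4 - t := by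
  rw [show 4 * m + 4 = 4 * (m + 1) by ring, knot_zero_L h]; push_cast; ring

theorem d_cases (f : ℤ → Letter) (n : ℤ) : d f n = 2 ∨ d f n = 3 := by
  rcases R_or_L (f n) with h | h
  · exact Or.inl (d_R h)
  · exact Or.inr (d_L h)

theorem knot_cases (f : ℤ → Letter) (n : ℤ) :
    (f n = .R ∧ d f n = 2 ∧ (∀ (m : ℤ) t, knot f n (4 * m) t = 3 * m) ∧
      (∀ (m : ℤ) t, knot f n (4 * m + 2) t = 3 * m + 1 + t) ∧
      ∀ (m : ℤ) t, knot f n (4 * m + 4) t = 3 * m + 3) ∨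
    (f n = .L ∧ d f n = 3 ∧ (∀ (m : ℤ) t, knot f n (4 * m) t = 3 * m + 1 - t) ∧
      (∀ (m : ℤ) t, knot f n (4 * m + 2) t = 3 * m + 2) ∧
      ∀ (m : ℤ) t, knot f n (4 * m + 4) t = 3 * m + 4 - t) := by
  rcases R_or_L (f n) with h | h
  · exact Or.inl ⟨h, d_R h, knot_zero_R h, knot_two_R h, knot_four_R h⟩
  · exact Or.inr ⟨h, d_L h, knot_zero_L h, knot_two_L h, knot_four_L h⟩

theorem mod_four_cases (k : ℤ) :
    ∃ m, k = 4 * m ∨ k = 4 * m + 1 ∨ k = 4 * m + 2 ∨ k = 4 * m + 3 := ⟨k / 4, by omega⟩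

theorem isKnots_knot (f : ℤ → Letter) : IsKnots (knot f) where
  cont n k := by
    unfold knot
    rcases R_or_L (f n) with h | h <;> rw [h] <;> split_ifs <;> fun_prop
  mono n k t h0 h1 := by
    obtain ⟨m, rfl | rfl | rfl | rfl⟩ := mod_four_cases k <;>
    rcases knot_cases f n with ⟨-, h, e0, e2, e4⟩ | ⟨-, h, e0, e2, e4⟩ <;>
    rcases d_cases f (n + 1) with h' | h' <;>
    simp only [add_assoc, one_add_one_eq_two, two_add_one_eq_three, three_add_one_eq_four,
      knot_one, knot_three, e0, e2, e4, h, h'] <;>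
    push_cast <;> linarith
  strict n k t h0 h1 := by
    obtain ⟨m, rfl | rfl | rfl | rfl⟩ := mod_four_cases k <;>
    rcases knot_cases f n with ⟨-, h, e0, e2, e4⟩ | ⟨-, h, e0, e2, e4⟩ <;>
    rcases d_cases f (n + 1) with h' | h' <;>
    simp only [add_assoc, one_add_one_eq_two, two_add_one_eq_three, three_add_one_eq_four,
      knot_one, knot_three, e0, e2, e4, h, h'] <;>
    push_cast <;> linarith
  bdd := by
    -- Four curves occupy a period of width three.
    refine ⟨3 / 4, 4, by norm_num, fun n k t h0 h1 => ?_⟩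
    rw [abs_le]
    obtain ⟨m, rfl | rfl | rfl | rfl⟩ := mod_four_cases k <;>
    rcases knot_cases f n with ⟨-, h, e0, e2, e4⟩ | ⟨-, h, e0, e2, e4⟩ <;>
    rcases d_cases f (n + 1) with h' | h' <;>
    simp only [knot_one, knot_three, e0, e2, h, h'] <;>
    push_cast <;> constructor <;> linarith

end Knot

section Families

variable {f : ℤ → Letter}

theorem knot_linear (f : ℤ → Letter) (n k : ℤ) :
    ∃ a b : ℤ, ∀ t, knot f n k t = a + t * (b - a) := by
  obtain ⟨m, rfl | rfl | rfl | rfl⟩ := mod_four_cases k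
  · rcases knot_cases f n with ⟨-, -, e, -, -⟩ | ⟨-, -, e, -, -⟩
    · exact ⟨3 * m, 3 * m, fun t => by rw [e]; push_cast; ring⟩
    · exact ⟨3 * m + 1, 3 * m, fun t => by rw [e]; push_cast; ring⟩
  · exact ⟨3 * m + 1, 3 * m + 1, fun t => by rw [knot_one]; push_cast; ring⟩
  · rcases knot_cases f n with ⟨-, -, -, e, -⟩ | ⟨-, -, -, e, -⟩
    · exact ⟨3 * m + 1, 3 * m + 2, fun t => by rw [e]; push_cast; ring⟩
    · exact ⟨3 * m + 2, 3 * m + 2, fun t => by rw [e]; push_cast; ring⟩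
  · exact ⟨3 * m + d f n, 3 * m + d f (n + 1), fun t => by rw [knot_three]; push_cast; ring⟩

theorem mem_closure_knot {n k : ℤ} {x : ℝ × ℝ} : x ∈ closure (openKnot (knot f) n k) ↔
    ∃ t : ℝ, 0 ≤ t ∧ t ≤ 1 ∧ x = (knot f n k t, n + t) := by
  obtain ⟨a, b, h⟩ := knot_linear f n k
  exact mem_closure_openKnot h

theorem vertical_eq : vertical f = {s | ∃ n k, s = openKnot (knot f) n (2 * k + 1)} := by
  have e1 : ∀ m n, edge (3 * m + 1) n (3 * m + 1) (n + 1) = openKnot (knot f) n (4 * m + 1) :=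
    fun m n => edge_eq_openKnot fun t => by rw [knot_one]; push_cast; ring
  have e2 : ∀ m n, edge (3 * m + d f n) n (3 * m + d f (n + 1)) (n + 1) =
      openKnot (knot f) n (4 * m + 3) :=
    fun m n => edge_eq_openKnot fun t => by rw [knot_three]; push_cast; ring
  ext s
  constructor
  · rintro (⟨m, n, rfl⟩ | ⟨m, n, rfl⟩)
    · exact ⟨n, 2 * m, by rw [e1]; congr 1; ring⟩
    · exact ⟨n, 2 * m + 1, by rw [e2]; congr 1; ring⟩
  · rintro ⟨n, k, rfl⟩
    obtain ⟨m, rfl | rfl⟩ := even_or_odd_cases k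
    · exact Or.inl ⟨m, n, by rw [e1]; congr 1; ring⟩
    · exact Or.inr ⟨m, n, by rw [e2]; congr 1; ring⟩

theorem slanted_eq : slanted f = {s | ∃ n k, s = openKnot (knot f) n (2 * k)} := by
  have e1 : ∀ m n, f n = .R → edge (3 * m) n (3 * m) (n + 1) = openKnot (knot f) n (4 * m) :=
    fun m n h => edge_eq_openKnot fun t => by rw [knot_zero_R h]; push_cast; ring
  have e2 : ∀ m n, f n = .R →
      edge (3 * m + 1) n (3 * m + 2) (n + 1) = openKnot (knot f) n (4 * m + 2) :=
    fun m n h => edge_eq_openKnot fun t => by rw [knot_two_R h]; push_cast; ring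
  have e3 : ∀ m n, f n = .L → edge (3 * m + 1) n (3 * m) (n + 1) = openKnot (knot f) n (4 * m) :=
    fun m n h => edge_eq_openKnot fun t => by rw [knot_zero_L h]; push_cast; ring
  have e4 : ∀ m n, f n = .L →
      edge (3 * m + 2) n (3 * m + 2) (n + 1) = openKnot (knot f) n (4 * m + 2) :=
    fun m n h => edge_eq_openKnot fun t => by rw [knot_two_L h]; push_cast; ring
  ext s
  constructor
  · rintro (⟨m, n, h, rfl | rfl⟩ | ⟨m, n, h, rfl | rfl⟩)
    · exact ⟨n, 2 * m, by rw [e1 _ _ h]; congr 1; ring⟩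
    · exact ⟨n, 2 * m + 1, by rw [e2 _ _ h]; congr 1; ring⟩
    · exact ⟨n, 2 * m, by rw [e3 _ _ h]; congr 1; ring⟩
    · exact ⟨n, 2 * m + 1, by rw [e4 _ _ h]; congr 1; ring⟩
  · rintro ⟨n, k, rfl⟩
    rcases R_or_L (f n) with h | h
    · obtain ⟨m, rfl | rfl⟩ := even_or_odd_cases k
      · exact Or.inl ⟨m, n, h, Or.inl (by rw [e1 _ _ h]; congr 1; ring)⟩
      · exact Or.inl ⟨m, n, h, Or.inr (by rw [e2 _ _ h]; congr 1; ring)⟩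
    · obtain ⟨m, rfl | rfl⟩ := even_or_odd_cases k
      · exact Or.inr ⟨m, n, h, Or.inl (by rw [e3 _ _ h]; congr 1; ring)⟩
      · exact Or.inr ⟨m, n, h, Or.inr (by rw [e4 _ _ h]; congr 1; ring)⟩

/-- The slanted edges above level `n`, from left to right. -/
noncomputable def slant (f : ℤ → Letter) (n k : ℤ) (t : ℝ) : ℝ := knot f n (2 * k) t

theorem isKnots_slant (f : ℤ → Letter) : IsKnots (slant f) where
  cont n k := (isKnots_knot f).cont n _
  mono n k t h0 h1 := ((isKnots_knot f).monotone n h0 h1) (by omega)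
  strict n k t h0 h1 := ((isKnots_knot f).strictMono n h0 h1) (by omega)
  bdd := by
    obtain ⟨κ, K, hκ, h⟩ := (isKnots_knot f).bdd
    refine ⟨2 * κ, K, by linarith, fun n k t h0 h1 => ?_⟩
    have := h n (2 * k) t h0 h1
    push_cast at this
    rw [show 2 * κ * (k : ℝ) = κ * (2 * k) by ring]
    exact this

/-- The slanted edges above level `n` for the two values of the letter, together with the
position of the last occurrences of the two letters. -/
theorem slant_cases (hf : Recurrent f) (n : ℤ) :
    (f n = .R ∧ lastIdx f .R (n + 1) = n ∧ lastIdx f .L (n + 1) = lastIdx f .L n ∧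
      (∀ m, mid f n (2 * m + 1) = (m, lastIdx f .R n)) ∧
      (∀ (m : ℤ) t, slant f n (2 * m) t = 3 * m) ∧
      (∀ (m : ℤ) t, slant f n (2 * m + 1) t = 3 * m + 1 + t) ∧
      ∀ (m : ℤ) t, slant f n (2 * m + 1 + 1) t = 3 * m + 3) ∨
    (f n = .L ∧ lastIdx f .L (n + 1) = n ∧ lastIdx f .R (n + 1) = lastIdx f .R n ∧
      (∀ m, mid f n (2 * m + 1) = (m + 1, lastIdx f .L n)) ∧
      (∀ (m : ℤ) t, slant f n (2 * m) t = 3 * m + 1 - t) ∧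
      (∀ (m : ℤ) t, slant f n (2 * m + 1) t = 3 * m + 2) ∧
      ∀ (m : ℤ) t, slant f n (2 * m + 1 + 1) t = 3 * m + 4 - t) := by
  have a0 : ∀ m : ℤ, 2 * (2 * m) = 4 * m := fun m => by ring
  have a1 : ∀ m : ℤ, 2 * (2 * m + 1) = 4 * m + 2 := fun m => by ring
  have a2 : ∀ m : ℤ, 2 * (2 * m + 1 + 1) = 4 * m + 4 := fun m => by ring
  rcases (lastIdx_facts hf n).2.2.2 with ⟨h, e1, e2⟩ | ⟨h, e1, e2⟩
  · refine Or.inl ⟨h, e1, e2, mid_odd_of_R h, ?_, ?_, ?_⟩ <;> intro m t <;> unfold slant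
    · rw [a0, knot_zero_R h]
    · rw [a1, knot_two_R h]
    · rw [a2, knot_four_R h]
  · refine Or.inr ⟨h, e1, e2, mid_odd_of_L h, ?_, ?_, ?_⟩ <;> intro m t <;> unfold slant
    · rw [a0, knot_zero_L h]
    · rw [a1, knot_two_L h]
    · rw [a2, knot_four_L h]

theorem slanted_eq_slant : slanted f = {s | ∃ n k, s = openKnot (slant f) n k} := slanted_eq

theorem mem_closure_slant {n k : ℤ} {x : ℝ × ℝ} : x ∈ closure (openKnot (slant f) n k) ↔
    ∃ t : ℝ, 0 ≤ t ∧ t ≤ 1 ∧ x = (slant f n k t, n + t) := mem_closure_knot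

theorem mk_slant_eq {n k : ℤ} {t t' : ℝ} (h0 : 0 ≤ t) (h1 : t ≤ 1) (h0' : 0 ≤ t') (h1' : t' ≤ 1) :
    Collapse.mk (slanted f) (slant f n k t, n + t) =
      Collapse.mk (slanted f) (slant f n k t', n + t') :=
  Collapse.mk_eq (e := openKnot (slant f) n k) (by rw [slanted_eq_slant]; exact ⟨n, k, rfl⟩)
    (mem_closure_slant.2 ⟨t, h0, h1, rfl⟩) (mem_closure_slant.2 ⟨t', h0', h1', rfl⟩)

/-- The slanted edges ending in a lattice point lead down to the vertex indexing it. -/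
theorem mk_pt_eq (hf : Recurrent f) (j n : ℤ) : Collapse.mk (slanted f) (pt j n) =
    Collapse.mk (slanted f) (pt (3 * (lat f j n).1 + 1) (lat f j n).2) := by
  have step : ∀ i k a b : ℤ, slant f i k 0 = a → slant f i k 1 = b →
      Collapse.mk (slanted f) (pt b (i + 1)) = Collapse.mk (slanted f) (pt a i) := by
    intro i k a b ha hb
    have := mk_slant_eq (f := f) (n := i) (k := k) zero_le_one le_rfl le_rfl zero_le_one
    rw [ha, hb] at this
    simpa [pt] using this
  obtain ⟨m, rfl | rfl | rfl⟩ := mod_three_cases j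
  · rw [lat_zero]
    refine last_induction hf .L (p := fun n i => Collapse.mk (slanted f) (pt (3 * m) n) =
      Collapse.mk (slanted f) (pt (3 * m + 1) i)) ?_ ?_ n
    · intro i hi
      rcases slant_cases hf i with ⟨h, -, -, -, e, -⟩ | ⟨h, -, -, -, e, -⟩
      · rw [h] at hi; exact absurd hi letter_ne
      · exact step i (2 * m) _ _ (by rw [e]; push_cast; ring) (by rw [e]; push_cast; ring)
    · intro i l hi hp
      rcases slant_cases hf i with ⟨h, -, -, -, e, -⟩ | ⟨h, -, -, -, e, -⟩
      · rw [← hp]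
        exact step i (2 * m) _ _ (by rw [e]; push_cast; ring) (by rw [e]; push_cast; ring)
      · exact absurd h hi
  · rw [lat_one]
  · rw [lat_two]
    refine last_induction hf .R (p := fun n i => Collapse.mk (slanted f) (pt (3 * m + 2) n) =
      Collapse.mk (slanted f) (pt (3 * m + 1) i)) ?_ ?_ n
    · intro i hi
      rcases slant_cases hf i with ⟨h, -, -, -, -, e, -⟩ | ⟨h, -, -, -, -, e, -⟩
      · exact step i (2 * m + 1) _ _ (by rw [e]; push_cast; ring) (by rw [e]; push_cast; ring)
      · rw [h] at hi; exact absurd hi.symm letter_ne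
    · intro i l hi hp
      rcases slant_cases hf i with ⟨h, -, -, -, -, e, -⟩ | ⟨h, -, -, -, -, e, -⟩
      · exact absurd h hi
      · rw [← hp]
        exact step i (2 * m + 1) _ _ (by rw [e]; push_cast; ring) (by rw [e]; push_cast; ring)

/-- All points of a slanted edge represent the same vertex. -/
theorem mk_slant (hf : Recurrent f) (n k : ℤ) {t : ℝ} (h0 : 0 ≤ t) (h1 : t ≤ 1) :
    Collapse.mk (slanted f) (slant f n k t, n + t) =
      Collapse.mk (slanted f) (pt (3 * (ver f n k).1 + 1) (ver f n k).2) := by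
  rw [mk_slant_eq h0 h1 zero_le_one le_rfl]
  have key : ∀ j, slant f n k 1 = (j : ℤ) → lat f j (n + 1) = ver f n k →
      Collapse.mk (slanted f) (slant f n k 1, (n : ℝ) + 1) =
      Collapse.mk (slanted f) (pt (3 * (ver f n k).1 + 1) (ver f n k).2) := by
    intro j hj hl
    rw [← hl, ← mk_pt_eq hf, hj, pt]
    push_cast; rfl
  obtain ⟨m, rfl | rfl⟩ := even_or_odd_cases k
  · refine key (3 * m) ?_ (by rw [lat_zero, ver_even])
    rcases slant_cases hf n with ⟨-, -, -, -, e, -⟩ | ⟨-, -, -, -, e, -⟩ <;> rw [e] <;>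
    push_cast <;> ring
  · refine key (3 * m + 2) ?_ (by rw [lat_two, ver_odd])
    rcases slant_cases hf n with ⟨-, -, -, -, -, e, -⟩ | ⟨-, -, -, -, -, e, -⟩ <;> rw [e] <;>
    push_cast <;> ring

end Families

end PTB

namespace PTB

/-! ### Barycentric coordinates -/

open unitInterval

/-- The barycentric coordinates of the vertex `X`. -/
noncomputable def vert (X : Orb) : Orb → ℝ := Set.indicator {X} 1

theorem vert_self (X : Orb) : vert X X = 1 := by simp [vert]

theorem vert_of_ne {X Y : Orb} (h : Y ≠ X) : vert X Y = 0 := by simp [vert, h]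

theorem vert_nonneg (X Y : Orb) : 0 ≤ vert X Y := by
  by_cases h : Y = X
  · rw [h, vert_self]; exact zero_le_one
  · rw [vert_of_ne h]

theorem vert_injective : Function.Injective vert := by
  intro X Y h
  by_contra hne
  have h1 := congrFun h X
  rw [vert_self, vert_of_ne hne] at h1
  exact one_ne_zero h1

theorem vert_ne_zero_iff {X Y : Orb} : vert X Y ≠ 0 ↔ Y = X := by
  constructor
  · intro h; by_contra hne; exact h (vert_of_ne hne)
  · rintro rfl; rw [vert_self]; exact one_ne_zero

/-- The point with the given barycentric coordinates. -/
noncomputable def comb (X Y Z : Orb) (a b c : ℝ) (V : Orb) : ℝ :=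
  a * vert X V + b * vert Y V + c * vert Z V

section Comb

variable {X Y Z : Orb} {a b c : ℝ}

theorem comb_ne_zero_iff (ha : 0 < a) (hb : 0 < b) (hc : 0 < c) (V : Orb) :
    comb X Y Z a b c V ≠ 0 ↔ V = X ∨ V = Y ∨ V = Z := by
  have h1 := vert_nonneg X V
  have h2 := vert_nonneg Y V
  have h3 := vert_nonneg Z V
  rw [← vert_ne_zero_iff, ← vert_ne_zero_iff, ← vert_ne_zero_iff, comb]
  constructor
  · intro h
    by_contra hn
    push Not at hn
    rw [hn.1, hn.2.1, hn.2.2] at h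
    simp at h
  · rintro (h | h | h)
    · have := lt_of_le_of_ne h1 h.symm
      positivity
    · have := lt_of_le_of_ne h2 h.symm
      positivity
    · have := lt_of_le_of_ne h3 h.symm
      positivity

theorem comb_fst (h1 : X ≠ Y) (h2 : X ≠ Z) : comb X Y Z a b c X = a := by
  simp [comb, vert_self, vert_of_ne h1, vert_of_ne h2]

theorem comb_snd (h1 : X ≠ Y) (h2 : Y ≠ Z) : comb X Y Z a b c Y = b := by
  simp [comb, vert_self, vert_of_ne h1.symm, vert_of_ne h2]

theorem comb_thd (h1 : X ≠ Z) (h2 : Y ≠ Z) : comb X Y Z a b c Z = c := by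
  simp [comb, vert_self, vert_of_ne h1.symm, vert_of_ne h2.symm]

theorem comb_other {V : Orb} (h1 : V ≠ X) (h2 : V ≠ Y) (h3 : V ≠ Z) :
    comb X Y Z a b c V = 0 := by
  simp [comb, vert_of_ne h1, vert_of_ne h2, vert_of_ne h3]

theorem comb_nonneg (ha : 0 ≤ a) (hb : 0 ≤ b) (hc : 0 ≤ c) (V : Orb) :
    0 ≤ comb X Y Z a b c V := by
  have h1 := vert_nonneg X V
  have h2 := vert_nonneg Y V
  have h3 := vert_nonneg Z V
  unfold comb; positivity

end Comb

/-- The point dividing an edge in the ratio `u : 1 - u`. -/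
noncomputable def seg (X Y : Orb) (u : ℝ) : Orb → ℝ := fun V => (1 - u) * vert X V + u * vert Y V

theorem seg_zero (X Y : Orb) : seg X Y 0 = vert X := by ext V; simp [seg]

theorem seg_one (X Y : Orb) : seg X Y 1 = vert Y := by ext V; simp [seg]

theorem seg_ne_zero_iff {X Y : Orb} {u : ℝ} (h0 : 0 < u) (h1 : u < 1) (V : Orb) :
    seg X Y u V ≠ 0 ↔ V = X ∨ V = Y := by
  have e : seg X Y u = comb X Y Y (1 - u) (u / 2) (u / 2) := by
    ext V; simp only [seg, comb]; ring
  rw [e, comb_ne_zero_iff (by linarith) (by linarith) (by linarith)]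
  tauto

/-- Each closed simplex sits compatibly in one of the `T i`, so openness in the weak topology can be
tested on these. Each `b i` is itself a quotient map, going from a compact space onto a Hausdorff
one. -/
theorem isQuotientMap_realization {V ι W : Type*} [TopologicalSpace ι] [DiscreteTopology ι]
    [TopologicalSpace W] [CompactSpace W] {K : PreAbstractSimplicialComplex V} (T : ι → K.faces)
    (b : ∀ i, W → ClosedSimplex (T i).1) (hb : ∀ i, Continuous (b i))
    (hs : ∀ i, Function.Surjective (b i)) (hT : ∀ s : K.faces, ∃ i, s.1 ⊆ (T i).1) :
    IsQuotientMap fun z : ι × W => ClosedSimplex.incl (T z.1) (b z.1 z.2) := by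
  classical
  have hT2 : ∀ s : Finset V, T2Space (ClosedSimplex s) := fun s =>
    inferInstanceAs (T2Space {_w : V → ℝ // _})
  have hincl : ∀ s : K.faces, Continuous (ClosedSimplex.incl s) := fun s =>
    continuous_iff_coinduced_le.2 (le_iSup (fun s : K.faces => TopologicalSpace.coinduced
      (ClosedSimplex.incl s) inferInstance) s)
  have hle : ∀ s : K.faces, ∃ i, ∃ g : ClosedSimplex s.1 → ClosedSimplex (T i).1, Continuous g ∧
      ∀ w, ClosedSimplex.incl (T i) (g w) = ClosedSimplex.incl s w := by
    intro s
    obtain ⟨i, hi⟩ := hT s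
    refine ⟨i, fun w => ⟨w.1, w.2.1, fun v hv => w.2.2.1 v fun h => hv (hi h), ?_⟩, ?_,
      fun w => rfl⟩
    · rw [← Finset.sum_subset hi fun v _ hv => w.2.2.1 v hv]
      exact w.2.2.2
    · exact Continuous.subtype_mk continuous_subtype_val _
  refine (isQuotientMap_iff _).2
    ⟨isCoinducing_iff.2 fun U => ⟨fun hU => ?_, fun hU => ?_⟩, ?_⟩
  rotate_left 2
  · rintro ⟨w, h0, s, hs', hw⟩
    obtain ⟨i, g, -, hg⟩ := hle ⟨s, hs'⟩
    obtain ⟨x, hx⟩ := hs i (g ⟨w, h0, hw⟩)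
    exact ⟨(i, x), (congrArg (ClosedSimplex.incl (T i)) hx).trans (hg _)⟩
  · rw [isOpen_iSup_iff]
    intro s
    rw [isOpen_coinduced]
    obtain ⟨i, g, hgc, hg⟩ := hle s
    have hq : IsQuotientMap (b i) := (hb i).isClosedMap.isQuotientMap (hb i) (hs i)
    have h1 : IsOpen (ClosedSimplex.incl (T i) ⁻¹' U) := by
      rw [← hq.isOpen_preimage]
      exact hU.preimage (f := fun x : W => (i, x)) (by fun_prop)
    have h2 := h1.preimage hgc
    rw [← Set.preimage_comp] at h2
    rwa [show ClosedSimplex.incl (T i) ∘ g = ClosedSimplex.incl s from funext hg] at h2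
  · refine hU.preimage ?_
    rw [continuous_prod_of_discrete_left]
    exact fun i => (hincl (T i)).comp (hb i)

/-- The weight of the third vertex of a face. -/
noncomputable def midWeight (k : ℤ) (s t : ℝ) : ℝ :=
  (if k % 2 = 0 then t else 1 - t) * (1 - |2 * s - 1|)

theorem midWeight_even (m : ℤ) (s t : ℝ) : midWeight (2 * m) s t = t * (1 - |2 * s - 1|) := by
  simp [midWeight]

theorem midWeight_odd (m : ℤ) (s t : ℝ) :
    midWeight (2 * m + 1) s t = (1 - t) * (1 - |2 * s - 1|) := by
  simp [midWeight]

theorem midWeight_eq (k : ℤ) : (∀ s t, midWeight k s t = t * (1 - |2 * s - 1|)) ∨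
    ∀ s t, midWeight k s t = (1 - t) * (1 - |2 * s - 1|) := by
  obtain ⟨m, rfl | rfl⟩ := even_or_odd_cases k
  · exact Or.inl (midWeight_even m)
  · exact Or.inr (midWeight_odd m)

/-- The characteristic maps of the faces of `Δ*(φ)`. -/
noncomputable def bary (f : ℤ → Letter) (i : ℤ × ℤ) (s t : ℝ) : Orb → ℝ :=
  comb (gen f (ver f i.1 i.2)) (gen f (mid f i.1 i.2)) (gen f (ver f i.1 (i.2 + 1)))
    (1 - s - midWeight i.2 s t / 2) (midWeight i.2 s t) (s - midWeight i.2 s t / 2)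

theorem abs_cases_half (s : ℝ) : (s ≤ 1 / 2 ∧ |2 * s - 1| = 1 - 2 * s) ∨
    (1 / 2 ≤ s ∧ |2 * s - 1| = 2 * s - 1) := by
  rcases le_total s (1 / 2) with h | h
  · exact Or.inl ⟨h, by rw [abs_of_nonpos (by linarith)]; ring⟩
  · exact Or.inr ⟨h, abs_of_nonneg (by linarith)⟩

theorem weights_nonneg (k : ℤ) {s t : ℝ} (hs0 : 0 ≤ s) (hs1 : s ≤ 1) (ht0 : 0 ≤ t)
    (ht1 : t ≤ 1) : 0 ≤ midWeight k s t ∧ 0 ≤ 1 - s - midWeight k s t / 2 ∧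
      0 ≤ s - midWeight k s t / 2 := by
  rcases midWeight_eq k with h | h <;> rw [h] <;>
  rcases abs_cases_half s with ⟨h1, e⟩ | ⟨h1, e⟩ <;> rw [e] <;>
  refine ⟨?_, ?_, ?_⟩ <;> nlinarith

theorem weights_pos (k : ℤ) {s t : ℝ} (hs0 : 0 < s) (hs1 : s < 1) (ht0 : 0 < t)
    (ht1 : t < 1) : 0 < midWeight k s t ∧ 0 < 1 - s - midWeight k s t / 2 ∧
      0 < s - midWeight k s t / 2 := by
  rcases midWeight_eq k with h | h <;> rw [h] <;>
  rcases abs_cases_half s with ⟨h1, e⟩ | ⟨h1, e⟩ <;> rw [e] <;>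
  refine ⟨?_, ?_, ?_⟩ <;> nlinarith

/-- The weights determine the parameters. -/
theorem exists_weights (k : ℤ) {a b c : ℝ} (ha : 0 ≤ a) (hb : 0 ≤ b) (hc : 0 ≤ c)
    (h : a + b + c = 1) : ∃ s t : ℝ, 0 ≤ s ∧ s ≤ 1 ∧ 0 ≤ t ∧ t ≤ 1 ∧
      midWeight k s t = b ∧ 1 - s - midWeight k s t / 2 = a ∧ s - midWeight k s t / 2 = c := by
  have hab : |c - a| ≤ 1 - b := abs_le.2 ⟨by linarith, by linarith⟩
  -- The difference of the outer weights is `2s - 1`, which fixes `s`; then `t` is the ratio of `b`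
  -- to its maximal value. If that maximum is zero then `b = 0`, and `τ = 0` is an arbitrary choice.
  obtain ⟨τ, h0, h1, hτ⟩ : ∃ τ : ℝ, 0 ≤ τ ∧ τ ≤ 1 ∧ τ * (1 - |c - a|) = b := by
    rcases (show 0 ≤ 1 - |c - a| by linarith).eq_or_lt with h' | h'
    · exact ⟨0, le_rfl, zero_le_one, by linarith⟩
    · refine ⟨b / (1 - |c - a|), by positivity, ?_, by field_simp⟩
      rw [div_le_one h']; linarith
  refine ⟨(1 + c - a) / 2, if k % 2 = 0 then τ else 1 - τ, by linarith, by linarith, ?_, ?_, ?_⟩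
  · split_ifs <;> linarith
  · split_ifs <;> linarith
  · have e : midWeight k ((1 + c - a) / 2) (if k % 2 = 0 then τ else 1 - τ) = b := by
      rw [← hτ, midWeight]
      split_ifs <;> ring_nf
    rw [e]
    refine ⟨rfl, ?_, ?_⟩ <;> linarith

theorem weights_injective (k : ℤ) {s t s' t' : ℝ} (hs0 : 0 < s) (hs1 : s < 1)
    (hb : midWeight k s t = midWeight k s' t')
    (hc : s - midWeight k s t / 2 = s' - midWeight k s' t' / 2) : s = s' ∧ t = t' := by
  have e : s = s' := by linarith
  subst e
  refine ⟨rfl, ?_⟩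
  have hne : 1 - |2 * s - 1| ≠ 0 := by
    rcases abs_cases_half s with ⟨h1, e⟩ | ⟨h1, e⟩ <;> rw [e] <;> intro h <;> linarith
  rcases midWeight_eq k with h | h <;> rw [h, h] at hb
  · exact mul_right_cancel₀ hne hb
  · have := mul_right_cancel₀ hne hb
    linarith

/-- The left and right sides of a square go to single vertices; this reflects the collapse of the
slanted edges. -/
theorem bary_left (f : ℤ → Letter) (i : ℤ × ℤ) (t : ℝ) :
    bary f i 0 t = vert (gen f (ver f i.1 i.2)) := by
  have h : midWeight i.2 0 t = 0 := by simp [midWeight]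
  ext V
  simp [bary, comb, h]

theorem bary_right (f : ℤ → Letter) (i : ℤ × ℤ) (t : ℝ) :
    bary f i 1 t = vert (gen f (ver f i.1 (i.2 + 1))) := by
  have h : midWeight i.2 1 t = 0 := by simp [midWeight]; norm_num
  ext V
  simp [bary, comb, h]

end PTB

namespace PTB

open unitInterval

/-! ### Barycentric coordinates and points of the plane -/

section Levels

variable {f : ℤ → Letter}

theorem bary_of_zero {i : ℤ × ℤ} {s t : ℝ} (h : midWeight i.2 s t = 0) :
    bary f i s t = seg (gen f (ver f i.1 i.2)) (gen f (ver f i.1 (i.2 + 1))) s := by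
  ext V
  simp [bary, comb, seg, h]

/-- With the greatest possible middle weight, the side of the square is spread at double speed over
the two edges through the middle vertex. This matches the side of a region that consists of two
horizontal unit edges. -/
theorem bary_of_full {i : ℤ × ℤ} {s t : ℝ} (h : midWeight i.2 s t = 1 - |2 * s - 1|) :
    (s ≤ 1 / 2 ∧ bary f i s t =
      seg (gen f (ver f i.1 i.2)) (gen f (mid f i.1 i.2)) (2 * s)) ∨
    (1 / 2 ≤ s ∧ bary f i s t =
      seg (gen f (mid f i.1 i.2)) (gen f (ver f i.1 (i.2 + 1))) (2 * s - 1)) := by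
  rcases abs_cases_half s with ⟨h1, e⟩ | ⟨h1, e⟩
  · refine Or.inl ⟨h1, ?_⟩
    ext V
    rw [e] at h
    simp only [bary, comb, seg, h]
    ring
  · refine Or.inr ⟨h1, ?_⟩
    ext V
    rw [e] at h
    simp only [bary, comb, seg, h]
    ring

/-- On the integral levels the barycentric coordinates are those of the horizontal edges. -/
theorem exists_level (hf : Recurrent f) (z : (ℤ × ℤ) × (I × I))
    (ht : (z.2.2 : ℝ) = 0 ∨ (z.2.2 : ℝ) = 1) :
    ∃ (j N : ℤ) (u : ℝ), 0 ≤ u ∧ u ≤ 1 ∧ strip (slant f) z = (j + u, (N : ℝ)) ∧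
      bary f z.1 z.2.1 z.2.2 = seg (Q f j N) (Q f (j + 1) N) u := by
  obtain ⟨⟨n, k⟩, ⟨s, hs0, hs1⟩, ⟨t, ht0, ht1⟩⟩ := z
  simp only at ht
  simp only [strip]
  have a1 : ∀ a : ℤ, 3 * a + 1 + 1 = 3 * a + 2 := fun a => by ring
  have a2 : ∀ a : ℤ, 3 * a + 2 + 1 = 3 * a + 3 := fun a => by ring
  have a3 : ∀ a : ℤ, 3 * a + 3 + 1 = 3 * a + 4 := fun a => by ring
  obtain ⟨m, rfl | rfl⟩ := even_or_odd_cases k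
  · rcases ht with rfl | rfl
    · have hb := bary_of_zero (f := f) (i := (n, 2 * m)) (s := s) (t := 0) (by
        simp [midWeight_even])
      rw [ver_even, ver_odd] at hb
      rcases slant_cases hf n with ⟨-, e1, e2, -, k0, k1, -⟩ | ⟨-, e1, e2, -, k0, k1, -⟩
      · refine ⟨3 * m, n, s, hs0, hs1, ?_, ?_⟩
        · rw [k0, k1]; push_cast; ext <;> simp only <;> ring
        · rw [hb, Q_eq_gen hf, Q_eq_gen hf, lat_zero, lat_one, e1, e2]
      · refine ⟨3 * m + 1, n, s, hs0, hs1, ?_, ?_⟩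
        · rw [k0, k1]; push_cast; ext <;> simp only <;> ring
        · rw [hb, a1, Q_eq_gen hf, Q_eq_gen hf, lat_one, lat_two, e1, e2]
    · have hp : slant f n (2 * m) 1 = 3 * m ∧ slant f n (2 * m + 1) 1 = 3 * m + 2 := by
        rcases slant_cases hf n with ⟨-, -, -, -, k0, k1, -⟩ | ⟨-, -, -, -, k0, k1, -⟩ <;>
        rw [k0, k1] <;> constructor <;> ring
      rcases bary_of_full (f := f) (i := (n, 2 * m)) (s := s) (t := 1) (by
        simp [midWeight_even]) with ⟨h, hb⟩ | ⟨h, hb⟩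
      · refine ⟨3 * m, n + 1, 2 * s, by linarith, by linarith, ?_, ?_⟩
        · rw [hp.1, hp.2]; push_cast; ext <;> simp only; ring
        · rw [hb, Q_eq_gen hf, Q_eq_gen hf, lat_zero, lat_one, ver_even, mid_even]
      · refine ⟨3 * m + 1, n + 1, 2 * s - 1, by linarith, by linarith, ?_, ?_⟩
        · rw [hp.1, hp.2]; push_cast; ext <;> simp only; ring
        · rw [hb, a1, Q_eq_gen hf, Q_eq_gen hf, lat_one, lat_two, ver_odd, mid_even]
  · rcases ht with rfl | rfl
    · have hb := bary_of_full (f := f) (i := (n, 2 * m + 1)) (s := s) (t := 0) (by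
        simp [midWeight_odd])
      rw [ver_odd, ver_even'] at hb
      rcases slant_cases hf n with ⟨-, e1, e2, e, -, k0, k1⟩ | ⟨-, e1, e2, e, -, k0, k1⟩ <;>
      rcases hb with ⟨h, hb⟩ | ⟨h, hb⟩
      · refine ⟨3 * m + 1, n, 2 * s, by linarith, by linarith, ?_, ?_⟩
        · rw [k0, k1]; push_cast; ext <;> simp only <;> ring
        · rw [hb, a1, Q_eq_gen hf, Q_eq_gen hf, lat_one, lat_two, e, e1]
      · refine ⟨3 * m + 2, n, 2 * s - 1, by linarith, by linarith, ?_, ?_⟩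
        · rw [k0, k1]; push_cast; ext <;> simp only <;> ring
        · rw [hb, a2, Q_eq_gen hf, Q_eq_gen hf, lat_two, lat_three, e, e2]
      · refine ⟨3 * m + 2, n, 2 * s, by linarith, by linarith, ?_, ?_⟩
        · rw [k0, k1]; push_cast; ext <;> simp only <;> ring
        · rw [hb, a2, Q_eq_gen hf, Q_eq_gen hf, lat_two, lat_three, e, e2]
      · refine ⟨3 * m + 3, n, 2 * s - 1, by linarith, by linarith, ?_, ?_⟩
        · rw [k0, k1]; push_cast; ext <;> simp only <;> ring
        · rw [hb, a3, Q_eq_gen hf, Q_eq_gen hf, lat_three, lat_four, e, e1]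
    · have hb := bary_of_zero (f := f) (i := (n, 2 * m + 1)) (s := s) (t := 1) (by
        simp [midWeight_odd])
      have hp : slant f n (2 * m + 1) 1 = 3 * m + 2 ∧
          slant f n (2 * m + 1 + 1) 1 = 3 * m + 3 := by
        rcases slant_cases hf n with ⟨-, -, -, -, -, k0, k1⟩ | ⟨-, -, -, -, -, k0, k1⟩ <;>
        rw [k0, k1] <;> constructor <;> ring
      refine ⟨3 * m + 2, n + 1, s, hs0, hs1, ?_, ?_⟩
      · rw [hp.1, hp.2]; push_cast; ext <;> simp only; ring
      · rw [hb, ver_odd, ver_even', a2, Q_eq_gen hf, Q_eq_gen hf, lat_two, lat_three]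

theorem seg_eq_of_add_eq {j j' N : ℤ} {u u' : ℝ} (h0 : 0 ≤ u) (h1 : u ≤ 1) (h0' : 0 ≤ u')
    (h1' : u' ≤ 1) (h : (j : ℝ) + u = j' + u') :
    seg (Q f j N) (Q f (j + 1) N) u = seg (Q f j' N) (Q f (j' + 1) N) u' := by
  have k1 : (j : ℝ) ≤ j' + 1 := by linarith
  have k2 : (j' : ℝ) ≤ j + 1 := by linarith
  have k3 : j ≤ j' + 1 := by exact_mod_cast k1
  have k4 : j' ≤ j + 1 := by exact_mod_cast k2
  rcases (by omega : j = j' ∨ j' = j + 1 ∨ j = j' + 1) with rfl | rfl | rfl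
  · rw [add_left_cancel h]
  · push_cast at h
    obtain rfl : u = 1 := by linarith
    obtain rfl : u' = 0 := by linarith
    rw [seg_one, seg_zero]
  · push_cast at h
    obtain rfl : u = 0 := by linarith
    obtain rfl : u' = 1 := by linarith
    rw [seg_one, seg_zero]

theorem param_of_level {E : ℤ → ℤ → ℝ → ℝ} {z : (ℤ × ℤ) × (I × I)} {N : ℤ}
    (h : (strip E z).2 = N) : (z.2.2 : ℝ) = 0 ∨ (z.2.2 : ℝ) = 1 := by
  obtain ⟨⟨n, k⟩, s, ⟨t, h0, h1⟩⟩ := z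
  simp only [strip] at h ⊢
  by_contra hn
  push Not at hn
  obtain ⟨-, h⟩ := IsKnots.level_eq (n' := N) (t' := 0) (lt_of_le_of_ne h0 hn.1.symm)
    (lt_of_le_of_ne h1 hn.2) le_rfl zero_le_one (by simpa using h)
  exact hn.1 h

theorem bary_of_level (hf : Recurrent f) {z : (ℤ × ℤ) × (I × I)} {j N : ℤ} {u : ℝ} (h0 : 0 ≤ u)
    (h1 : u ≤ 1) (h : strip (slant f) z = (j + u, (N : ℝ))) :
    bary f z.1 z.2.1 z.2.2 = seg (Q f j N) (Q f (j + 1) N) u := by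
  obtain ⟨j', N', u', h0', h1', h', hb⟩ := exists_level hf z
    (param_of_level (N := N) (congrArg Prod.snd h))
  rw [h] at h'
  simp only [Prod.mk.injEq, Int.cast_inj] at h'
  obtain ⟨e, rfl⟩ := h'
  rw [hb]
  exact seg_eq_of_add_eq h0' h1' h0 h1 e.symm

/-- On integral levels both sides depend only on the position along the horizontal edges; inside a
strip, squares meet only in their sides, where the coordinates are those of a common vertex. -/
theorem bary_eq_of_strip_eq (hf : Recurrent f) {z z' : (ℤ × ℤ) × (I × I)}
    (h : strip (slant f) z = strip (slant f) z') :
    bary f z.1 z.2.1 z.2.2 = bary f z'.1 z'.2.1 z'.2.2 := by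
  by_cases ht : (z.2.2 : ℝ) = 0 ∨ (z.2.2 : ℝ) = 1
  · obtain ⟨j, N, u, h0, h1, e, hb⟩ := exists_level hf z ht
    rw [hb, bary_of_level hf h0 h1 (h.symm.trans e)]
  · push Not at ht
    rw [(isKnots_slant f).strip_eq_iff (lt_of_le_of_ne z.2.2.2.1 ht.1.symm)
      (lt_of_le_of_ne z.2.2.2.2 ht.2)] at h
    obtain ⟨⟨n, k⟩, s, t⟩ := z
    obtain ⟨⟨n', k'⟩, s', t'⟩ := z'
    simp only [IsKnots.SamePoint] at h
    obtain ⟨rfl, rfl, ⟨rfl, rfl⟩ | ⟨rfl, rfl, rfl⟩ | ⟨rfl, rfl, rfl⟩⟩ := h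
    · rfl
    · simp only [Set.Icc.coe_one, Set.Icc.coe_zero]
      rw [bary_left, bary_right]
    · simp only [Set.Icc.coe_one, Set.Icc.coe_zero]
      rw [bary_left, bary_right]

/-- Points of the plane lie over vertices, edges or faces. -/
theorem strip_cases (hf : Recurrent f) (z : (ℤ × ℤ) × (I × I)) :
    (∃ v, bary f z.1 z.2.1 z.2.2 = vert (gen f v) ∧
      Collapse.mk (slanted f) (strip (slant f) z) =
        Collapse.mk (slanted f) (pt (3 * v.1 + 1) v.2)) ∨
    (∃ (j N : ℤ) (u : ℝ), 0 < u ∧ u < 1 ∧ strip (slant f) z = (j + u, (N : ℝ)) ∧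
      bary f z.1 z.2.1 z.2.2 = seg (Q f j N) (Q f (j + 1) N) u) ∨
    (0 < (z.2.1 : ℝ) ∧ (z.2.1 : ℝ) < 1 ∧ 0 < (z.2.2 : ℝ) ∧ (z.2.2 : ℝ) < 1) := by
  by_cases ht : (z.2.2 : ℝ) = 0 ∨ (z.2.2 : ℝ) = 1
  · obtain ⟨j, N, u, h0, h1, e, hb⟩ := exists_level hf z ht
    rcases h0.eq_or_lt with rfl | h0
    · left
      refine ⟨lat f j N, ?_, ?_⟩
      · rw [hb, seg_zero, Q_eq_gen hf]
      · rw [e, ← mk_pt_eq hf, pt, add_zero]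
    · rcases h1.eq_or_lt with rfl | h1
      · left
        refine ⟨lat f (j + 1) N, ?_, ?_⟩
        · rw [hb, seg_one, Q_eq_gen hf]
        · rw [e, ← mk_pt_eq hf, pt]; push_cast; rfl
      · exact Or.inr (Or.inl ⟨j, N, u, h0, h1, e, hb⟩)
  · push Not at ht
    have t0 := lt_of_le_of_ne z.2.2.2.1 ht.1.symm
    have t1 := lt_of_le_of_ne z.2.2.2.2 ht.2
    obtain ⟨⟨n, k⟩, s, t⟩ := z
    simp only at t0 t1 ⊢
    rcases s.2.1.eq_or_lt with h | h
    · left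
      refine ⟨ver f n k, ?_, ?_⟩
      · rw [← h, bary_left]
      · rw [← mk_slant hf n k t0.le t1.le]
        simp [strip, ← h]
    · rcases s.2.2.eq_or_lt with h' | h'
      · left
        refine ⟨ver f n (k + 1), ?_, ?_⟩
        · rw [h', bary_right]
        · rw [← mk_slant hf n (k + 1) t0.le t1.le]
          simp [strip, h']
      · exact Or.inr (Or.inr ⟨h, h', t0, t1⟩)

end Levels

end PTB

namespace PTB

open unitInterval

/-! ### The isomorphism onto `Δ*(φ)` -/

section Star

variable {f : ℤ → Letter} {K : PreAbstractSimplicialComplex Orb}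

open Classical in
/-- The vertices of a face. -/
noncomputable def triangle (f : ℤ → Letter) (i : ℤ × ℤ) : Finset Orb :=
  {gen f (ver f i.1 i.2), gen f (mid f i.1 i.2), gen f (ver f i.1 (i.2 + 1))}

theorem mem_triangle {i : ℤ × ℤ} {V : Orb} : V ∈ triangle f i ↔
    V = gen f (ver f i.1 i.2) ∨ V = gen f (mid f i.1 i.2) ∨ V = gen f (ver f i.1 (i.2 + 1)) := by
  simp [triangle]

open Classical in
/-- The simplicial complex with the simplices of `Δ*(φ)`. -/
def IsStar (f : ℤ → Letter) (K : PreAbstractSimplicialComplex Orb) : Prop :=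
  ∀ s : Finset Orb, s ∈ K.faces ↔ (∃ v, s = {gen f v}) ∨
    (∃ j n, s = {Q f j n, Q f (j + 1) n}) ∨ ∃ i, s = triangle f i

theorem gen_distinct (hf : Recurrent f) (i : ℤ × ℤ) :
    gen f (ver f i.1 i.2) ≠ gen f (mid f i.1 i.2) ∧
    gen f (mid f i.1 i.2) ≠ gen f (ver f i.1 (i.2 + 1)) ∧
    gen f (ver f i.1 i.2) ≠ gen f (ver f i.1 (i.2 + 1)) := by
  obtain ⟨a, b, c⟩ := ver_mid_distinct hf i.1 i.2
  exact ⟨(gen_injective f).ne a, (gen_injective f).ne b, (gen_injective f).ne c⟩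

theorem Q_succ_ne (hf : Recurrent f) (j n : ℤ) : Q f j n ≠ Q f (j + 1) n := fun h =>
  lat_ne_succ hf j n ((Q_eq_iff hf).1 h)

theorem card_triangle (hf : Recurrent f) (i : ℤ × ℤ) : (triangle f i).card = 3 := by
  classical
  obtain ⟨a, b, c⟩ := gen_distinct hf i
  exact Finset.card_eq_three.2 ⟨_, _, _, a, c, b, rfl⟩

theorem IsStar.triangle_mem (hK : IsStar f K) (i : ℤ × ℤ) : triangle f i ∈ K.faces :=
  (hK _).2 (Or.inr (Or.inr ⟨i, rfl⟩))

/-- Every simplex lies in a triangle, so that the triangles alone determine the topology of the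
realization. -/
theorem IsStar.subset_triangle (hf : Recurrent f) (hK : IsStar f K) {s : Finset Orb}
    (hs : s ∈ K.faces) : ∃ i, s ⊆ triangle f i := by
  classical
  rcases (hK s).1 hs with ⟨⟨m, n⟩, rfl⟩ | ⟨j, n, rfl⟩ | ⟨i, rfl⟩
  · refine ⟨(n - 1, 2 * m), fun V hV => ?_⟩
    rw [Finset.mem_singleton] at hV
    rw [mem_triangle, mid_even, sub_add_cancel]
    exact Or.inr (Or.inl hV)
  · obtain ⟨m, rfl | rfl | rfl⟩ := mod_three_cases j
    · refine ⟨(n - 1, 2 * m), fun V hV => ?_⟩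
      rw [Finset.mem_insert, Finset.mem_singleton, Q_eq_gen hf, Q_eq_gen hf, lat_zero,
        lat_one] at hV
      rw [mem_triangle, ver_even, mid_even, sub_add_cancel]
      tauto
    · refine ⟨(n - 1, 2 * m), fun V hV => ?_⟩
      rw [Finset.mem_insert, Finset.mem_singleton, show 3 * m + 1 + 1 = 3 * m + 2 by ring,
        Q_eq_gen hf, Q_eq_gen hf, lat_one, lat_two] at hV
      rw [mem_triangle, mid_even, ver_odd, sub_add_cancel]
      tauto
    · refine ⟨(n - 1, 2 * m + 1), fun V hV => ?_⟩
      rw [Finset.mem_insert, Finset.mem_singleton, show 3 * m + 2 + 1 = 3 * m + 3 by ring,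
        Q_eq_gen hf, Q_eq_gen hf, lat_two, lat_three] at hV
      rw [mem_triangle, ver_odd, ver_even', sub_add_cancel]
      tauto
  · exact ⟨i, Finset.Subset.refl _⟩

/-- The characteristic map of a face, into the closed simplex. -/
noncomputable def baryPoint (hf : Recurrent f) (i : ℤ × ℤ) (x : I × I) :
    ClosedSimplex (triangle f i) :=
  ⟨bary f i x.1 x.2, by
    obtain ⟨h1, h2, h3⟩ := weights_nonneg i.2 x.1.2.1 x.1.2.2 x.2.2.1 x.2.2.2
    obtain ⟨a, b, c⟩ := gen_distinct hf i
    refine ⟨comb_nonneg h2 h1 h3, fun V hV => ?_, ?_⟩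
    · rw [mem_triangle] at hV
      push Not at hV
      exact comb_other hV.1 hV.2.1 hV.2.2
    · classical
      rw [triangle, Finset.sum_insert (by simp [a, c]), Finset.sum_pair b, bary, comb_fst a c,
        comb_snd a b, comb_thd c b]
      ring⟩

theorem continuous_baryPoint (hf : Recurrent f) (i : ℤ × ℤ) : Continuous (baryPoint hf i) := by
  refine Continuous.subtype_mk (continuous_pi fun V => ?_) _
  rcases midWeight_eq i.2 with h | h <;> simp only [bary, comb, h] <;> fun_prop

theorem surjective_baryPoint (hf : Recurrent f) (i : ℤ × ℤ) :
    Function.Surjective (baryPoint hf i) := by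
  classical
  rintro ⟨w, h0, h1, h2⟩
  obtain ⟨a, b, c⟩ := gen_distinct hf i
  rw [triangle, Finset.sum_insert (by simp [a, c]), Finset.sum_pair b, ← add_assoc] at h2
  obtain ⟨s, t, hs0, hs1, ht0, ht1, e1, e2, e3⟩ := exists_weights i.2 (h0 _) (h0 _) (h0 _) h2
  refine ⟨(⟨s, hs0, hs1⟩, ⟨t, ht0, ht1⟩), Subtype.ext (funext fun V => ?_)⟩
  change bary f i s t V = w V
  rw [bary, e2, e3, e1]
  by_cases hV : V ∈ triangle f i
  · rcases mem_triangle.1 hV with rfl | rfl | rfl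
    · exact comb_fst a c
    · exact comb_snd a b
    · exact comb_thd c b
  · rw [h1 V hV]
    rw [mem_triangle] at hV
    push Not at hV
    exact comb_other hV.1 hV.2.1 hV.2.2

/-- The map from the parameter space to the realization. -/
noncomputable def charMap (hf : Recurrent f) (hK : IsStar f K) (z : (ℤ × ℤ) × (I × I)) :
    Realization K :=
  ClosedSimplex.incl ⟨triangle f z.1, hK.triangle_mem z.1⟩ (baryPoint hf z.1 z.2)

theorem charMap_val (hf : Recurrent f) (hK : IsStar f K) (z : (ℤ × ℤ) × (I × I)) :
    (charMap hf hK z).1 = bary f z.1 z.2.1 z.2.2 := rfl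

theorem isQuotientMap_charMap (hf : Recurrent f) (hK : IsStar f K) :
    IsQuotientMap (charMap hf hK) :=
  isQuotientMap_realization (fun i => ⟨triangle f i, hK.triangle_mem i⟩) (baryPoint hf)
    (continuous_baryPoint hf) (surjective_baryPoint hf) fun s => hK.subset_triangle hf s.2

theorem bary_ne_zero_iff {i : ℤ × ℤ} {s t : ℝ} (hs0 : 0 < s) (hs1 : s < 1) (ht0 : 0 < t)
    (ht1 : t < 1) (V : Orb) : bary f i s t V ≠ 0 ↔ V ∈ triangle f i := by
  obtain ⟨h1, h2, h3⟩ := weights_pos i.2 hs0 hs1 ht0 ht1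
  rw [bary, comb_ne_zero_iff h2 h1 h3, mem_triangle]

open Classical in
theorem seg_mem_iff {X Y : Orb} {u : ℝ} (h0 : 0 < u) (h1 : u < 1) (V : Orb) :
    seg X Y u V ≠ 0 ↔ V ∈ ({X, Y} : Finset Orb) := by
  rw [seg_ne_zero_iff h0 h1, Finset.mem_insert, Finset.mem_singleton]

theorem vert_mem_iff {X : Orb} (V : Orb) : vert X V ≠ 0 ↔ V ∈ ({X} : Finset Orb) := by
  rw [vert_ne_zero_iff, Finset.mem_singleton]

theorem support_unique {w : Orb → ℝ} {s t : Finset Orb} (hs : ∀ V, w V ≠ 0 ↔ V ∈ s)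
    (ht : ∀ V, w V ≠ 0 ↔ V ∈ t) : s = t :=
  Finset.ext fun V => (hs V).symm.trans (ht V)

theorem triangle_injective (hf : Recurrent f) : Function.Injective (triangle f) := by
  rintro ⟨n, k⟩ ⟨n', k'⟩ h
  obtain ⟨rfl, rfl⟩ := face_unique hf (n := n) (k := k) (n' := n') (k' := k') (by
    apply Set.image_injective.2 (gen_injective f)
    simp only [Set.image_insert_eq, Set.image_singleton]
    ext V
    have := Finset.ext_iff.1 h V
    simpa [mem_triangle] using this)
  rfl

open Classical in
theorem card_pair (hf : Recurrent f) (j n : ℤ) :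
    ({Q f j n, Q f (j + 1) n} : Finset Orb).card = 2 :=
  Finset.card_pair (Q_succ_ne hf j n)

open Classical in
theorem pair_injective (hf : Recurrent f) {j n j' n' : ℤ}
    (h : ({Q f j n, Q f (j + 1) n} : Finset Orb) = {Q f j' n', Q f (j' + 1) n'}) :
    j = j' ∧ n = n' := by
  apply lat_edge_unique hf
  simp only [Q_eq_gen hf] at h
  have h1 : gen f (lat f j n) ∈
      ({gen f (lat f j' n'), gen f (lat f (j' + 1) n')} : Finset Orb) := by rw [← h]; simp
  have h2 : gen f (lat f (j + 1) n) ∈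
      ({gen f (lat f j' n'), gen f (lat f (j' + 1) n')} : Finset Orb) := by rw [← h]; simp
  have h3 := lat_ne_succ hf j n
  simp only [Finset.mem_insert, Finset.mem_singleton, (gen_injective f).eq_iff] at h1 h2
  rcases h1 with h1 | h1 <;> rcases h2 with h2 | h2
  · exact absurd (h1.trans h2.symm) h3
  · exact Or.inl ⟨h1, h2⟩
  · exact Or.inr ⟨h1, h2⟩
  · exact absurd (h1.trans h2.symm) h3

/-- The support of the coordinates has one, two or three elements according to whether the point
lies over a vertex, an edge or a face. The support identifies this simplex, and the weights then
identify the point. -/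
theorem mk_strip_eq_of_bary_eq (hf : Recurrent f) {z z' : (ℤ × ℤ) × (I × I)}
    (h : bary f z.1 z.2.1 z.2.2 = bary f z'.1 z'.2.1 z'.2.2) :
    Collapse.mk (slanted f) (strip (slant f) z) = Collapse.mk (slanted f) (strip (slant f) z') := by
  classical
  have hcard : ∀ {s t : Finset Orb}, s.card ≠ t.card →
      (∀ V, bary f z.1 z.2.1 z.2.2 V ≠ 0 ↔ V ∈ s) →
      ¬ ∀ V, bary f z'.1 z'.2.1 z'.2.2 V ≠ 0 ↔ V ∈ t := by
    intro s t hne h1 h2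
    rw [h] at h1
    exact hne (congrArg _ (support_unique h1 h2))
  rcases strip_cases hf z with ⟨v, b, e⟩ | ⟨j, N, u, u0, u1, e, b⟩ | ⟨s0, s1, t0, t1⟩ <;>
  rcases strip_cases hf z' with ⟨v', b', e'⟩ | ⟨j', N', u', u0', u1', e', b'⟩ |
    ⟨s0', s1', t0', t1'⟩
  · rw [b, b', vert_injective.eq_iff, (gen_injective f).eq_iff] at h
    rw [e, e', h]
  · exact absurd (by rw [b']; exact seg_mem_iff u0' u1') (hcard (s := {gen f v})
      (by rw [card_pair hf]; simp) (by rw [b]; exact vert_mem_iff))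
  · exact absurd (bary_ne_zero_iff s0' s1' t0' t1') (hcard (s := {gen f v})
      (by rw [card_triangle hf]; simp) (by rw [b]; exact vert_mem_iff))
  · exact absurd (by rw [b']; exact vert_mem_iff)
      (hcard (s := {Q f j N, Q f (j + 1) N}) (t := {gen f v'})
      (by rw [card_pair hf]; simp) (by rw [b]; exact seg_mem_iff u0 u1))
  · have hs : ({Q f j N, Q f (j + 1) N} : Finset Orb) = {Q f j' N', Q f (j' + 1) N'} := by
      refine support_unique (w := bary f z.1 z.2.1 z.2.2) ?_ ?_
      · rw [b]; exact seg_mem_iff u0 u1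
      · rw [h, b']; exact seg_mem_iff u0' u1'
    obtain ⟨rfl, rfl⟩ := pair_injective hf hs
    have hu : u = u' := by
      have := congrFun (b.symm.trans (h.trans b')) (Q f (j + 1) N)
      simpa [seg, vert_self, vert_of_ne (Q_succ_ne hf j N).symm] using this
    rw [e, e', hu]
  · exact absurd (bary_ne_zero_iff s0' s1' t0' t1') (hcard (s := {Q f j N, Q f (j + 1) N})
      (by rw [card_triangle hf, card_pair hf]; simp) (by rw [b]; exact seg_mem_iff u0 u1))
  · exact absurd (by rw [b']; exact vert_mem_iff) (hcard (t := {gen f v'})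
      (by rw [card_triangle hf]; simp) (bary_ne_zero_iff s0 s1 t0 t1))
  · exact absurd (by rw [b']; exact seg_mem_iff u0' u1') (hcard
      (by rw [card_triangle hf, card_pair hf]; simp) (bary_ne_zero_iff s0 s1 t0 t1))
  · obtain ⟨i, s, t⟩ := z
    obtain ⟨i', s', t'⟩ := z'
    simp only at h s0 s1 t0 t1 s0' s1' t0' t1'
    obtain rfl : i = i' := triangle_injective hf (support_unique
      (bary_ne_zero_iff s0 s1 t0 t1) (by rw [h]; exact bary_ne_zero_iff s0' s1' t0' t1'))
    obtain ⟨a, b, c⟩ := gen_distinct hf i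
    have h1 := congrFun h (gen f (mid f i.1 i.2))
    have h2 := congrFun h (gen f (ver f i.1 (i.2 + 1)))
    rw [bary, bary, comb_snd a b, comb_snd a b] at h1
    rw [bary, bary, comb_thd c b, comb_thd c b] at h2
    obtain ⟨e1, e2⟩ := weights_injective i.2 s0 s1 h1 h2
    rw [Subtype.ext e1, Subtype.ext e2]

/-- Coordinates depend only on the image under `strip`, so they define a function on the plane
through any section `r`. It is constant on each closed slanted edge and hence descends to the
collapse. -/
theorem bary_eq_of_mk_strip_eq (hf : Recurrent f) {z z' : (ℤ × ℤ) × (I × I)}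
    (h : Collapse.mk (slanted f) (strip (slant f) z) =
      Collapse.mk (slanted f) (strip (slant f) z')) :
    bary f z.1 z.2.1 z.2.2 = bary f z'.1 z'.2.1 z'.2.2 := by
  have hs := (isKnots_slant f).surjective_strip
  set r := Function.surjInv hs
  have hr : ∀ z, strip (slant f) (r (strip (slant f) z)) = strip (slant f) z := fun z =>
    Function.surjInv_eq hs _
  have key := Collapse.apply_eq_of_mk_eq
    (u := fun x => bary f (r x).1 (r x).2.1 (r x).2.2) (S := slanted f) ?_ h
  · rwa [bary_eq_of_strip_eq hf (hr z), bary_eq_of_strip_eq hf (hr z')] at key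
  · rw [slanted_eq_slant]
    have : ∀ n k, ∀ x ∈ closure (openKnot (slant f) n k),
        bary f (r x).1 (r x).2.1 (r x).2.2 = vert (gen f (ver f n k)) := by
      intro n k x hx
      obtain ⟨t, t0, t1, rfl⟩ := mem_closure_slant.1 hx
      rw [← bary_left f (n, k) t]
      have e : strip (slant f) ((n, k), ((0 : I), (⟨t, t0, t1⟩ : I))) =
          (slant f n k t, (n : ℝ) + t) := by simp [strip]
      rw [← e]
      exact bary_eq_of_strip_eq hf (hr _)
    rintro _ ⟨n, k, rfl⟩ x hx y hy
    rw [this n k x hx, this n k y hy]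

theorem exists_star_homeomorph (hf : Recurrent f) (hK : IsStar f K) :
    ∃ h : Collapse (slanted f) ≃ₜ Realization K, ∀ z : (ℤ × ℤ) × (I × I),
      h (Collapse.mk (slanted f) (strip (slant f) z)) = charMap hf hK z :=
  exists_homeomorph_of_isQuotientMap
    (p := fun z => Collapse.mk (slanted f) (strip (slant f) z))
    ((isQuotientMap_mk _).comp (isKnots_slant f).isQuotientMap_strip)
    (isQuotientMap_charMap hf hK) fun _ _ =>
    ⟨fun h => Subtype.ext (bary_eq_of_mk_strip_eq hf h),
      fun h => mk_strip_eq_of_bary_eq hf (congrArg Subtype.val h)⟩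

end Star

end PTB

namespace PTB

/-! ### The cells of `Δ*(φ)` and of `CWΔ(φ)` -/

open Classical in
/-- The complex `Δ*(φ)` has the expected simplices. -/
theorem isStar_DeltaStar {f : ℤ → Letter} (hf : Recurrent f)
    {σ : ℤ → Set (OnePoint ℚ)} (hσ : ∀ n, σ n = tri f n)
    (hF : ∀ n, IsFareyTriangle (σ n)) : IsStar f (DeltaStar σ) := by
  intro s
  change ((∃ X, IsDeltaVertex σ X ∧ s = {X}) ∨ (∃ X Y, IsDeltaEdge σ X Y ∧ s = {X, Y}) ∨
    ∃ X Y Z, IsDeltaFace σ X Y Z ∧ s = {X, Y, Z}) ↔ _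
  simp only [isDeltaVertex_iff hσ hF, isDeltaEdge_iff hσ hF, isDeltaFace_iff hσ hF,
    gen_face_iff hf]
  refine or_congr ⟨?_, ?_⟩ (or_congr ⟨?_, ?_⟩ ⟨?_, ?_⟩)
  · rintro ⟨_, ⟨m, n, rfl⟩, rfl⟩
    exact ⟨lat f m n, by rw [Q_eq_gen hf]⟩
  · rintro ⟨v, rfl⟩
    exact ⟨_, ⟨_, _, rfl⟩, rfl⟩
  · rintro ⟨_, _, ⟨m, n, rfl, rfl⟩, rfl⟩
    exact ⟨m, n, rfl⟩
  · rintro ⟨m, n, rfl⟩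
    exact ⟨_, _, ⟨m, n, rfl, rfl⟩, rfl⟩
  · rintro ⟨_, _, _, ⟨n, k, rfl, rfl, rfl⟩, rfl⟩
    exact ⟨(n, k), rfl⟩
  · rintro ⟨⟨n, k⟩, rfl⟩
    exact ⟨_, _, _, ⟨n, k, rfl, rfl, rfl⟩, rfl⟩

open unitInterval

section Cells

variable {f : ℤ → Letter}

theorem level_of_mem_horizontal {e : Set (ℝ × ℝ)} (he : e ∈ horizontal) {x : ℝ × ℝ} (hx : x ∈ e) :
    ∃ (j n : ℤ) (u : ℝ), 0 < u ∧ u < 1 ∧ x = (j + u, (n : ℝ)) ∧ e = edge j n (j + 1) n := by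
  obtain ⟨j, n, rfl⟩ := he
  obtain ⟨u, h0, h1, rfl⟩ := mem_edge.1 hx
  exact ⟨j, n, u, h0, h1, by push_cast; ext <;> simp, rfl⟩

theorem mem_horizontal_edge {j n : ℤ} {u : ℝ} (h0 : 0 < u) (h1 : u < 1) :
    ((j + u, (n : ℝ)) : ℝ × ℝ) ∈ edge j n (j + 1) n :=
  mem_edge.2 ⟨u, h0, h1, by push_cast; ext <;> simp⟩

theorem openKnot_nonempty (E : ℤ → ℤ → ℝ → ℝ) (n k : ℤ) : (openKnot E n k).Nonempty :=
  ⟨_, 1 / 2, by norm_num, by norm_num, rfl⟩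

theorem knot_of_mem_vertical {e : Set (ℝ × ℝ)} (he : e ∈ vertical f) :
    ∃ n k, e = openKnot (knot f) n (2 * k + 1) := by
  rwa [vertical_eq] at he

theorem knot_of_mem_slanted {e : Set (ℝ × ℝ)} (he : e ∈ slanted f) :
    ∃ n k, e = openKnot (knot f) n (2 * k) := by
  rwa [slanted_eq] at he

theorem vertical_slanted_disjoint {e e' : Set (ℝ × ℝ)} (he : e ∈ vertical f)
    (he' : e' ∈ slanted f) {x : ℝ × ℝ} (hx : x ∈ e) : x ∉ e' := by
  obtain ⟨n, k, rfl⟩ := knot_of_mem_vertical he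
  obtain ⟨n', k', rfl⟩ := knot_of_mem_slanted he'
  intro hx'
  have := (isKnots_knot f).openKnot_disjoint hx hx'
  omega

theorem level_of_mem_vertical {e : Set (ℝ × ℝ)} (he : e ∈ vertical f ∪ slanted f) {x : ℝ × ℝ}
    (hx : x ∈ e) (m : ℤ) : x.2 ≠ m := by
  rcases he with he | he
  · obtain ⟨n, k, rfl⟩ := knot_of_mem_vertical he
    exact IsKnots.openKnot_not_level hx
  · obtain ⟨n, k, rfl⟩ := knot_of_mem_slanted he
    exact IsKnots.openKnot_not_level hx

theorem edge_nonempty {e : Set (ℝ × ℝ)} (he : e ∈ horizontal ∪ vertical f ∪ slanted f) :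
    e.Nonempty := by
  rcases he with (⟨m, n, rfl⟩ | he) | he
  · exact ⟨_, mem_horizontal_edge (u := 1 / 2) (by norm_num) (by norm_num)⟩
  · obtain ⟨n, k, rfl⟩ := knot_of_mem_vertical he
    exact openKnot_nonempty _ _ _
  · obtain ⟨n, k, rfl⟩ := knot_of_mem_slanted he
    exact openKnot_nonempty _ _ _

theorem horizontal_disjoint {e e' : Set (ℝ × ℝ)} (he : e ∈ horizontal)
    (he' : e' ∈ vertical f ∪ slanted f) {x : ℝ × ℝ} (hx : x ∈ e) : x ∉ e' := by
  obtain ⟨j, n, u, -, -, rfl, -⟩ := level_of_mem_horizontal he hx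
  exact fun h => level_of_mem_vertical he' h n rfl

theorem pt_not_mem_horizontal {e : Set (ℝ × ℝ)} (he : e ∈ horizontal) (m n : ℤ) :
    pt m n ∉ e := by
  intro hx
  obtain ⟨j, n', u, h0, h1, h, -⟩ := level_of_mem_horizontal he hx
  simp only [pt, Prod.mk.injEq] at h
  obtain ⟨-, h⟩ := IsKnots.level_eq (n := j) (n' := m) (t' := 0) h0 h1 le_rfl zero_le_one
    (by linarith [h.1])
  exact h0.ne' h

theorem level_cases {x : ℝ × ℝ} {n : ℤ} (h : x.2 = n) :
    (∃ m n, x = pt m n) ∨ ∃ e ∈ horizontal, x ∈ e := by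
  obtain ⟨x, y⟩ := x
  simp only at h
  subst h
  have hx := Int.floor_add_fract x
  rcases (Int.fract_nonneg x).eq_or_lt with h0 | h0
  · exact Or.inl ⟨⌊x⌋, n, by rw [pt, ← hx, ← h0]; simp⟩
  · refine Or.inr ⟨_, ⟨⌊x⌋, n, rfl⟩, ?_⟩
    have := mem_horizontal_edge (j := ⌊x⌋) (n := n) h0 (Int.fract_lt_one x)
    rwa [hx] at this

/-- The faces fill the complement of the `1`-skeleton. If the removed edges avoid all other cells,
faces and removed edges together fill the complement of what is left. -/
theorem removeEdges_planar_faces {V : Set (ℝ × ℝ)} {E S : Set (Set (ℝ × ℝ))}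
    (hV : ∀ s ∈ S, ∀ x ∈ s, x ∉ V) (hE : ∀ s ∈ S, ∀ e ∈ E, ∀ x ∈ s, x ∉ e) :
    ((planar V (E ∪ S)).removeEdges S).faces = components (V ∪ ⋃₀ E)ᶜ := by
  change components (⋃₀ components (V ∪ ⋃₀ (E ∪ S))ᶜ ∪ ⋃₀ S) = _
  rw [sUnion_components]
  congr 1
  ext x
  simp only [Set.mem_union, Set.mem_compl_iff, Set.mem_sUnion]
  constructor
  · rintro (h | ⟨s, hs, hx⟩)
    · rintro (h' | ⟨e, he, hx⟩)
      · exact h (Or.inl h')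
      · exact h (Or.inr ⟨e, Or.inl he, hx⟩)
    · rintro (h' | ⟨e, he, hx'⟩)
      · exact hV s hs x hx h'
      · exact hE s hs e he x hx hx'
  · intro h
    by_cases hS : ∃ s ∈ S, x ∈ s
    · exact Or.inr hS
    · left
      rintro (h' | ⟨e, he | he, hx⟩)
      · exact h (Or.inl h')
      · exact h (Or.inr ⟨e, he, hx⟩)
      · exact hS ⟨e, he, hx⟩

theorem DeltaStarStar_edges :
    (DeltaStarStar f).edges = Set.image (Collapse.mk (slanted f)) '' horizontal := by
  change Set.image (Collapse.mk (slanted f)) ''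
    (((horizontal ∪ vertical f ∪ slanted f) \ vertical f) \ slanted f) = _
  congr 1
  ext e
  constructor
  · rintro ⟨⟨(h | h) | h, h1⟩, h2⟩
    · exact h
    · exact absurd h h1
    · exact absurd h h2
  · intro h
    obtain ⟨x, hx⟩ := edge_nonempty (f := f) (Or.inl (Or.inl h))
    exact ⟨⟨Or.inl (Or.inl h), fun h' => horizontal_disjoint h (Or.inl h') hx hx⟩,
      fun h' => horizontal_disjoint h (Or.inr h') hx hx⟩

/-- Without the vertical edges, what remains off the vertices, horizontal edges and slanted edges is
the union of the open regions between successive slanted edges. -/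
theorem DeltaStarStar_faces : (DeltaStarStar f).faces =
    Set.image (Collapse.mk (slanted f)) '' {s | ∃ n k, s = openCell (slant f) n k} := by
  change Set.image (Collapse.mk (slanted f)) ''
    ((CWDelta f).removeEdges (vertical f)).faces = _
  congr 1
  rw [← (isKnots_slant f).components_openCell, CWDelta,
    show horizontal ∪ vertical f ∪ slanted f = (horizontal ∪ slanted f) ∪ vertical f from
      Set.union_right_comm _ _ _, removeEdges_planar_faces]
  · congr 1
    ext x
    simp only [Set.mem_compl_iff, Set.mem_union, Set.mem_ofPred_eq, Set.mem_sUnion]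
    constructor
    · intro h
      rcases (isKnots_slant f).cases_point x with ⟨n, hn⟩ | ⟨n, k, hx⟩ | ⟨n, k, hx⟩
      · rcases level_cases hn with h' | ⟨e, he, hx⟩
        · exact absurd (Or.inl h') h
        · exact absurd (Or.inr ⟨e, Or.inl he, hx⟩) h
      · refine absurd (Or.inr ⟨_, Or.inr ?_, hx⟩) h
        rw [slanted_eq_slant]
        exact ⟨n, k, rfl⟩
      · exact ⟨_, ⟨n, k, rfl⟩, hx⟩
    · rintro ⟨_, ⟨n, k, rfl⟩, hx⟩ (⟨m, n', rfl⟩ | ⟨e, he | he, hx'⟩)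
      · exact IsKnots.openCell_not_level hx (m := n') rfl
      · obtain ⟨j, n', u, -, -, rfl, -⟩ := level_of_mem_horizontal he hx'
        exact IsKnots.openCell_not_level hx (m := n') rfl
      · rw [slanted_eq_slant] at he
        obtain ⟨n', k', rfl⟩ := he
        exact (isKnots_slant f).not_mem_openKnot_of_mem_openCell hx hx'
  · rintro s hs x hx ⟨m, n, rfl⟩
    exact level_of_mem_vertical (Or.inl hs) hx n rfl
  · rintro s hs e (he | he) x hx hx'
    · exact horizontal_disjoint he (Or.inl hs) hx' hx
    · exact vertical_slanted_disjoint hs he hx hx'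

end Cells

section Iso

variable {f : ℤ → Letter} {K : PreAbstractSimplicialComplex Orb}

theorem exists_star_iso (hf : Recurrent f) (hK : IsStar f K) :
    ∃ h : CellIso (DeltaStarStar f) (simplicialCells K),
      (∀ m n : ℤ, (h.toHomeomorph (Collapse.mk (slanted f) (pt m n))).1 =
        Set.indicator {Q f m n} 1) ∧
      ∀ z : (ℤ × ℤ) × (I × I), h.toHomeomorph (Collapse.mk (slanted f) (strip (slant f) z)) =
        charMap hf hK z := by
  classical
  obtain ⟨h, hh⟩ := exists_star_homeomorph hf hK
  have hval : ∀ z : (ℤ × ℤ) × (I × I), (h (Collapse.mk (slanted f) (strip (slant f) z))).1 =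
      bary f z.1 z.2.1 z.2.2 := fun z => by rw [hh, charMap_val]
  have hsurj : ∀ y : Realization K, ∃ z : (ℤ × ℤ) × (I × I),
      h (Collapse.mk (slanted f) (strip (slant f) z)) = y := fun y => by
    obtain ⟨z, hz⟩ := (isQuotientMap_charMap hf hK).surjective y
    exact ⟨z, by rw [hh, hz]⟩
  have hpt : ∀ m n : ℤ, (h (Collapse.mk (slanted f) (pt m n))).1 = vert (Q f m n) := by
    intro m n
    obtain ⟨z, hz⟩ := (isKnots_slant f).surjective_strip (pt m n)
    rw [← hz, hval, bary_of_level hf (j := m) (N := n) le_rfl zero_le_one (by simp [hz, pt]),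
      seg_zero]
  -- An open simplex is the set of points with a given support, so it suffices to know which
  -- parameters have that support.
  have himage : ∀ (U : Set (ℝ × ℝ)) (s : Finset Orb),
      (∀ z : (ℤ × ℤ) × (I × I), strip (slant f) z ∈ U →
        ∀ V, bary f z.1 z.2.1 z.2.2 V ≠ 0 ↔ V ∈ s) →
      (∀ z : (ℤ × ℤ) × (I × I), (∀ V, bary f z.1 z.2.1 z.2.2 V ≠ 0 ↔ V ∈ s) →
        strip (slant f) z ∈ U) →
      h '' (Collapse.mk (slanted f) '' U) = openSimplex K s := by
    intro U s h1 h2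
    ext y
    obtain ⟨z, rfl⟩ := hsurj y
    constructor
    · rintro ⟨_, ⟨x, hx, rfl⟩, he⟩
      obtain ⟨z', rfl⟩ := (isKnots_slant f).surjective_strip x
      intro V
      rw [← he, hval]
      exact h1 z' hx V
    · intro hy
      refine ⟨_, ⟨_, h2 z fun V => ?_, rfl⟩, rfl⟩
      rw [← hval]
      exact hy V
  have hedge : ∀ j n, h '' (Collapse.mk (slanted f) '' edge j n (j + 1) n) =
      openSimplex K {Q f j n, Q f (j + 1) n} := by
    intro j n
    apply himage
    · intro z hz
      obtain ⟨u, h0, h1, e⟩ := mem_edge.1 hz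
      rw [bary_of_level hf (j := j) (N := n) h0.le h1.le
        (by rw [e]; push_cast; ext <;> simp)]
      exact seg_mem_iff h0 h1
    · intro z hz
      rcases strip_cases hf z with ⟨v, b, -⟩ | ⟨j', N, u, u0, u1, e, b⟩ | ⟨s0, s1, t0, t1⟩
      · rw [b] at hz
        have := congrArg Finset.card (support_unique hz vert_mem_iff)
        rw [card_pair hf] at this
        simp at this
      · rw [b] at hz
        obtain ⟨rfl, rfl⟩ := pair_injective hf (support_unique hz (seg_mem_iff u0 u1))
        rw [e]
        exact mem_horizontal_edge u0 u1
      · have := congrArg Finset.card (support_unique hz (bary_ne_zero_iff s0 s1 t0 t1))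
        rw [card_pair hf, card_triangle hf] at this
        simp at this
  have hface : ∀ n k, h '' (Collapse.mk (slanted f) '' openCell (slant f) n k) =
      openSimplex K (triangle f (n, k)) := by
    intro n k
    apply himage
    · intro z hz
      obtain ⟨z', e, hi, t0, t1, s0, s1⟩ := IsKnots.exists_of_mem_openCell hz
      rw [← bary_eq_of_strip_eq hf e, ← hi]
      exact bary_ne_zero_iff s0 s1 t0 t1
    · intro z hz
      rcases strip_cases hf z with ⟨v, b, -⟩ | ⟨j', N, u, u0, u1, e, b⟩ | ⟨s0, s1, t0, t1⟩
      · rw [b] at hz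
        have := congrArg Finset.card (support_unique hz vert_mem_iff)
        rw [card_triangle hf] at this
        simp at this
      · rw [b] at hz
        have := congrArg Finset.card (support_unique hz (seg_mem_iff u0 u1))
        rw [card_pair hf, card_triangle hf] at this
        simp at this
      · have := triangle_injective hf (support_unique hz (bary_ne_zero_iff s0 s1 t0 t1))
        have hmem := (isKnots_slant f).strip_mem_openCell t0 t1 s0 s1
        rwa [← this] at hmem
  refine ⟨⟨h, ?_, ?_, ?_⟩, hpt, hh⟩
  · change h '' (Collapse.mk (slanted f) '' {x | ∃ m n, x = pt m n}) =
      {x | ∃ s ∈ K.faces, s.card = 1 ∧ x ∈ openSimplex K s}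
    ext y
    constructor
    · rintro ⟨_, ⟨_, ⟨m, n, rfl⟩, rfl⟩, rfl⟩
      refine ⟨{Q f m n}, (hK _).2 (Or.inl ⟨lat f m n, by rw [Q_eq_gen hf]⟩), by simp, fun V => ?_⟩
      rw [hpt]
      exact vert_mem_iff V
    · rintro ⟨s, hs, hc, hy⟩
      obtain ⟨z, rfl⟩ := hsurj y
      have hy' : ∀ V, bary f z.1 z.2.1 z.2.2 V ≠ 0 ↔ V ∈ s := by rw [← hval]; exact hy
      rcases strip_cases hf z with ⟨v, -, e⟩ | ⟨j', N, u, u0, u1, -, b⟩ | ⟨s0, s1, t0, t1⟩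
      · exact ⟨_, ⟨_, ⟨_, _, rfl⟩, rfl⟩, congrArg h e.symm⟩
      · rw [b] at hy'
        have := congrArg Finset.card (support_unique hy' (seg_mem_iff u0 u1))
        rw [card_pair hf, hc] at this
        simp at this
      · have := congrArg Finset.card (support_unique hy' (bary_ne_zero_iff s0 s1 t0 t1))
        rw [card_triangle hf, hc] at this
        simp at this
  · rw [DeltaStarStar_edges, Set.image_image]
    ext e
    constructor
    · rintro ⟨_, ⟨m, n, rfl⟩, rfl⟩
      exact ⟨_, (hK _).2 (Or.inr (Or.inl ⟨m, n, rfl⟩)), card_pair hf m n, hedge m n⟩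
    · rintro ⟨s, hs, hc, rfl⟩
      rcases (hK s).1 hs with ⟨v, rfl⟩ | ⟨j, n, rfl⟩ | ⟨i, rfl⟩
      · simp at hc
      · exact ⟨_, ⟨j, n, rfl⟩, hedge j n⟩
      · rw [card_triangle hf] at hc; simp at hc
  · rw [DeltaStarStar_faces, Set.image_image]
    ext e
    constructor
    · rintro ⟨_, ⟨n, k, rfl⟩, rfl⟩
      exact ⟨_, hK.triangle_mem (n, k), card_triangle hf _, hface n k⟩
    · rintro ⟨s, hs, hc, rfl⟩
      rcases (hK s).1 hs with ⟨v, rfl⟩ | ⟨j, n, rfl⟩ | ⟨⟨n, k⟩, rfl⟩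
      · simp at hc
      · rw [card_pair hf] at hc; simp at hc
      · exact ⟨_, ⟨n, k, rfl⟩, hface n k⟩

end Iso

end PTB

namespace PTB

/-! ### The slanted edges of `CW'(φ)` -/

section Pos

variable {f : ℤ → Letter}

/-- The direction of the slanted edges of `CW'(φ)` starting at level `n`. -/
def sgn (f : ℤ → Letter) (n : ℤ) : ℤ :=
  match f n with
  | .R => 1
  | .L => -1

theorem sgn_R {n : ℤ} (h : f n = .R) : sgn f n = 1 := by simp [sgn, h]

theorem sgn_L {n : ℤ} (h : f n = .L) : sgn f n = -1 := by simp [sgn, h]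

/-- The first coordinate of the point at height `y` of the slanted edge of `CW'(φ)` starting
at `(2 * w.1, w.2)`. -/
noncomputable def pos (f : ℤ → Letter) (w : ℤ × ℤ) (y : ℝ) : ℝ :=
  2 * w.1 + sgn f w.2 * ((y - w.2) / (nextIdx f w.2 - w.2))

theorem pos_self (m n : ℤ) : pos f (m, n) n = 2 * m := by simp [pos]

theorem next_sub_pos (hf : Recurrent f) (n : ℤ) : (0 : ℝ) < nextIdx f n - n := by
  have := (nextIdx_spec hf n).2.1
  have h : (n : ℝ) < nextIdx f n := by exact_mod_cast this
  linarith

theorem pos_next (hf : Recurrent f) (m n : ℤ) :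
    pos f (m, n) (nextIdx f n) = 2 * m + sgn f n := by
  have := next_sub_pos hf n
  simp only [pos]
  rw [div_self this.ne']; ring

theorem nextIdx_lastIdx (hf : Recurrent f) (n : ℤ) : nextIdx f (lastIdx f (f n) n) = n :=
  nextIdx_prevIdx hf n

/-- The relative height of a level between the last and the next occurrence of a letter. -/
theorem height_bounds (hf : Recurrent f) (l : Letter) (n : ℤ) {y : ℝ} (h0 : n ≤ y)
    (h1 : y ≤ n + 1) (k : ℤ) (hk : k = lastIdx f l (n + 1)) :
    f k = l ∧ 0 ≤ (y - k) / (nextIdx f k - k) ∧ (y - k) / (nextIdx f k - k) ≤ 1 ∧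
    (n < y → 0 < (y - k) / (nextIdx f k - k)) ∧
    (y < n + 1 → (y - k) / (nextIdx f k - k) < 1) := by
  obtain ⟨a, -, -⟩ := lastIdx_spec hf l (n + 1)
  rw [← hk] at a
  have hp := next_sub_pos hf k
  obtain ⟨h2, h3⟩ := (lastIdx_eq_iff hf k n).1 (by rw [a, hk])
  have h2' : (k : ℝ) ≤ n := by exact_mod_cast h2
  have h3' : (n : ℝ) + 1 ≤ nextIdx f k := by exact_mod_cast h3
  refine ⟨a, div_nonneg (by linarith) hp.le, ?_, fun h => div_pos (by linarith) hp, fun h => ?_⟩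
  · rw [div_le_one hp]; linarith
  · rw [div_lt_one hp]; linarith

/-- The same at the levels themselves. -/
theorem level_height_bounds (hf : Recurrent f) (l : Letter) (n : ℤ) (k : ℤ)
    (hk : k = lastIdx f l n) :
    f k = l ∧ 0 < ((n : ℝ) - k) / (nextIdx f k - k) ∧ ((n : ℝ) - k) / (nextIdx f k - k) ≤ 1 ∧
    (f n ≠ l → ((n : ℝ) - k) / (nextIdx f k - k) < 1) := by
  obtain ⟨a, b, c, d, -⟩ := height_bounds hf l (n - 1) (y := n) (by push_cast; linarith)
    (by push_cast; linarith) k (by rw [sub_add_cancel]; exact hk)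
  refine ⟨a, d (by push_cast; linarith), c, fun h => ?_⟩
  obtain ⟨-, -, -, -, e⟩ := height_bounds hf l n (y := n) le_rfl (by linarith) k
    (by rw [lastIdx_succ_of_ne hf h]; exact hk)
  exact e (by linarith)

/-- The slanted (`k` even) and vertical (`k` odd) edges of `CW'(φ)` between two levels. -/
noncomputable def knot' (f : ℤ → Letter) (n k : ℤ) (t : ℝ) : ℝ :=
  if k % 2 = 0 then pos f (ver f n (k / 2)) (n + t) else (k / 2 : ℤ)

theorem knot'_even (n k : ℤ) (t : ℝ) : knot' f n (2 * k) t = pos f (ver f n k) (n + t) := by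
  simp [knot']

theorem knot'_odd (n k : ℤ) (t : ℝ) : knot' f n (2 * k + 1) t = k := by
  simp [knot', show (2 * k + 1) / 2 = k by omega]

/-- Here `α` and `β` are the fractions already travelled, at height `n + t`, along the `L`-edges and
the `R`-edges crossing the strip. There is one such edge between any two neighbouring vertical
lines. -/
theorem knot'_cases (hf : Recurrent f) (n : ℤ) {t : ℝ} (h0 : 0 ≤ t) (h1 : t ≤ 1) :
    ∃ α β : ℝ, 0 ≤ α ∧ α ≤ 1 ∧ 0 ≤ β ∧ β ≤ 1 ∧ (0 < t → t < 1 → 0 < α ∧ α < 1 ∧ 0 < β ∧ β < 1) ∧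
      (∀ m : ℤ, knot' f n (4 * m) t = 2 * m - α) ∧
      (∀ m : ℤ, knot' f n (4 * m + 1) t = 2 * m) ∧
      (∀ m : ℤ, knot' f n (4 * m + 2) t = 2 * m + β) ∧
      (∀ m : ℤ, knot' f n (4 * m + 3) t = 2 * m + 1) ∧
      ∀ m : ℤ, knot' f n (4 * m + 4) t = 2 * m + 2 - α := by
  obtain ⟨a1, a2, a3, a4, a5⟩ := height_bounds hf .L n (y := n + t) (by linarith) (by linarith) _ rfl
  obtain ⟨b1, b2, b3, b4, b5⟩ := height_bounds hf .R n (y := n + t) (by linarith) (by linarith) _ rfl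
  have k0 : ∀ m : ℤ, knot' f n (4 * m) t = 2 * m - (n + t - lastIdx f .L (n + 1)) /
      (nextIdx f (lastIdx f .L (n + 1)) - lastIdx f .L (n + 1)) := by
    intro m
    rw [show 4 * m = 2 * (2 * m) by ring, knot'_even, ver_even, pos, sgn_L a1]
    push_cast; ring
  refine ⟨_, _, a2, a3, b2, b3, fun h h' => ⟨a4 (by linarith), a5 (by linarith), b4 (by linarith),
    b5 (by linarith)⟩, k0, ?_, ?_, ?_, ?_⟩ <;> intro m
  · rw [show 4 * m + 1 = 2 * (2 * m) + 1 by ring, knot'_odd]; push_cast; ring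
  · rw [show 4 * m + 2 = 2 * (2 * m + 1) by ring, knot'_even, ver_odd, pos, sgn_R b1]
    push_cast; ring
  · rw [show 4 * m + 3 = 2 * (2 * m + 1) + 1 by ring, knot'_odd]; push_cast; ring
  · rw [show 4 * m + 4 = 4 * (m + 1) by ring, k0]; push_cast; ring

theorem isKnots_knot' (hf : Recurrent f) : IsKnots (knot' f) where
  cont n k := by
    unfold knot' pos
    split_ifs <;> fun_prop
  mono n k t h0 h1 := by
    obtain ⟨α, β, a0, a1, b0, b1, -, e0, e1, e2, e3, e4⟩ := knot'_cases hf n h0 h1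
    obtain ⟨m, rfl | rfl | rfl | rfl⟩ := mod_four_cases k <;>
    simp only [add_assoc, one_add_one_eq_two, two_add_one_eq_three, three_add_one_eq_four,
      e0, e1, e2, e3, e4] <;> linarith
  strict n k t h0 h1 := by
    obtain ⟨α, β, -, -, -, -, h, e0, e1, e2, e3, e4⟩ := knot'_cases hf n h0.le h1.le
    obtain ⟨a0, a1, b0, b1⟩ := h h0 h1
    obtain ⟨m, rfl | rfl | rfl | rfl⟩ := mod_four_cases k <;>
    simp only [add_assoc, one_add_one_eq_two, two_add_one_eq_three, three_add_one_eq_four,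
      e0, e1, e2, e3, e4] <;> linarith
  bdd := by
    -- Four curves occupy a period of width two.
    refine ⟨1 / 2, 4, by norm_num, fun n k t h0 h1 => ?_⟩
    obtain ⟨α, β, a0, a1, b0, b1, -, e0, e1, e2, e3, e4⟩ := knot'_cases hf n h0 h1
    rw [abs_le]
    obtain ⟨m, rfl | rfl | rfl | rfl⟩ := mod_four_cases k <;>
    simp only [e0, e1, e2, e3] <;> push_cast <;> constructor <;> linarith

/-! ### The homeomorphism of the plane carrying `CW**(φ)` onto `CW*(φ)` -/

/-- The map between the integral points at level `n`. -/
noncomputable def levelMap (f : ℤ → Letter) (n j : ℤ) : ℝ := pos f (lat f j n) n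

theorem levelMap_cases (hf : Recurrent f) (n : ℤ) :
    ∃ α β : ℝ, 0 < α ∧ α ≤ 1 ∧ 0 < β ∧ β ≤ 1 ∧ ((f n = .R ∧ β = 1 ∧ α < 1) ∨
      (f n = .L ∧ α = 1 ∧ β < 1)) ∧
      (∀ m : ℤ, levelMap f n (3 * m) = 2 * m - α) ∧
      (∀ m : ℤ, levelMap f n (3 * m + 1) = 2 * m) ∧
      (∀ m : ℤ, levelMap f n (3 * m + 2) = 2 * m + β) ∧
      ∀ m : ℤ, levelMap f n (3 * m + 3) = 2 * m + 2 - α := by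
  obtain ⟨a1, a2, a3, a4⟩ := level_height_bounds hf .L n _ rfl
  obtain ⟨b1, b2, b3, b4⟩ := level_height_bounds hf .R n _ rfl
  have k0 : ∀ m : ℤ, levelMap f n (3 * m) = 2 * m - ((n : ℝ) - lastIdx f .L n) /
      (nextIdx f (lastIdx f .L n) - lastIdx f .L n) := by
    intro m
    rw [levelMap, lat_zero, pos, sgn_L a1]; push_cast; ring
  refine ⟨_, _, a2, a3, b2, b3, ?_, k0, fun m => ?_, fun m => ?_, fun m => ?_⟩
  · rcases R_or_L (f n) with h | h
    · refine Or.inl ⟨h, ?_, a4 (by rw [h]; exact letter_ne)⟩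
      have e := nextIdx_lastIdx hf n
      rw [h] at e
      have := next_sub_pos hf (lastIdx f .R n)
      rw [e] at this ⊢
      exact div_self this.ne'
    · refine Or.inr ⟨h, ?_, b4 (by rw [h]; exact letter_ne.symm)⟩
      have e := nextIdx_lastIdx hf n
      rw [h] at e
      have := next_sub_pos hf (lastIdx f .L n)
      rw [e] at this ⊢
      exact div_self this.ne'
  · rw [levelMap, lat_one, pos_self]
  · rw [levelMap, lat_two, pos, sgn_R b1]; push_cast; ring
  · rw [show 3 * m + 3 = 3 * (m + 1) by ring, k0]; push_cast; ring

theorem levelMap_strictMono (hf : Recurrent f) (n : ℤ) : StrictMono (levelMap f n) := by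
  refine strictMono_int_of_lt_succ fun j => ?_
  obtain ⟨α, β, a0, a1, b0, b1, h, e0, e1, e2, e3⟩ := levelMap_cases hf n
  obtain ⟨m, rfl | rfl | rfl⟩ := mod_three_cases j <;>
  simp only [add_assoc, one_add_one_eq_two, two_add_one_eq_three, e0, e1, e2, e3] <;>
  rcases h with ⟨-, h, h'⟩ | ⟨-, h, h'⟩ <;> linarith

/-- This is the meaning of `d`: it selects the lattice point whose slanted edge ends at level `n` in
`CW'(φ)`. -/
theorem levelMap_d (hf : Recurrent f) (m n : ℤ) : levelMap f n (3 * m + d f n) = 2 * m + 1 := by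
  obtain ⟨α, β, a0, a1, b0, b1, h, e0, e1, e2, e3⟩ := levelMap_cases hf n
  rcases h with ⟨h, e, -⟩ | ⟨h, e, -⟩
  · rw [d_R h, e2, e]
  · rw [d_L h, e3, e]; ring

theorem exists_slant_bot (hf : Recurrent f) (n k : ℤ) :
    ∃ j : ℤ, slant f n k 0 = j ∧ lat f j n = ver f n k := by
  obtain ⟨m, rfl | rfl⟩ := even_or_odd_cases k <;>
  rcases slant_cases hf n with ⟨-, e1, e2, -, k0, k1, -⟩ | ⟨-, e1, e2, -, k0, k1, -⟩
  · exact ⟨3 * m, by rw [k0]; push_cast; ring, by rw [lat_zero, ver_even, e2]⟩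
  · exact ⟨3 * m + 1, by rw [k0]; push_cast; ring, by rw [lat_one, ver_even, e1]⟩
  · exact ⟨3 * m + 1, by rw [k1]; push_cast; ring, by rw [lat_one, ver_odd, e1]⟩
  · exact ⟨3 * m + 2, by rw [k1]; push_cast; ring, by rw [lat_two, ver_odd, e2]⟩

theorem exists_slant_top (hf : Recurrent f) (n k : ℤ) :
    ∃ j : ℤ, slant f n k 1 = j ∧ lat f j (n + 1) = ver f n k := by
  obtain ⟨m, rfl | rfl⟩ := even_or_odd_cases k <;>
  rcases slant_cases hf n with ⟨-, e1, e2, -, k0, k1, -⟩ | ⟨-, e1, e2, -, k0, k1, -⟩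
  · exact ⟨3 * m, by rw [k0]; push_cast; ring, by rw [lat_zero, ver_even]⟩
  · exact ⟨3 * m, by rw [k0]; push_cast; ring, by rw [lat_zero, ver_even]⟩
  · exact ⟨3 * m + 2, by rw [k1]; push_cast; ring, by rw [lat_two, ver_odd]⟩
  · exact ⟨3 * m + 2, by rw [k1]; push_cast; ring, by rw [lat_two, ver_odd]⟩

/-- Corresponding curves of the two families have corresponding endpoints under `levelMap`, which
makes the gluing at integral levels the same. -/
theorem exists_knot_bot (hf : Recurrent f) (n k : ℤ) :
    ∃ j : ℤ, knot f n k 0 = j ∧ knot' f n k 0 = levelMap f n j := by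
  obtain ⟨i, rfl | rfl⟩ := even_or_odd_cases k
  · obtain ⟨j, h, hl⟩ := exists_slant_bot hf n i
    exact ⟨j, h, by rw [knot'_even, levelMap, hl, add_zero]⟩
  · rw [knot'_odd]
    obtain ⟨α, β, a0, a1, b0, b1, h, e0, e1, e2, e3⟩ := levelMap_cases hf n
    obtain ⟨m, rfl | rfl⟩ := even_or_odd_cases i
    · refine ⟨3 * m + 1, ?_, ?_⟩
      · rw [show 2 * (2 * m) + 1 = 4 * m + 1 by ring, knot_one]; push_cast; ring
      · rw [e1]; push_cast; ring
    · refine ⟨3 * m + d f n, ?_, ?_⟩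
      · rw [show 2 * (2 * m + 1) + 1 = 4 * m + 3 by ring, knot_three]; push_cast; ring
      · rw [levelMap_d hf]; push_cast; ring

theorem exists_knot_top (hf : Recurrent f) (n k : ℤ) :
    ∃ j : ℤ, knot f n k 1 = j ∧ knot' f n k 1 = levelMap f (n + 1) j := by
  obtain ⟨i, rfl | rfl⟩ := even_or_odd_cases k
  · obtain ⟨j, h, hl⟩ := exists_slant_top hf n i
    exact ⟨j, h, by rw [knot'_even, levelMap, hl]; push_cast; rfl⟩
  · rw [knot'_odd]
    obtain ⟨α, β, a0, a1, b0, b1, h, e0, e1, e2, e3⟩ := levelMap_cases hf (n + 1)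
    obtain ⟨m, rfl | rfl⟩ := even_or_odd_cases i
    · refine ⟨3 * m + 1, ?_, ?_⟩
      · rw [show 2 * (2 * m) + 1 = 4 * m + 1 by ring, knot_one]; push_cast; ring
      · rw [e1]; push_cast; ring
    · refine ⟨3 * m + d f (n + 1), ?_, ?_⟩
      · rw [show 2 * (2 * m + 1) + 1 = 4 * m + 3 by ring, knot_three]; push_cast; ring
      · rw [levelMap_d hf]; push_cast; ring

/-- At integral levels the side of a region is a single horizontal edge or a point, so linear
interpolation along it involves only neighbouring values of `levelMap`. -/
theorem knot_succ_le (n k : ℤ) {t : ℝ} (ht : t = 0 ∨ t = 1) :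
    knot f n (k + 1) t ≤ knot f n k t + 1 := by
  obtain ⟨m, rfl | rfl | rfl | rfl⟩ := mod_four_cases k <;>
  rcases knot_cases f n with ⟨-, h, e0, e2, e4⟩ | ⟨-, h, e0, e2, e4⟩ <;>
  rcases d_cases f (n + 1) with h' | h' <;>
  rcases ht with rfl | rfl <;>
  simp only [add_assoc, one_add_one_eq_two, two_add_one_eq_three, three_add_one_eq_four,
    knot_one, knot_three, e0, e2, e4, h, h'] <;>
  push_cast <;> linarith

end Pos

section Homeo

open unitInterval

variable {f : ℤ → Letter}

theorem exists_level_knot (hf : Recurrent f) (z : (ℤ × ℤ) × (I × I))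
    (ht : (z.2.2 : ℝ) = 0 ∨ (z.2.2 : ℝ) = 1) :
    ∃ (j N : ℤ) (u : ℝ), 0 ≤ u ∧ u ≤ 1 ∧ strip (knot f) z = (j + u, (N : ℝ)) ∧
      strip (knot' f) z = ((1 - u) * levelMap f N j + u * levelMap f N (j + 1), (N : ℝ)) := by
  obtain ⟨⟨n, k⟩, ⟨s, hs0, hs1⟩, ⟨t, ht0, ht1⟩⟩ := z
  simp only at ht
  obtain ⟨N, hN, j, j', e1, e1', e2, e2'⟩ : ∃ N : ℤ, (n : ℝ) + t = N ∧ ∃ j j' : ℤ,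
      knot f n k t = j ∧ knot' f n k t = levelMap f N j ∧
      knot f n (k + 1) t = j' ∧ knot' f n (k + 1) t = levelMap f N j' := by
    rcases ht with rfl | rfl
    · obtain ⟨j, h⟩ := exists_knot_bot hf n k
      obtain ⟨j', h'⟩ := exists_knot_bot hf n (k + 1)
      exact ⟨n, by simp, j, j', h.1, h.2, h'.1, h'.2⟩
    · obtain ⟨j, h⟩ := exists_knot_top hf n k
      obtain ⟨j', h'⟩ := exists_knot_top hf n (k + 1)
      exact ⟨n + 1, by simp, j, j', h.1, h.2, h'.1, h'.2⟩
  have h1 := (isKnots_knot f).mono n k t ht0 ht1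
  have h2 := knot_succ_le (f := f) n k ht
  rw [e1, e2] at h1 h2
  have h1' : j ≤ j' := by exact_mod_cast h1
  have h2' : j' ≤ j + 1 := by exact_mod_cast h2
  simp only [strip, e1, e1', e2, e2', hN]
  rcases (by omega : j' = j ∨ j' = j + 1) with rfl | rfl
  · refine ⟨j', N, 0, le_rfl, zero_le_one, ?_, ?_⟩ <;> ext <;> simp only <;> ring
  · refine ⟨j, N, s, hs0, hs1, ?_, ?_⟩ <;> push_cast <;> ext <;> simp only; ring

theorem interp_eq_iff {γ : ℤ → ℝ} (hγ : StrictMono γ) {j j' : ℤ} {u u' : ℝ} (h0 : 0 ≤ u)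
    (h1 : u ≤ 1) (h0' : 0 ≤ u') (h1' : u' ≤ 1) :
    (j : ℝ) + u = j' + u' ↔
      (1 - u) * γ j + u * γ (j + 1) = (1 - u') * γ j' + u' * γ (j' + 1) := by
  have hs : ∀ i, 0 < γ (i + 1) - γ i := fun i => sub_pos.2 (hγ (by omega))
  have hlt : ∀ {i i' : ℤ} {v v' : ℝ}, 0 ≤ v → v ≤ 1 → 0 ≤ v' → v' ≤ 1 → i < i' →
      ((i : ℝ) + v = i' + v' ↔
        (1 - v) * γ i + v * γ (i + 1) = (1 - v') * γ i' + v' * γ (i' + 1)) := by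
    intro i i' v v' h0 h1 h0' h1' hi
    have a1 := hs i
    have a2 := hs i'
    rcases (show i + 1 ≤ i' by omega).eq_or_lt with rfl | hi'
    · push_cast
      constructor
      · intro h
        obtain rfl : v = 1 := by linarith
        obtain rfl : v' = 0 := by linarith
        ring
      · intro h
        have : (1 - v) * (γ (i + 1) - γ i) + v' * (γ (i + 1 + 1) - γ (i + 1)) = 0 := by linarith
        have b1 : 0 ≤ (1 - v) * (γ (i + 1) - γ i) := mul_nonneg (by linarith) a1.le
        have b2 : 0 ≤ v' * (γ (i + 1 + 1) - γ (i + 1)) := mul_nonneg h0' a2.le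
        have c1 : (1 - v) * (γ (i + 1) - γ i) = 0 := by linarith
        have c2 : v' * (γ (i + 1 + 1) - γ (i + 1)) = 0 := by linarith
        have d1 := (mul_eq_zero.1 c1).resolve_right a1.ne'
        have d2 := (mul_eq_zero.1 c2).resolve_right a2.ne'
        linarith
    · have b : γ (i + 1) < γ i' := hγ hi'
      have c : (i : ℝ) + 1 < i' := by exact_mod_cast hi'
      constructor
      · intro h; linarith
      · intro h
        nlinarith [mul_nonneg (sub_nonneg.2 h1) a1.le, mul_nonneg h0' a2.le]
  rcases lt_trichotomy j j' with h | rfl | h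
  · exact hlt h0 h1 h0' h1' h
  · constructor
    · intro h; rw [add_left_cancel h]
    · intro h
      have : (u - u') * (γ (j + 1) - γ j) = 0 := by linarith
      have := (mul_eq_zero.1 this).resolve_right (hs j).ne'
      linarith
  · rw [eq_comm, hlt h0' h1' h0 h1 h, eq_comm]

/-- Inside the strips both fibres are described by `SamePoint`, which does not mention the curves.
On integral levels both maps are interpolations of strictly increasing sequences at the same
parameters. -/
theorem strip_knot_eq_iff (hf : Recurrent f) (z z' : (ℤ × ℤ) × (I × I)) :
    strip (knot f) z = strip (knot f) z' ↔ strip (knot' f) z = strip (knot' f) z' := by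
  by_cases ht : (z.2.2 : ℝ) = 0 ∨ (z.2.2 : ℝ) = 1
  · obtain ⟨j, N, u, h0, h1, e, e'⟩ := exists_level_knot hf z ht
    by_cases ht' : (z'.2.2 : ℝ) = 0 ∨ (z'.2.2 : ℝ) = 1
    · obtain ⟨j', N', u', h0', h1', k, k'⟩ := exists_level_knot hf z' ht'
      rw [e, e', k, k', Prod.mk.injEq, Prod.mk.injEq, Int.cast_inj]
      refine and_congr_left ?_
      rintro rfl
      exact interp_eq_iff (levelMap_strictMono hf N) h0 h1 h0' h1'
    · refine iff_of_false (fun h => ht' ?_) fun h => ht' ?_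
      · exact param_of_level (N := N) (by rw [← h, e])
      · exact param_of_level (N := N) (by rw [← h, e'])
  · push Not at ht
    have t0 := lt_of_le_of_ne z.2.2.2.1 ht.1.symm
    have t1 := lt_of_le_of_ne z.2.2.2.2 ht.2
    rw [(isKnots_knot f).strip_eq_iff t0 t1, (isKnots_knot' hf).strip_eq_iff t0 t1]

theorem exists_plane_homeomorph (hf : Recurrent f) : ∃ g : ℝ × ℝ ≃ₜ ℝ × ℝ,
    (∀ n k t, 0 ≤ t → t ≤ 1 → g (knot f n k t, (n : ℝ) + t) = (knot' f n k t, (n : ℝ) + t)) ∧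
    ∀ j n : ℤ, g (pt j n) = (levelMap f n j, (n : ℝ)) := by
  obtain ⟨g, hg⟩ := exists_homeomorph_of_isQuotientMap (isKnots_knot f).isQuotientMap_strip
    (isKnots_knot' hf).isQuotientMap_strip (strip_knot_eq_iff hf)
  refine ⟨g, fun n k t h0 h1 => ?_, fun j n => ?_⟩
  · have := hg ((n, k), (0, ⟨t, h0, h1⟩))
    simpa [strip] using this
  · obtain ⟨z, hz⟩ := (isKnots_knot f).surjective_strip (pt j n)
    obtain ⟨j', N, u, h0, h1, e, e'⟩ := exists_level_knot hf z
      (param_of_level (N := n) (by rw [hz]; rfl))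
    rw [← hz, hg, e']
    rw [hz, pt, Prod.mk.injEq, Int.cast_inj] at e
    obtain ⟨e, rfl⟩ := e
    rw [Prod.mk.injEq]
    refine ⟨?_, rfl⟩
    rw [← (interp_eq_iff (levelMap_strictMono hf n) (j := j) le_rfl zero_le_one h0 h1).1
      (by rw [← e]; ring)]
    ring

end Homeo

/-! ### Skeleta and compatibility with the collapses -/

section Skeleton

variable {f : ℤ → Letter}

theorem slanted'_eq : slanted' f =
    {e | ∃ m n, e = edge (2 * m) n (2 * m + sgn f n) (nextIdx f n)} := by
  ext e
  constructor
  · rintro (⟨m, n, h, rfl⟩ | ⟨m, n, h, rfl⟩)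
    · exact ⟨m, n, by rw [sgn_R h]⟩
    · exact ⟨m, n, by rw [sgn_L h, sub_eq_add_neg]⟩
  · rintro ⟨m, n, rfl⟩
    rcases R_or_L (f n) with h | h
    · exact Or.inl ⟨m, n, h, by rw [sgn_R h]⟩
    · exact Or.inr ⟨m, n, h, by rw [sgn_L h, sub_eq_add_neg]⟩

theorem mem_slanted'_edge (hf : Recurrent f) {m n : ℤ} {x : ℝ × ℝ} :
    x ∈ edge (2 * m) n (2 * m + sgn f n) (nextIdx f n) ↔
      n < x.2 ∧ x.2 < nextIdx f n ∧ x.1 = pos f (m, n) x.2 := by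
  have hp := next_sub_pos hf n
  rw [mem_edge]
  constructor
  · rintro ⟨t, h0, h1, rfl⟩
    refine ⟨?_, ?_, ?_⟩
    · simp only; nlinarith
    · simp only; nlinarith
    · simp only [pos]
      push_cast
      field_simp
      ring
  · rintro ⟨h0, h1, h⟩
    refine ⟨(x.2 - n) / (nextIdx f n - n), div_pos (by linarith) hp, ?_, ?_⟩
    · rw [div_lt_one hp]; linarith
    · ext
      · rw [h, pos]; push_cast; ring
      · simp only; field_simp; ring

theorem mem_closure_slanted'_edge (hf : Recurrent f) {m n : ℤ} {x : ℝ × ℝ} :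
    x ∈ closure (edge (2 * m) n (2 * m + sgn f n) (nextIdx f n)) ↔
      n ≤ x.2 ∧ x.2 ≤ nextIdx f n ∧ x.1 = pos f (m, n) x.2 := by
  have hp := next_sub_pos hf n
  rw [mem_closure_edge]
  constructor
  · rintro ⟨t, h0, h1, rfl⟩
    refine ⟨?_, ?_, ?_⟩
    · simp only; nlinarith
    · simp only; nlinarith
    · simp only [pos]
      push_cast
      field_simp
      ring
  · rintro ⟨h0, h1, h⟩
    refine ⟨(x.2 - n) / (nextIdx f n - n), div_nonneg (by linarith) hp.le, ?_, ?_⟩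
    · rw [div_le_one hp]; linarith
    · ext
      · rw [h, pos]; push_cast; ring
      · simp only; field_simp; ring

/-- The points of `CW'(φ)` on vertices or edges. -/
def skeleton' (f : ℤ → Letter) : Set (ℝ × ℝ) :=
  {x | ∃ m n, x = pt m n} ∪ ⋃₀ (vertical' ∪ slanted' f)

/-- The points of `CWΔ(φ)` on vertices or on vertical or slanted edges. -/
def skeleton (f : ℤ → Letter) : Set (ℝ × ℝ) :=
  {x | ∃ m n, x = pt m n} ∪ ⋃₀ (vertical f ∪ slanted f)

theorem pos_mem_skeleton' (hf : Recurrent f) (w : ℤ × ℤ) {y : ℝ} (h0 : w.2 ≤ y)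
    (h1 : y ≤ nextIdx f w.2) : (pos f w y, y) ∈ skeleton' f := by
  obtain ⟨m, n⟩ := w
  simp only at h0 h1
  rcases h0.eq_or_lt with rfl | h0
  · exact Or.inl ⟨2 * m, n, by rw [pos_self, pt]; push_cast; rfl⟩
  rcases h1.eq_or_lt with rfl | h1
  · exact Or.inl ⟨2 * m + sgn f n, nextIdx f n, by rw [pos_next hf, pt]; push_cast; rfl⟩
  refine Or.inr ⟨_, Or.inr ?_, (mem_slanted'_edge hf (m := m) (n := n)).2 ⟨h0, h1, rfl⟩⟩
  rw [slanted'_eq]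
  exact ⟨m, n, rfl⟩

theorem lastIdx_bounds (hf : Recurrent f) (l : Letter) (n : ℤ) :
    lastIdx f l (n + 1) ≤ n ∧ n < nextIdx f (lastIdx f l (n + 1)) :=
  (lastIdx_eq_iff hf _ _).1 (by rw [(lastIdx_spec hf l (n + 1)).1])

theorem ver_bounds (hf : Recurrent f) (n k : ℤ) :
    (ver f n k).2 ≤ n ∧ n < nextIdx f (ver f n k).2 := by
  obtain ⟨m, rfl | rfl⟩ := even_or_odd_cases k
  · rw [ver_even]; exact lastIdx_bounds hf _ _
  · rw [ver_odd]; exact lastIdx_bounds hf _ _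

theorem lat_bounds (hf : Recurrent f) (j n : ℤ) :
    (lat f j n).2 ≤ n ∧ n ≤ nextIdx f (lat f j n).2 := by
  have h : ∀ l, lastIdx f l n ≤ n ∧ n ≤ nextIdx f (lastIdx f l n) := by
    intro l
    have := lastIdx_bounds hf l (n - 1)
    rw [sub_add_cancel] at this
    omega
  obtain ⟨m, rfl | rfl | rfl⟩ := mod_three_cases j
  · rw [lat_zero]; exact h _
  · rw [lat_one]; exact ⟨le_rfl, (nextIdx_spec hf n).2.1.le⟩
  · rw [lat_two]; exact h _

theorem exists_ver (hf : Recurrent f) (m : ℤ) {n i : ℤ} (h0 : n ≤ i) (h1 : i < nextIdx f n) :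
    ∃ k, ver f i k = (m, n) := by
  have h := (lastIdx_eq_iff hf n i).2 ⟨h0, h1⟩
  rcases R_or_L (f n) with hl | hl <;> rw [hl] at h
  · exact ⟨2 * m + 1, by rw [ver_odd, h]⟩
  · exact ⟨2 * m, by rw [ver_even, h]⟩

/-- A closed slanted edge of `CW'(φ)` is a union of images of closed slanted edges of `CWΔ(φ)`. -/
theorem exists_slant_of_height (hf : Recurrent f) (m : ℤ) {n : ℤ} {y : ℝ} (h0 : n ≤ y)
    (h1 : y ≤ nextIdx f n) : ∃ (i k : ℤ) (t : ℝ), 0 ≤ t ∧ t ≤ 1 ∧ y = i + t ∧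
      ver f i k = (m, n) ∧ pos f (m, n) y = knot' f i (2 * k) t := by
  obtain ⟨i, t, t0, t1, rfl, hi, hi'⟩ : ∃ (i : ℤ) (t : ℝ), 0 ≤ t ∧ t ≤ 1 ∧ y = i + t ∧
      n ≤ i ∧ i < nextIdx f n := by
    rcases h1.eq_or_lt with rfl | h1
    -- The top endpoint is taken in the strip below it, since the edge does not enter the strip
    -- above.
    · exact ⟨nextIdx f n - 1, 1, zero_le_one, le_rfl, by push_cast; ring,
        by have := (nextIdx_spec hf n).2.1; omega, by omega⟩
    · exact ⟨⌊y⌋, Int.fract y, Int.fract_nonneg y, (Int.fract_lt_one y).le,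
        (Int.floor_add_fract y).symm, Int.le_floor.2 h0, Int.floor_lt.2 h1⟩
  obtain ⟨k, hk⟩ := exists_ver hf m hi hi'
  exact ⟨i, k, t, t0, t1, rfl, hk, by rw [knot'_even, hk]⟩

/-- The properties of the homeomorphism of the plane carrying `CW**(φ)` onto `CW*(φ)`. -/
def IsStraightening (f : ℤ → Letter) (g : ℝ × ℝ ≃ₜ ℝ × ℝ) : Prop :=
  (∀ n k t, 0 ≤ t → t ≤ 1 → g (knot f n k t, (n : ℝ) + t) = (knot' f n k t, (n : ℝ) + t)) ∧
    ∀ j n : ℤ, g (pt j n) = (levelMap f n j, (n : ℝ))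

variable {g : ℝ × ℝ ≃ₜ ℝ × ℝ}

theorem IsStraightening.pt_even (hg : IsStraightening f g) (m n : ℤ) :
    g (pt (3 * m + 1) n) = pt (2 * m) n := by
  rw [hg.2, levelMap, lat_one, pos_self, pt]; push_cast; rfl

theorem IsStraightening.pt_odd (hf : Recurrent f) (hg : IsStraightening f g) (m n : ℤ) :
    g (pt (3 * m + d f n) n) = pt (2 * m + 1) n := by
  rw [hg.2, levelMap_d hf, pt]; push_cast; rfl

theorem IsStraightening.image_openKnot (hg : IsStraightening f g) (n k : ℤ) :
    g '' openKnot (knot f) n k = openKnot (knot' f) n k := by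
  ext x
  constructor
  · rintro ⟨_, ⟨t, t0, t1, rfl⟩, rfl⟩
    exact ⟨t, t0, t1, hg.1 n k t t0.le t1.le⟩
  · rintro ⟨t, t0, t1, rfl⟩
    exact ⟨_, ⟨t, t0, t1, rfl⟩, hg.1 n k t t0.le t1.le⟩

theorem vertical'_eq : vertical' = {e | ∃ n k, e = openKnot (knot' f) n (2 * k + 1)} := by
  have h : ∀ n k, edge k n k (n + 1) = openKnot (knot' f) n (2 * k + 1) := fun n k =>
    edge_eq_openKnot fun t => by rw [knot'_odd]; ring
  ext e
  constructor
  · rintro ⟨k, n, rfl⟩; exact ⟨n, k, h n k⟩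
  · rintro ⟨n, k, rfl⟩; exact ⟨k, n, (h n k).symm⟩

theorem IsStraightening.image_vertical (hg : IsStraightening f g) :
    Set.image g '' vertical f = vertical' := by
  rw [vertical_eq, vertical'_eq (f := f)]
  ext e
  constructor
  · rintro ⟨_, ⟨n, k, rfl⟩, rfl⟩
    exact ⟨n, k, hg.image_openKnot n _⟩
  · rintro ⟨n, k, rfl⟩
    exact ⟨_, ⟨n, k, rfl⟩, hg.image_openKnot n _⟩

/-- Only the unions correspond: a lattice point of `CWΔ(φ)` may go to an interior point of a slanted
edge of `CW'(φ)`. This is enough for the faces, which are components of complements. -/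
theorem IsStraightening.image_skeleton (hf : Recurrent f) (hg : IsStraightening f g) :
    g '' skeleton f = skeleton' f := by
  ext x
  constructor
  · rintro ⟨_, ⟨j, n, rfl⟩ | ⟨e, he | he, hx⟩, rfl⟩
    · rw [hg.2]
      obtain ⟨h0, h1⟩ := lat_bounds hf j n
      exact pos_mem_skeleton' hf (lat f j n) (by exact_mod_cast h0) (by exact_mod_cast h1)
    · refine Or.inr ⟨g '' e, Or.inl ?_, ⟨_, hx, rfl⟩⟩
      rw [← hg.image_vertical]
      exact ⟨e, he, rfl⟩
    · obtain ⟨n, k, rfl⟩ := knot_of_mem_slanted he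
      obtain ⟨t, t0, t1, rfl⟩ := hx
      rw [hg.1 _ _ _ t0.le t1.le, knot'_even]
      obtain ⟨h0, h1⟩ := ver_bounds hf n k
      have h0' : ((ver f n k).2 : ℝ) ≤ n := by exact_mod_cast h0
      have h1' : (n : ℝ) + 1 ≤ nextIdx f (ver f n k).2 := by exact_mod_cast h1
      exact pos_mem_skeleton' hf _ (by linarith) (by linarith)
  · rintro (⟨M, n, rfl⟩ | ⟨e, he | he, hx⟩)
    · obtain ⟨m, rfl | rfl⟩ := even_or_odd_cases M
      · exact ⟨_, Or.inl ⟨_, _, rfl⟩, hg.pt_even m n⟩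
      · exact ⟨_, Or.inl ⟨_, _, rfl⟩, hg.pt_odd hf m n⟩
    · rw [← hg.image_vertical] at he
      obtain ⟨e, he, rfl⟩ := he
      obtain ⟨x, hx, rfl⟩ := hx
      exact ⟨x, Or.inr ⟨e, Or.inl he, hx⟩, rfl⟩
    · rw [slanted'_eq] at he
      obtain ⟨m, n, rfl⟩ := he
      obtain ⟨h0, h1, h⟩ := (mem_slanted'_edge hf).1 hx
      obtain ⟨i, k, t, t0, t1, hy, -, hpos⟩ := exists_slant_of_height hf m h0.le h1.le
      refine ⟨(knot f i (2 * k) t, i + t), ?_, ?_⟩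
      · rcases t0.eq_or_lt with rfl | t0
        · obtain ⟨j, hj, -⟩ := exists_slant_bot hf i k
          exact Or.inl ⟨j, i, by rw [pt, ← hj, add_zero]; rfl⟩
        · rcases t1.eq_or_lt with rfl | t1
          · obtain ⟨j, hj, -⟩ := exists_slant_top hf i k
            exact Or.inl ⟨j, i + 1, by rw [pt, ← hj]; push_cast; rfl⟩
          · refine Or.inr ⟨openKnot (knot f) i (2 * k), Or.inr ?_, ⟨t, t0, t1, rfl⟩⟩
            rw [slanted_eq]
            exact ⟨i, k, rfl⟩
      · rw [hg.1 _ _ _ t0 t1, ← hpos, ← hy, ← h]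

/-- Collapsing the slanted edges on both sides is compatible with the homeomorphism. -/
theorem IsStraightening.mk_eq_iff (hf : Recurrent f) (hg : IsStraightening f g) (x y : ℝ × ℝ) :
    Collapse.mk (slanted f) x = Collapse.mk (slanted f) y ↔
      Collapse.mk (slanted' f) (g x) = Collapse.mk (slanted' f) (g y) := by
  constructor
  · refine Collapse.apply_eq_of_mk_eq (u := fun x => Collapse.mk (slanted' f) (g x)) ?_
    intro e he x hx y hy
    obtain ⟨n, k, rfl⟩ := knot_of_mem_slanted he
    have key : ∀ x ∈ closure (openKnot (knot f) n (2 * k)),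
        g x ∈ closure (edge (2 * (ver f n k).1) (ver f n k).2
          (2 * (ver f n k).1 + sgn f (ver f n k).2) (nextIdx f (ver f n k).2)) := by
      intro x hx
      obtain ⟨t, t0, t1, rfl⟩ := mem_closure_knot.1 hx
      rw [hg.1 _ _ _ t0 t1, mem_closure_slanted'_edge hf, knot'_even]
      obtain ⟨h0, h1⟩ := ver_bounds hf n k
      have h0' : ((ver f n k).2 : ℝ) ≤ n := by exact_mod_cast h0
      have h1' : (n : ℝ) + 1 ≤ nextIdx f (ver f n k).2 := by exact_mod_cast h1
      exact ⟨by simp only; linarith, by simp only; linarith, rfl⟩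
    exact Collapse.mk_eq (by rw [slanted'_eq]; exact ⟨_, _, rfl⟩) (key x hx) (key y hy)
  · intro h
    have := Collapse.apply_eq_of_mk_eq (u := fun x => Collapse.mk (slanted f) (g.symm x)) ?_ h
    · simpa using this
    · rw [slanted'_eq]
      -- The preimage of a long slanted edge is a chain of short ones, all collapsing to the vertex
      -- at its lower end.
      have key : ∀ m n, ∀ x ∈ closure (edge (2 * m) n (2 * m + sgn f n) (nextIdx f n)),
          Collapse.mk (slanted f) (g.symm x) = Collapse.mk (slanted f) (pt (3 * m + 1) n) := by
        intro m n x hx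
        obtain ⟨h0, h1, h⟩ := (mem_closure_slanted'_edge hf).1 hx
        obtain ⟨i, k, t, t0, t1, hy, hv, hpos⟩ := exists_slant_of_height hf m h0 h1
        have e : g (slant f i k t, i + t) = x := by
          rw [slant, hg.1 _ _ _ t0 t1, ← hpos, ← hy, ← h]
        rw [← e, Homeomorph.symm_apply_apply, mk_slant hf i k t0 t1, hv]
      rintro _ ⟨m, n, rfl⟩ x hx y hy
      rw [key m n x hx, key m n y hy]

theorem exists_collapse_homeomorph (hf : Recurrent f) (hg : IsStraightening f g) :
    ∃ h : Collapse (slanted f) ≃ₜ Collapse (slanted' f), ∀ x,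
      h (Collapse.mk (slanted f) x) = Collapse.mk (slanted' f) (g x) :=
  exists_homeomorph_of_isQuotientMap (isQuotientMap_mk _)
    ((isQuotientMap_mk _).comp g.isQuotientMap) (hg.mk_eq_iff hf)

end Skeleton

/-! ### The faces of `CW'(φ)` -/

section Faces

variable {f : ℤ → Letter}

theorem sgn_mul_self (n : ℤ) : (sgn f n : ℝ) * sgn f n = 1 := by
  rcases R_or_L (f n) with h | h
  · rw [sgn_R h]; norm_num
  · rw [sgn_L h]; norm_num

theorem cell'_eq (m n : ℤ) : cell' f m n = interior (convexHull ℝ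
    {pt (2 * m) (prevIdx f n), pt (2 * m) n, pt (2 * m + sgn f n) n,
      pt (2 * m + sgn f n) (nextIdx f n)}) := by
  unfold cell'
  rcases R_or_L (f n) with h | h
  · rw [sgn_R h]; simp only [h]
  · rw [sgn_L h]; simp only [h]
    congr 2
    ext x
    simp only [Set.mem_insert_iff, Set.mem_singleton_iff, sub_eq_add_neg]
    tauto

/-- The height of the slanted edge of `CW'(φ)` starting at level `n`, at distance `v` from the
vertical line through its starting point. -/
noncomputable def line (f : ℤ → Letter) (n : ℤ) (v : ℝ) : ℝ := n + v * (nextIdx f n - n)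

theorem line_bounds (hf : Recurrent f) (n : ℤ) {v : ℝ} (h0 : 0 ≤ v) (h1 : v ≤ 1) :
    n ≤ line f n v ∧ line f n v ≤ nextIdx f n := by
  have := next_sub_pos hf n
  unfold line
  constructor <;> nlinarith

theorem line_lt (hf : Recurrent f) {n n' : ℤ} (hl : f n = f n') (h : n < n') {v : ℝ} (h0 : 0 ≤ v)
    (h1 : v < 1) : line f n v < line f n' v := by
  have h2 := (line_bounds hf n' h0 h1.le).1
  have h3 : (nextIdx f n : ℝ) ≤ n' := by
    exact_mod_cast (nextIdx_spec hf n).2.2 n' hl.symm h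
  have := next_sub_pos hf n
  have : line f n v < nextIdx f n := by unfold line; nlinarith
  linarith

theorem prevIdx_spec (hf : Recurrent f) (n : ℤ) : f (prevIdx f n) = f n ∧ prevIdx f n < n ∧
    ∀ k, f k = f n → k < n → k ≤ prevIdx f n := lastIdx_spec hf (f n) n

theorem line_prev (hf : Recurrent f) (n : ℤ) (v : ℝ) :
    line f (prevIdx f n) v = prevIdx f n + v * (n - prevIdx f n) := by
  rw [line, nextIdx_prevIdx hf]

/-- A perturbation of an interior point in the four coordinate directions. -/
theorem exists_perturbation {W : Set (ℝ × ℝ)} {x : ℝ × ℝ} (hx : x ∈ interior W) :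
    ∃ ε > 0, (x.1 + ε, x.2) ∈ W ∧ (x.1 - ε, x.2) ∈ W ∧ (x.1, x.2 + ε) ∈ W ∧
      (x.1, x.2 - ε) ∈ W := by
  obtain ⟨δ, hδ, hb⟩ := Metric.mem_nhds_iff.1 (mem_interior_iff_mem_nhds.1 hx)
  have habs : |δ| / 2 < δ := by rw [abs_of_pos hδ]; linarith
  refine ⟨δ / 2, by linarith, hb ?_, hb ?_, hb ?_, hb ?_⟩ <;>
  simp [Prod.dist_eq, habs, hδ]

/-- The hull is the region between two slanted edges inside a vertical strip of width one, and `sgn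
f n * (x.1 - 2 * m)` is the distance from the line through `(2 * m, n)`, counted towards the other
side. -/
theorem mem_cell' (hf : Recurrent f) (m n : ℤ) (x : ℝ × ℝ) : x ∈ cell' f m n ↔
    0 < sgn f n * (x.1 - 2 * m) ∧ sgn f n * (x.1 - 2 * m) < 1 ∧
      line f (prevIdx f n) (sgn f n * (x.1 - 2 * m)) < x.2 ∧
      x.2 < line f n (sgn f n * (x.1 - 2 * m)) := by
  rw [cell'_eq]
  have hs := sgn_mul_self (f := f) n
  have hsz : (sgn f n : ℝ) = 1 ∨ (sgn f n : ℝ) = -1 := by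
    rcases R_or_L (f n) with h | h
    · rw [sgn_R h]; simp
    · rw [sgn_L h]; simp
  have hnx := next_sub_pos hf n
  have hpv : (prevIdx f n : ℝ) < n := by exact_mod_cast (prevIdx_spec hf n).2.1
  rw [line_prev hf, line]
  set ε : ℝ := ((sgn f n : ℤ) : ℝ) with hε
  set b : ℝ := ((nextIdx f n : ℤ) : ℝ) with hb
  set a : ℝ := ((prevIdx f n : ℤ) : ℝ) with ha
  set P : Set (ℝ × ℝ) := {pt (2 * m) (prevIdx f n), pt (2 * m) n, pt (2 * m + sgn f n) n,
    pt (2 * m + sgn f n) (nextIdx f n)} with hP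
  have hP1 : ((2 * m, a) : ℝ × ℝ) ∈ convexHull ℝ P :=
    subset_convexHull ℝ P (Or.inl (by simp [pt, a]))
  have hP2 : ((2 * m, n) : ℝ × ℝ) ∈ convexHull ℝ P :=
    subset_convexHull ℝ P (Or.inr (Or.inl (by simp [pt])))
  have hP3 : ((2 * m + ε, n) : ℝ × ℝ) ∈ convexHull ℝ P :=
    subset_convexHull ℝ P (Or.inr (Or.inr (Or.inl (by simp [pt, ε]))))
  have hP4 : ((2 * m + ε, b) : ℝ × ℝ) ∈ convexHull ℝ P :=
    subset_convexHull ℝ P (Or.inr (Or.inr (Or.inr (by simp [pt, ε, b]))))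
  have hc := convex_convexHull ℝ P
  constructor
  · intro hx
    have hsub : convexHull ℝ P ⊆ {y : ℝ × ℝ | 0 ≤ ε * (y.1 - 2 * m) ∧ ε * (y.1 - 2 * m) ≤ 1 ∧
        a + ε * (y.1 - 2 * m) * (n - a) ≤ y.2 ∧ y.2 ≤ n + ε * (y.1 - 2 * m) * (b - n)} := by
      refine convexHull_min ?_ ?_
      · have e0 : ε * (2 * (m : ℝ) - 2 * m) = 0 := by ring
        have e1 : ε * (2 * (m : ℝ) + ε - 2 * m) = 1 := by linear_combination hs
        rintro y (rfl | rfl | rfl | rfl) <;> simp only [pt, Set.mem_ofPred_eq] <;> push_cast <;>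
        simp only [← hε, ← ha, ← hb, e0, e1] <;> refine ⟨?_, ?_, ?_, ?_⟩ <;> linarith
      · rintro ⟨x1, y1⟩ ⟨h1, h2, h3, h4⟩ ⟨x2, y2⟩ ⟨k1, k2, k3, k4⟩ p q hp hq hpq
        simp only at h1 h2 h3 h4 k1 k2 k3 k4
        obtain rfl : q = 1 - p := by linarith
        simp only [Prod.smul_mk, Prod.mk_add_mk, smul_eq_mul, Set.mem_ofPred_eq]
        refine ⟨?_, ?_, ?_, ?_⟩
        · linarith [mul_nonneg hp h1, mul_nonneg hq k1]
        · linarith [mul_nonneg hp (sub_nonneg.2 h2), mul_nonneg hq (sub_nonneg.2 k2)]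
        · linarith [mul_nonneg hp (sub_nonneg.2 h3), mul_nonneg hq (sub_nonneg.2 k3)]
        · linarith [mul_nonneg hp (sub_nonneg.2 h4), mul_nonneg hq (sub_nonneg.2 k4)]
    -- Weak inequalities at the perturbed points give strict ones at `x`. Both horizontal directions
    -- are used since the sign `ε` is not fixed.
    obtain ⟨δ, hδ, ⟨a1, a2, -, -⟩, ⟨b1, b2, -, -⟩, ⟨-, -, -, c4⟩, -, -, d3, -⟩ :=
      exists_perturbation (interior_mono hsub hx)
    simp only at a1 a2 b1 b2 c4 d3
    refine ⟨?_, ?_, by linarith, by linarith⟩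
    · rcases hsz with h | h <;> rw [h] at a1 b1 ⊢ <;> linarith
    · rcases hsz with h | h <;> rw [h] at a2 b2 ⊢ <;> linarith
  · rintro ⟨h1, h2, h3, h4⟩
    have hopen : IsOpen {y : ℝ × ℝ | 0 < ε * (y.1 - 2 * m) ∧ ε * (y.1 - 2 * m) < 1 ∧
        a + ε * (y.1 - 2 * m) * (n - a) < y.2 ∧ y.2 < n + ε * (y.1 - 2 * m) * (b - n)} := by
      have c0 : Continuous fun y : ℝ × ℝ => ε * (y.1 - 2 * m) := by fun_prop
      have c1 : Continuous fun y : ℝ × ℝ => a + ε * (y.1 - 2 * m) * (n - a) := by fun_prop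
      have c2 : Continuous fun y : ℝ × ℝ => n + ε * (y.1 - 2 * m) * (b - n) := by fun_prop
      exact (isOpen_lt continuous_const c0).inter ((isOpen_lt c0 continuous_const).inter
        ((isOpen_lt c1 continuous_snd).inter (isOpen_lt continuous_snd c2)))
    refine interior_maximal ?_ hopen ⟨h1, h2, h3, h4⟩
    rintro ⟨x, y⟩ ⟨h1, h2, h3, h4⟩
    simp only at h1 h2 h3 h4
    obtain ⟨v, hv⟩ : ∃ v, v = ε * (x - 2 * m) := ⟨_, rfl⟩
    have hx : x = 2 * m + ε * v := by
      rw [hv, ← mul_assoc, hs]; ring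
    rw [← hv] at h1 h2 h3 h4
    -- The points of the lower and the upper boundary line on the vertical through the given point
    -- lie in the hull, and the given point lies between them.
    have hlow : ((x, a + v * (n - a)) : ℝ × ℝ) ∈ convexHull ℝ P := by
      have := hc hP1 hP3 (sub_nonneg.2 h2.le) h1.le (by ring)
      convert this using 1
      simp only [Prod.smul_mk, Prod.mk_add_mk, smul_eq_mul, Prod.mk.injEq]
      exact ⟨by rw [hx]; ring, by ring⟩
    have hup : ((x, n + v * (b - n)) : ℝ × ℝ) ∈ convexHull ℝ P := by
      have := hc hP2 hP4 (sub_nonneg.2 h2.le) h1.le (by ring)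
      convert this using 1
      simp only [Prod.smul_mk, Prod.mk_add_mk, smul_eq_mul, Prod.mk.injEq]
      exact ⟨by rw [hx]; ring, by ring⟩
    have hpos : 0 < n + v * (b - n) - (a + v * (n - a)) := by linarith
    have := hc hlow hup
      (a := (n + v * (b - n) - y) / (n + v * (b - n) - (a + v * (n - a))))
      (b := (y - (a + v * (n - a))) / (n + v * (b - n) - (a + v * (n - a))))
      (div_nonneg (by linarith) hpos.le) (div_nonneg (by linarith) hpos.le)
      (by rw [← add_div, div_eq_one_iff_eq hpos.ne']; ring)
    convert this using 1
    simp only [Prod.smul_mk, Prod.mk_add_mk, smul_eq_mul, Prod.mk.injEq]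
    have hne := hpos.ne'
    constructor <;> field_simp <;> ring

theorem mem_slanted'_edge_line {m n : ℤ} {x : ℝ × ℝ} :
    x ∈ edge (2 * m) n (2 * m + sgn f n) (nextIdx f n) ↔ 0 < sgn f n * (x.1 - 2 * m) ∧
      sgn f n * (x.1 - 2 * m) < 1 ∧ x.2 = line f n (sgn f n * (x.1 - 2 * m)) := by
  have hs := sgn_mul_self (f := f) n
  rw [mem_edge]
  constructor
  · rintro ⟨t, h0, h1, rfl⟩
    have e : (sgn f n : ℝ) * ((2 * m : ℤ) + t * ((2 * m + sgn f n : ℤ) - (2 * m : ℤ)) - 2 * m) =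
        t := by
      push_cast
      linear_combination t * hs
    simp only [e, line, and_true]
    exact ⟨h0, h1⟩
  · rintro ⟨h0, h1, h⟩
    refine ⟨_, h0, h1, ?_⟩
    ext
    · push_cast
      linear_combination (2 * (m : ℝ) - x.1) * hs
    · exact h

/-- The position of a point between two vertical lines determines the letter. -/
theorem side_unique {m m' n n' : ℤ} {x : ℝ} (h0 : 0 < sgn f n * (x - 2 * m))
    (h1 : sgn f n * (x - 2 * m) < 1) (h0' : 0 < sgn f n' * (x - 2 * m'))
    (h1' : sgn f n' * (x - 2 * m') < 1) : f n = f n' ∧ m = m' ∧ sgn f n = sgn f n' := by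
  have key : ∀ {i j : ℤ}, (i : ℝ) < x → x < i + 1 → (j : ℝ) < x → x < j + 1 → i = j := by
    intro i j a b c d
    exact (IsKnots.floor_eq a b).symm.trans (IsKnots.floor_eq c d)
  rcases R_or_L (f n) with h | h <;> rcases R_or_L (f n') with h' | h'
  · rw [sgn_R h] at h0 h1
    rw [sgn_R h'] at h0' h1'
    push_cast at h0 h1 h0' h1'
    have := key (i := 2 * m) (j := 2 * m') (by push_cast; linarith) (by push_cast; linarith)
      (by push_cast; linarith) (by push_cast; linarith)
    exact ⟨h.trans h'.symm, by omega, by rw [sgn_R h, sgn_R h']⟩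
  · rw [sgn_R h] at h0 h1
    rw [sgn_L h'] at h0' h1'
    push_cast at h0 h1 h0' h1'
    have := key (i := 2 * m) (j := 2 * m' - 1) (by push_cast; linarith) (by push_cast; linarith)
      (by push_cast; linarith) (by push_cast; linarith)
    omega
  · rw [sgn_L h] at h0 h1
    rw [sgn_R h'] at h0' h1'
    push_cast at h0 h1 h0' h1'
    have := key (i := 2 * m - 1) (j := 2 * m') (by push_cast; linarith) (by push_cast; linarith)
      (by push_cast; linarith) (by push_cast; linarith)
    omega
  · rw [sgn_L h] at h0 h1
    rw [sgn_L h'] at h0' h1'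
    push_cast at h0 h1 h0' h1'
    have := key (i := 2 * m - 1) (j := 2 * m' - 1) (by push_cast; linarith)
      (by push_cast; linarith) (by push_cast; linarith) (by push_cast; linarith)
    exact ⟨h.trans h'.symm, by omega, by rw [sgn_L h, sgn_L h']⟩

theorem not_int_of_side {m n : ℤ} {x : ℝ} (h0 : 0 < sgn f n * (x - 2 * m))
    (h1 : sgn f n * (x - 2 * m) < 1) (k : ℤ) : x ≠ k := by
  rintro rfl
  have h0' : (0 : ℤ) < sgn f n * (k - 2 * m) := by exact_mod_cast h0
  have h1' : sgn f n * (k - 2 * m) < (1 : ℤ) := by exact_mod_cast h1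
  omega

theorem exists_side {x : ℝ} (hf : Recurrent f) (hx : ∀ k : ℤ, x ≠ k) :
    ∃ (m n : ℤ), 0 < sgn f n * (x - 2 * m) ∧ sgn f n * (x - 2 * m) < 1 := by
  have h0 : (⌊x⌋ : ℝ) < x := lt_of_le_of_ne (Int.floor_le x) (hx _).symm
  have h1 := Int.lt_floor_add_one x
  obtain ⟨m, hm | hm⟩ := even_or_odd_cases ⌊x⌋
  · obtain ⟨n, -, hn⟩ := (hf .R 0).1
    refine ⟨m, n, ?_⟩
    rw [hm] at h0 h1
    push_cast at h0 h1
    rw [sgn_R hn]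
    push_cast
    constructor <;> linarith
  · obtain ⟨n, -, hn⟩ := (hf .L 0).1
    refine ⟨m + 1, n, ?_⟩
    rw [hm] at h0 h1
    push_cast at h0 h1
    rw [sgn_L hn]
    push_cast
    constructor <;> linarith

theorem sgn_congr {n n' : ℤ} (h : f n = f n') : sgn f n = sgn f n' := by
  unfold sgn; rw [h]

theorem cell'_disjoint (hf : Recurrent f) {m n m' n' : ℤ} {x : ℝ × ℝ} (hx : x ∈ cell' f m n)
    (hx' : x ∈ cell' f m' n') : m = m' ∧ n = n' := by
  rw [mem_cell' hf] at hx hx'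
  obtain ⟨h0, h1, h2, h3⟩ := hx
  obtain ⟨h0', h1', h2', h3'⟩ := hx'
  obtain ⟨hl, rfl, hs⟩ := side_unique h0 h1 h0' h1'
  rw [← hs] at h2' h3'
  refine ⟨rfl, ?_⟩
  have key : ∀ {i j : ℤ} {v y : ℝ}, 0 < v → v < 1 → f i = f j → i < j →
      line f (prevIdx f j) v < y → y < line f i v → False := by
    intro i j v y v0 v1 hl hij a b
    obtain ⟨p1, p2, p3⟩ := prevIdx_spec hf j
    rcases (p3 i hl hij).eq_or_lt with h | h
    · rw [h] at b; linarith
    · have := line_lt hf (hl.trans p1.symm) h v0.le v1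
      linarith
  rcases lt_trichotomy n n' with h | h | h
  · exact (key h0 h1 hl h h2' h3).elim
  · exact h
  · exact (key h0 h1 hl.symm h h2 h3').elim

theorem isOpen_cell' (m n : ℤ) : IsOpen (cell' f m n) := by
  rw [cell'_eq]; exact isOpen_interior

theorem isConnected_cell' (hf : Recurrent f) (m n : ℤ) : IsConnected (cell' f m n) := by
  refine ⟨?_, ?_⟩
  · have hs := sgn_mul_self (f := f) n
    have hlt := line_lt hf (prevIdx_spec hf n).1 (prevIdx_spec hf n).2.1
      (v := 1 / 2) (by norm_num) (by norm_num)
    refine ⟨(2 * m + sgn f n * (1 / 2),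
      (line f (prevIdx f n) (1 / 2) + line f n (1 / 2)) / 2), (mem_cell' hf m n _).2 ?_⟩
    have e : (sgn f n : ℝ) * (2 * m + sgn f n * (1 / 2) - 2 * m) = 1 / 2 := by
      linear_combination (1 / 2) * hs
    simp only [e]
    refine ⟨by norm_num, by norm_num, by linarith, by linarith⟩
  · rw [cell'_eq]
    exact (convex_convexHull ℝ _).interior.isPreconnected

/-- Vertical lines cut the plane into strips, each crossed by the slanted edges of a single letter,
stacked in order. The cells are the gaps between successive ones. -/
theorem compl_skeleton' (hf : Recurrent f) :
    (skeleton' f)ᶜ = ⋃₀ {c | ∃ m n, c = cell' f m n} := by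
  ext x
  constructor
  · intro hx
    have hint : ∀ k : ℤ, x.1 ≠ k := by
      intro k hk
      apply hx
      have hy := Int.floor_add_fract x.2
      rcases (Int.fract_nonneg x.2).eq_or_lt with h | h
      · exact Or.inl ⟨k, ⌊x.2⌋, by ext <;> simp only [pt]; exacts [hk, by linarith]⟩
      · refine Or.inr ⟨_, Or.inl ⟨k, ⌊x.2⌋, rfl⟩, mem_edge.2
          ⟨Int.fract x.2, h, Int.fract_lt_one _, ?_⟩⟩
        ext
        · simp [hk]
        · push_cast; linarith
    obtain ⟨m, n₀, h0, h1⟩ := exists_side hf hint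
    obtain ⟨v, hv⟩ : ∃ v, v = (sgn f n₀ : ℝ) * (x.1 - 2 * m) := ⟨_, rfl⟩
    rw [← hv] at h0 h1
    have hne : ∀ n, f n = f n₀ → x.2 ≠ line f n v := by
      intro n hn h
      apply hx
      refine Or.inr ⟨_, Or.inr (by rw [slanted'_eq]; exact ⟨m, n, rfl⟩),
        mem_slanted'_edge_line.2 ?_⟩
      rw [sgn_congr hn, ← hv]
      exact ⟨h0, h1, h⟩
    -- The highest slanted edge below the point starts at level `i`; the cell is therefore indexed
    -- by the next occurrence of the letter.
    obtain ⟨i, ⟨hi, hix⟩, hmax⟩ := Int.exists_greatest_of_bdd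
      (P := fun n => f n = f n₀ ∧ line f n v < x.2)
      ⟨⌈x.2⌉, fun n hn => by
        have h2 := (line_bounds hf n h0.le h1.le).1
        have h3 : (n : ℝ) ≤ ⌈x.2⌉ := by linarith [hn.2, Int.le_ceil x.2]
        exact_mod_cast h3⟩
      (by
        obtain ⟨j, hj, hjl⟩ := (hf (f n₀) ⌊x.2⌋).1
        obtain ⟨p1, p2, -⟩ := prevIdx_spec hf j
        refine ⟨prevIdx f j, p1.trans hjl, ?_⟩
        have h2 := (line_bounds hf (prevIdx f j) h0.le h1.le).2
        rw [nextIdx_prevIdx hf] at h2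
        have h3 : (j : ℝ) < ⌊x.2⌋ := by exact_mod_cast hj
        linarith [Int.floor_le x.2])
    obtain ⟨q1, q2, -⟩ := nextIdx_spec hf i
    have hprev : prevIdx f (nextIdx f i) = i := by
      obtain ⟨p1, p2, p3⟩ := prevIdx_spec hf (nextIdx f i)
      have h3 := p3 i q1.symm q2
      rcases h3.eq_or_lt with h | h
      · exact h.symm
      · have := (nextIdx_spec hf i).2.2 _ (p1.trans q1) h
        omega
    refine ⟨_, ⟨m, nextIdx f i, rfl⟩, (mem_cell' hf _ _ _).2 ?_⟩
    have hl := q1.trans hi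
    rw [hprev, sgn_congr hl, ← hv]
    refine ⟨h0, h1, hix, lt_of_le_of_ne (not_lt.1 fun h => ?_) (hne _ hl)⟩
    have := hmax _ ⟨hl, h⟩
    omega
  · rintro ⟨_, ⟨m, n, rfl⟩, hx⟩
    rw [mem_cell' hf] at hx
    obtain ⟨h0, h1, h2, h3⟩ := hx
    rintro (⟨k, l, rfl⟩ | ⟨e, ⟨k, l, rfl⟩ | he, hx⟩)
    · exact not_int_of_side h0 h1 k rfl
    · obtain ⟨t, -, -, rfl⟩ := mem_edge.1 hx
      exact not_int_of_side h0 h1 k (by simp)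
    · rw [slanted'_eq] at he
      obtain ⟨m', n', rfl⟩ := he
      obtain ⟨h0', h1', h2'⟩ := mem_slanted'_edge_line.1 hx
      obtain ⟨hl, rfl, hs⟩ := side_unique h0 h1 h0' h1'
      rw [← hs] at h2'
      obtain ⟨p1, p2, p3⟩ := prevIdx_spec hf n
      rcases lt_or_ge n' n with h | h
      · rcases (p3 n' hl.symm h).eq_or_lt with h' | h'
        · rw [h'] at h2'; linarith
        · have := line_lt hf (hl.symm.trans p1.symm) h' h0.le h1
          linarith
      · rcases h.eq_or_lt with h' | h'
        · rw [← h'] at h2'; linarith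
        · have := line_lt hf hl h' h0.le h1
          linarith

theorem components_compl_skeleton' (hf : Recurrent f) :
    components (skeleton' f)ᶜ = {c | ∃ m n, c = cell' f m n} := by
  rw [compl_skeleton' hf]
  apply components_sUnion
  · rintro _ ⟨m, n, rfl⟩; exact isOpen_cell' m n
  · rintro _ ⟨m, n, rfl⟩; exact isConnected_cell' hf m n
  · rintro _ ⟨m, n, rfl⟩ _ ⟨m', n', rfl⟩ x hx hx'
    obtain ⟨rfl, rfl⟩ := cell'_disjoint hf hx hx'
    rfl

end Faces

/-! ### The isomorphism onto `CW*(φ)` -/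

section CWIso

variable {f : ℤ → Letter}

theorem P_two_mul (m n : ℤ) : P f (2 * m) n = Q f (3 * m + 1) n := by
  rw [P, if_pos (by omega), Q_three_mul, Q_one, MulAut.conj_apply,
    show 2 * m / 2 = m by omega]

/-- The element `CBC⁻¹` is sent by `autR` to `C`, and by `autL` to `CBABC = DAD⁻¹`, which has index
`3` in the sequence. This is where the two values of `d` come from. -/
theorem P_two_mul_add_one (m n : ℤ) : P f (2 * m + 1) n = Q f (3 * m + d f n) n := by
  rw [P, if_neg (by omega), Q_three_mul, MulAut.conj_apply, MulAut.conj_apply,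
    show (2 * m + 1) / 2 = m by omega]
  congr 2
  have hC : (C : Orb)⁻¹ = C := inv_eq_of_mul_eq_one_left C_sq
  rcases R_or_L (f n) with h | h
  · rw [d_R h, Q_two, F_apply_of_R h, map_mul autR, map_mul autR, map_inv, autR_B,
      autR_C]
    congr 1
    rw [inv_eq_of_mul_eq_one_left B_sq, ← mul_assoc, ← mul_assoc, B_sq, one_mul, mul_assoc,
      B_sq, mul_one]
  · rw [d_L h, show (3 : ℤ) = 0 + 3 by norm_num, Q_add_three, Q_zero, F_apply_of_L h,
      map_mul autL, map_mul autL, map_inv, autL_B, autL_C]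
    have hD : D * F f (n - 1) A * D⁻¹ = F f (n - 1) (D * A * D⁻¹) := by
      rw [map_mul, map_mul, map_inv, F_D]
    rw [hD]
    congr 1
    rw [D, _root_.mul_inv_rev, _root_.mul_inv_rev, inv_eq_of_mul_eq_one_left A_sq,
      inv_eq_of_mul_eq_one_left B_sq, hC]
    have e : C * B * A * A * (A * (B * C)) = C * B * (A * A) * (A * (B * C)) := by group
    rw [e, A_sq, mul_one]
    group

theorem vertical'_slanted'_disjoint {e e' : Set (ℝ × ℝ)} (he : e ∈ vertical')
    (he' : e' ∈ slanted' f) {x : ℝ × ℝ} (hx : x ∈ e) : x ∉ e' := by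
  obtain ⟨k, l, rfl⟩ := he
  rw [slanted'_eq] at he'
  obtain ⟨m, n, rfl⟩ := he'
  intro hx'
  obtain ⟨h0, h1, -⟩ := mem_slanted'_edge_line.1 hx'
  obtain ⟨t, -, -, rfl⟩ := mem_edge.1 hx
  exact not_int_of_side h0 h1 k (by simp)

theorem CWStar_edges :
    (CWStar f).edges = Set.image (Collapse.mk (slanted' f)) '' vertical' := by
  change Set.image (Collapse.mk (slanted' f)) '' ((vertical' ∪ slanted' f) \ slanted' f) = _
  congr 1
  ext e
  constructor
  · rintro ⟨h | h, h1⟩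
    · exact h
    · exact absurd h h1
  · intro h
    obtain ⟨x, hx⟩ : e.Nonempty := by
      rw [vertical'_eq (f := f)] at h
      obtain ⟨n, k, rfl⟩ := h
      exact openKnot_nonempty _ _ _
    exact ⟨Or.inl h, fun h' => vertical'_slanted'_disjoint h h' hx hx⟩

theorem CWStarStar_edges :
    (CWStarStar f).edges = Set.image (Collapse.mk (slanted f)) '' vertical f := by
  change Set.image (Collapse.mk (slanted f)) ''
    (((horizontal ∪ vertical f ∪ slanted f) \ horizontal) \ slanted f) = _
  congr 1
  ext e
  constructor
  · rintro ⟨⟨(h | h) | h, h1⟩, h2⟩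
    · exact absurd h h1
    · exact h
    · exact absurd h h2
  · intro h
    obtain ⟨x, hx⟩ := edge_nonempty (f := f) (Or.inl (Or.inr h))
    exact ⟨⟨Or.inl (Or.inr h), fun h' => horizontal_disjoint h' (Or.inl h) hx hx⟩,
      fun h' => vertical_slanted_disjoint h h' hx hx⟩

theorem CWStarStar_faces : (CWStarStar f).faces =
    Set.image (Collapse.mk (slanted f)) '' components (skeleton f)ᶜ := by
  change Set.image (Collapse.mk (slanted f)) '' ((CWDelta f).removeEdges horizontal).faces = _
  congr 1
  rw [CWDelta, show horizontal ∪ vertical f ∪ slanted f = (vertical f ∪ slanted f) ∪ horizontal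
    from by rw [Set.union_assoc, Set.union_comm], removeEdges_planar_faces]
  · rfl
  · rintro s hs x hx ⟨m, n, rfl⟩
    exact pt_not_mem_horizontal hs m n hx
  · rintro s hs e he x hx hx'
    exact horizontal_disjoint hs he hx hx'

/-- Edges correspond by `image_vertical`, faces as components of the complements of the skeleta. For
the vertices, every lattice point is first moved down its slanted edges to some `(3 * m + 1, i)`. -/
theorem exists_cw_iso (hf : Recurrent f) {g : ℝ × ℝ ≃ₜ ℝ × ℝ} (hg : IsStraightening f g) :
    ∃ h : CellIso (CWStarStar f) (CWStar f), ∀ x,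
      h.toHomeomorph (Collapse.mk (slanted f) x) = Collapse.mk (slanted' f) (g x) := by
  obtain ⟨h, hh⟩ := exists_collapse_homeomorph hf hg
  have himage : ∀ U : Set (ℝ × ℝ),
      h '' (Collapse.mk (slanted f) '' U) = Collapse.mk (slanted' f) '' (g '' U) := by
    intro U
    rw [Set.image_image, Set.image_image]
    simp only [hh]
  have hfam : ∀ S : Set (Set (ℝ × ℝ)),
      Set.image h '' (Set.image (Collapse.mk (slanted f)) '' S) =
        Set.image (Collapse.mk (slanted' f)) '' (Set.image g '' S) := by
    intro S
    rw [Set.image_image, Set.image_image]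
    simp only [himage]
  refine ⟨⟨h, ?_, ?_, ?_⟩, hh⟩
  · change h '' (Collapse.mk (slanted f) '' {x | ∃ m n, x = pt m n}) =
      Collapse.mk (slanted' f) '' {x | ∃ m n, x = pt m n}
    apply Set.Subset.antisymm
    · rintro _ ⟨_, ⟨_, ⟨j, n, rfl⟩, rfl⟩, rfl⟩
      rw [mk_pt_eq hf, hh, hg.pt_even]
      exact ⟨_, ⟨_, _, rfl⟩, rfl⟩
    · rintro _ ⟨_, ⟨M, n, rfl⟩, rfl⟩
      obtain ⟨m, rfl | rfl⟩ := even_or_odd_cases M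
      · rw [← hg.pt_even, ← hh]
        exact ⟨_, ⟨_, ⟨_, _, rfl⟩, rfl⟩, rfl⟩
      · rw [← hg.pt_odd hf, ← hh]
        exact ⟨_, ⟨_, ⟨_, _, rfl⟩, rfl⟩, rfl⟩
  · rw [CWStarStar_edges, CWStar_edges, ← hg.image_vertical]
    exact hfam _
  · rw [CWStarStar_faces]
    change Set.image h '' _ = Set.image (Collapse.mk (slanted' f)) '' {c | ∃ m n, c = cell' f m n}
    rw [hfam, image_components, Set.image_compl_eq g.bijective, hg.image_skeleton hf,
      components_compl_skeleton' hf]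

/-- The vertices of `CW*(φ)` are identified with the elements `P_{m,n}`. -/
theorem mk_eq_iff_P_eq (hf : Recurrent f) {g : ℝ × ℝ ≃ₜ ℝ × ℝ} (hg : IsStraightening f g)
    {u : Collapse (slanted f) → Orb → ℝ} (hu : Function.Injective u)
    (hpt : ∀ m n : ℤ, u (Collapse.mk (slanted f) (pt m n)) = Set.indicator {Q f m n} 1)
    (M n M' n' : ℤ) :
    Collapse.mk (slanted' f) (pt M n) = Collapse.mk (slanted' f) (pt M' n') ↔
      P f M n = P f M' n' := by
  have key : ∀ M n, ∃ j, g (pt j n) = pt M n ∧ P f M n = Q f j n := by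
    intro M n
    obtain ⟨m, rfl | rfl⟩ := even_or_odd_cases M
    · exact ⟨_, hg.pt_even m n, P_two_mul m n⟩
    · exact ⟨_, hg.pt_odd hf m n, P_two_mul_add_one m n⟩
  obtain ⟨j, e, eP⟩ := key M n
  obtain ⟨j', e', eP'⟩ := key M' n'
  -- Equality in the collapse of `CW'(φ)` is pulled back to the collapse of `CWΔ(φ)`, where the
  -- barycentric coordinates `u` separate points.
  rw [← e, ← e', ← hg.mk_eq_iff hf, eP, eP', ← hu.eq_iff, hpt, hpt]
  exact vert_injective.eq_iff

end CWIso

end PTB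

theorem proposition8p7 (φ : Matrix.SpecialLinearGroup (Fin 2) ℤ)
    (hφ : 2 < |φ 0 0 + φ 1 1|)
    (μm μp : ℝ) (hμm : IsRepulsive φ μm) (hμp : IsAttractive φ μp)
    (σ : ℤ → Set (OnePoint ℚ)) (hσ : IsFareySequence φ μm μp σ)
    (hσ₀ : σ 0 = {OnePoint.some 0, OnePoint.infty, OnePoint.some (-1)})
    (hσ₁ : σ 1 = {OnePoint.some 0, OnePoint.some 1, OnePoint.infty})
    (f : ℤ → Letter) (hf : f = turn μm μp σ)
    (hf₀ : f 0 = Letter.L) (hf₁ : f 1 = Letter.R) :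
    -- (1)
    (∃ h : CellIso (DeltaStarStar f) (simplicialCells (DeltaStar σ)),
      (∀ m n : ℤ, (h.toHomeomorph (Collapse.mk (slanted f) (pt m n))).1 =
        Set.indicator {Q f m n} 1) ∧
      -- hence the same holds for every cell decomposition isomorphic to `Δ*(φ)`
      ∀ (Y : Type) [TopologicalSpace Y] (K : CellDecomp Y)
        (θ : CellIso (simplicialCells (DeltaStar σ)) K),
        ∃ h' : CellIso (DeltaStarStar f) K, ∀ x, h'.toHomeomorph x =
          θ.toHomeomorph (h.toHomeomorph x)) ∧
    -- (2), preceded by the identification of the vertex `[(m, n)]` of `CW*(φ)` with `P_{m,n}`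
    (∀ m n m' n' : ℤ, Collapse.mk (slanted' f) (pt m n) = Collapse.mk (slanted' f) (pt m' n') ↔
      P f m n = P f m' n') ∧
    (∃ h : CellIso (CWStarStar f) (CWStar f),
      (∀ m n : ℤ, h.toHomeomorph (Collapse.mk (slanted f) (pt (3 * m + 1) n)) =
          Collapse.mk (slanted' f) (pt (2 * m) n) ∧
        h.toHomeomorph (Collapse.mk (slanted f) (pt (3 * m + d f n) n)) =
          Collapse.mk (slanted' f) (pt (2 * m + 1) n)) ∧
      -- hence the same holds for every cell decomposition isomorphic to `CW*(φ)`
      ∀ (Y : Type) [TopologicalSpace Y] (K : CellDecomp Y) (θ : CellIso (CWStar f) K),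
        ∃ h' : CellIso (CWStarStar f) K, ∀ x, h'.toHomeomorph x =
          θ.toHomeomorph (h.toHomeomorph x)) := by
  have hrec : Recurrent f := letters_unbounded hμm hμp hσ hf hf₀ hf₁
  have hK : IsStar f (DeltaStar σ) :=
    isStar_DeltaStar hrec (farey_eq_tri hφ hμm hμp hσ hσ₀ hσ₁ hf) hσ.isFareyTriangle
  obtain ⟨h₁, hpt, -⟩ := exists_star_iso hrec hK
  obtain ⟨g, hg⟩ := exists_plane_homeomorph hrec
  obtain ⟨h₂, hh₂⟩ := exists_cw_iso hrec hg
  refine ⟨⟨h₁, hpt, fun Y _ K θ => ⟨h₁.trans θ, fun _ => rfl⟩⟩,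
    mk_eq_iff_P_eq hrec hg (u := fun x => (h₁.toHomeomorph x).1)
      (Subtype.val_injective.comp h₁.toHomeomorph.injective) hpt,
    h₂, fun m n => ⟨?_, ?_⟩, fun Y _ K θ => ⟨h₂.trans θ, fun _ => rfl⟩⟩
  · rw [hh₂, IsStraightening.pt_even hg]
  · rw [hh₂, IsStraightening.pt_odd hrec hg]
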